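/- Write $|x|=|x_1|+\dots+|x_d|$ for $x\in\mathbb R^d$ or $x\in\mathbb Z^d$ and $\widehat f(\xi)=\int_{\mathbb R^d} e^{-i x\cdot\xi}f(x)\,dx$. Let $\mathscr S_m(\mathbb R^d)$ be the Gelfand–Shilov space of all $f\in C^\infty(\mathbb R^d;\mathbb C)$ such that, for every $\lambda>0$, $$p_\lambda(f)=\sup_{x}e^{\lambda|x|}|f(x)|<\infty,\qquad q_\lambda(f)=\sup_{\xi}e^{\lambda|\xi|}|\widehat f(\xi)|<\infty,$$ with the locally convex topology generated by the seminorms $p_\lambda,q_\lambda$ $(\lambda>0)$, and let $\mathscr S_m'$ be its dual, the space of continuous linear functionals on $\mathscr S_m$. For $s\in\mathbb R$ and $1\le p,q\le\infty$ let $E^s_{p,q}=E^s_{p,q}(\mathbb R^d)$ be the space of all $f\in\mathscr S_m'$ for which there are $f_k\in L^p(\mathbb R^d)$, $k\in\mathbb Z^d$, with $$\operatorname{supp}\widehat{f_k}\subset k+[-3/2,3/2]^d,\qquad f=\sum_{k\in\mathbb Z^d}f_k\ \text{ in }\mathscr S_m',\qquad \big\|\{2^{s|k|}f_k\}_k\big\|_{\ell^q(L^p)}<\infty,$$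 where $f_k\in L^p$ acts on $\varphi\in\mathscr S_m$ by $\int f_k\varphi\,dx$. Put $$\|f\|_{E^s_{p,q}}=\inf\big\|\{2^{s|k|}f_k\}_k\big\|_{\ell^q(L^p)},$$ the infimum being taken over all such decompositions of $f$. Let $\frac1p+\frac1{p'}=1=\frac1q+\frac1{q'}$. (Duality) Let $s\in\mathbb R$ and $1\le p,q<\infty$. Then $(E^s_{p,q})^*=E^{-s}_{p',q'}$ with equivalent norms. That is, $\mathscr S_m\subset E^s_{p,q}$ (a function $\varphi\in\mathscr S_m$ being identified with the functional $\psi\mapsto\int\varphi\psi\,dx$), and assigning to $L\in(E^s_{p,q})^*$ its restriction to $\mathscr S_m$ is a linear homeomorphism of $(E^s_{p,q})^*$ onto $E^{-s}_{p',q'}$. (Completeness) Let $s\in\mathbb R$ and $1\le p,q\le\infty$. Then $\|\cdot\|_{E^s_{p,q}}$ is a complete norm on $E^s_{p,q}$, i.e. $E^s_{p,q}$ is a Banach space. -/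

import Mathlib

open MeasureTheory Filter Topology FourierTransform SchwartzMap
open scoped ENNReal

noncomputable section

namespace ExpModulation

/-- The space `ℝ^d` with its Lebesgue measure. -/
abbrev Rd (d : ℕ) : Type := EuclideanSpace ℝ (Fin d)

/-- `|x| = |x_1| + ... + |x_d|` on `ℝ^d`. -/
def absOne {d : ℕ} (x : Rd d) : ℝ := ∑ i, |x i|

/-- `|k| = |k_1| + ... + |k_d|` on `ℤ^d`. -/
def absOneInt {d : ℕ} (k : Fin d → ℤ) : ℝ := ∑ i, |(k i : ℝ)|

/-- The Fourier transform in the angular-frequency convention,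
`ξ ↦ ∫ f(x) exp(-i x·ξ) dx` (Mathlib's transform uses `exp(-2π i x·ξ)`). -/
def angFourier {d : ℕ} (f : Rd d → ℂ) (ξ : Rd d) : ℂ := 𝓕 f ((2 * Real.pi)⁻¹ • ξ)

/-! ### The Gelfand-Shilov space of Beurling type and its dual -/

/-- `f` is smooth and, for every `l > 0`, both `exp(l|x|) |f(x)|` and `exp(l|ξ|) |f̂(ξ)|`
are bounded. -/
structure IsGelfandShilov {d : ℕ} (f : Rd d → ℂ) : Prop where
  smooth : ContDiff ℝ (⊤ : ℕ∞) f
  decay : ∀ l : ℝ, 0 < l → ∃ C : ℝ, ∀ x, Real.exp (l * absOne x) * ‖f x‖ ≤ C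
  decayFourier : ∀ l : ℝ, 0 < l →
    ∃ C : ℝ, ∀ ξ, Real.exp (l * absOne ξ) * ‖angFourier f ξ‖ ≤ C

lemma norm_le_absOne {d : ℕ} (x : Rd d) : ‖x‖ ≤ absOne x := by
  have h0 : 0 ≤ absOne x := Finset.sum_nonneg fun i _ => abs_nonneg _
  rw [EuclideanSpace.norm_eq]
  refine Real.sqrt_le_iff.2 ⟨h0, ?_⟩
  have := Finset.sum_sq_le_sq_sum_of_nonneg (s := Finset.univ) (f := fun i => |x i|)
    (fun i _ => abs_nonneg _)
  simpa [absOne] using this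

lemma IsGelfandShilov.norm_le {d : ℕ} {f : Rd d → ℂ} (hf : IsGelfandShilov f) :
    ∃ C : ℝ, 0 ≤ C ∧ ∀ x, ‖f x‖ ≤ C * (1 + ‖x‖) ^ (-((d : ℝ) + 1)) := by
  obtain ⟨C, hC⟩ := hf.decay (d + 1) (by positivity)
  have hC0 : 0 ≤ C := le_trans (by positivity) (hC 0)
  refine ⟨C, hC0, fun x => ?_⟩
  have hpos : 0 < (1 + ‖x‖) ^ ((d : ℝ) + 1) := by positivity
  have h1 : (1 + ‖x‖) ^ ((d : ℝ) + 1) ≤ Real.exp ((d + 1) * absOne x) := by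
    have h2 : 1 + ‖x‖ ≤ Real.exp (absOne x) := by
      have := Real.add_one_le_exp (absOne x)
      have := norm_le_absOne x
      linarith
    calc (1 + ‖x‖) ^ ((d : ℝ) + 1) ≤ (Real.exp (absOne x)) ^ ((d : ℝ) + 1) :=
          Real.rpow_le_rpow (by positivity) h2 (by positivity)
      _ = _ := by rw [← Real.exp_mul, mul_comm]
  rw [Real.rpow_neg (by positivity), ← div_eq_mul_inv, le_div_iff₀ hpos, mul_comm]
  exact (mul_le_mul_of_nonneg_right h1 (norm_nonneg _)).trans (hC x)

lemma IsGelfandShilov.memLp {d : ℕ} {f : Rd d → ℂ} (hf : IsGelfandShilov f) {r : ℝ≥0∞}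
    (hr : 1 ≤ r) : MemLp f r volume := by
  obtain ⟨C, hC0, hC⟩ := hf.norm_le
  have hm : AEStronglyMeasurable f volume := hf.smooth.continuous.aestronglyMeasurable
  by_cases hrt : r = ∞
  · subst hrt
    refine memLp_top_of_bound hm C (Eventually.of_forall fun x => (hC x).trans ?_)
    refine mul_le_of_le_one_right hC0 ?_
    exact Real.rpow_le_one_of_one_le_of_nonpos (by linarith [norm_nonneg x])
      (by linarith [(Nat.cast_nonneg d : (0 : ℝ) ≤ d)])
  have hr0 : r ≠ 0 := (zero_lt_one.trans_le hr).ne'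
  have hr1 : 1 ≤ r.toReal := by
    simpa using (ENNReal.toReal_le_toReal ENNReal.one_ne_top hrt).2 hr
  rw [← integrable_norm_rpow_iff hm hr0 hrt]
  have hint : Integrable
      (fun x : Rd d => C ^ r.toReal * (1 + ‖x‖) ^ (-(((d : ℝ) + 1) * r.toReal))) volume := by
    refine (integrable_one_add_norm ?_).const_mul _
    rw [finrank_euclideanSpace_fin]
    nlinarith [(Nat.cast_nonneg d : (0 : ℝ) ≤ d)]
  refine hint.mono (hm.norm.aemeasurable.pow_const _).aestronglyMeasurable (Eventually.of_forall fun x => ?_)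
  have h := Real.rpow_le_rpow (norm_nonneg _) (hC x) (zero_le_one.trans hr1)
  rw [Real.mul_rpow hC0 (by positivity), ← Real.rpow_mul (by positivity), neg_mul] at h
  rw [Real.norm_of_nonneg (by positivity), Real.norm_of_nonneg (by positivity)]
  exact h

lemma IsGelfandShilov.integrable {d : ℕ} {f : Rd d → ℂ} (hf : IsGelfandShilov f) :
    Integrable f volume := memLp_one_iff_integrable.1 (hf.memLp le_rfl)

lemma angFourier_add {d : ℕ} {f g : Rd d → ℂ} (hf : Integrable f volume)
    (hg : Integrable g volume) (ξ : Rd d) :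
    angFourier (f + g) ξ = angFourier f ξ + angFourier g ξ := by
  have := congrFun (VectorFourier.fourierIntegral_add Real.continuous_fourierChar
    (L := innerₗ (Rd d)) continuous_inner hf hg) ((2 * Real.pi)⁻¹ • ξ)
  exact this

lemma angFourier_smul {d : ℕ} (c : ℂ) (f : Rd d → ℂ) (ξ : Rd d) :
    angFourier (c • f) ξ = c * angFourier f ξ :=
  congrFun (VectorFourier.fourierIntegral_const_smul Real.fourierChar volume
    (innerₗ (Rd d)) f c) ((2 * Real.pi)⁻¹ • ξ)

/-- The functions of Gelfand-Shilov type, as a vector space. -/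
def gelfandShilovSubmodule (d : ℕ) : Submodule ℂ (Rd d → ℂ) where
  carrier := {f | IsGelfandShilov f}
  zero_mem' := by
    refine ⟨contDiff_const, fun l _ => ⟨0, by simp⟩, fun l _ => ⟨0, fun ξ => ?_⟩⟩
    have := angFourier_smul (0 : ℂ) (0 : Rd d → ℂ) ξ
    rw [zero_smul, zero_mul] at this
    simp [this]
  add_mem' := by
    intro f g hf hg
    refine ⟨hf.smooth.add hg.smooth, fun l hl => ?_, fun l hl => ?_⟩
    · obtain ⟨C, hC⟩ := hf.decay l hl
      obtain ⟨D, hD⟩ := hg.decay l hl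
      refine ⟨C + D, fun x => ?_⟩
      calc _ ≤ Real.exp (l * absOne x) * (‖f x‖ + ‖g x‖) := by
            gcongr; exact norm_add_le _ _
        _ ≤ C + D := by rw [mul_add]; exact add_le_add (hC x) (hD x)
    · obtain ⟨C, hC⟩ := hf.decayFourier l hl
      obtain ⟨D, hD⟩ := hg.decayFourier l hl
      refine ⟨C + D, fun x => ?_⟩
      rw [angFourier_add hf.integrable hg.integrable]
      calc _ ≤ Real.exp (l * absOne x) * (‖angFourier f x‖ + ‖angFourier g x‖) := by
            gcongr; exact norm_add_le _ _
        _ ≤ C + D := by rw [mul_add]; exact add_le_add (hC x) (hD x)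
  smul_mem' := by
    intro c f hf
    refine ⟨contDiff_const.smul hf.smooth, fun l hl => ?_, fun l hl => ?_⟩
    · obtain ⟨C, hC⟩ := hf.decay l hl
      refine ⟨‖c‖ * C, fun x => ?_⟩
      rw [Pi.smul_apply, norm_smul, mul_left_comm]
      exact mul_le_mul_of_nonneg_left (hC x) (norm_nonneg _)
    · obtain ⟨C, hC⟩ := hf.decayFourier l hl
      refine ⟨‖c‖ * C, fun x => ?_⟩
      rw [angFourier_smul, norm_mul, mul_left_comm]
      exact mul_le_mul_of_nonneg_left (hC x) (norm_nonneg _)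

/-- The Gelfand-Shilov space `𝒮_1 = 𝒮_m` of Beurling type on `ℝ^d`. It is a type of its own,
so that it does not carry the topology of pointwise convergence. -/
def GelfandShilov (d : ℕ) : Type := gelfandShilovSubmodule d

namespace GelfandShilov

variable {d : ℕ}

instance : AddCommGroup (GelfandShilov d) :=
  inferInstanceAs (AddCommGroup (gelfandShilovSubmodule d))

instance : Module ℂ (GelfandShilov d) :=
  inferInstanceAs (Module ℂ (gelfandShilovSubmodule d))

instance : CoeFun (GelfandShilov d) (fun _ => Rd d → ℂ) := ⟨fun φ => φ.1⟩

lemma isGelfandShilov (φ : GelfandShilov d) : IsGelfandShilov φ := φ.2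

@[simp] lemma coe_add (φ ψ : GelfandShilov d) : (φ + ψ : GelfandShilov d).1 = φ.1 + ψ.1 := rfl

@[simp] lemma coe_smul (c : ℂ) (φ : GelfandShilov d) : (c • φ : GelfandShilov d).1 = c • φ.1 :=
  rfl

/-- A weighted sup seminorm, from a linear family of evaluations with bounded weighted values. -/
def supSeminorm (T : GelfandShilov d → Rd d → ℂ) (w : Rd d → ℝ) (hw : ∀ x, 0 ≤ w x)
    (hadd : ∀ φ ψ x, T (φ + ψ) x = T φ x + T ψ x) (hsmul : ∀ (c : ℂ) φ x, T (c • φ) x = c * T φ x)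
    (hbdd : ∀ φ, ∃ C : ℝ, ∀ x, w x * ‖T φ x‖ ≤ C) : Seminorm ℂ (GelfandShilov d) :=
  Seminorm.of (fun φ => ⨆ x, w x * ‖T φ x‖)
    (fun φ ψ => by
      have hb : ∀ φ, BddAbove (Set.range fun x => w x * ‖T φ x‖) := fun φ => by
        obtain ⟨C, hC⟩ := hbdd φ
        exact ⟨C, by rintro _ ⟨x, rfl⟩; exact hC x⟩
      refine ciSup_le fun x => ?_
      calc w x * ‖T (φ + ψ) x‖ ≤ w x * ‖T φ x‖ + w x * ‖T ψ x‖ := by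
            rw [hadd, ← mul_add]
            exact mul_le_mul_of_nonneg_left (norm_add_le _ _) (hw x)
        _ ≤ _ := add_le_add (le_ciSup (hb φ) x) (le_ciSup (hb ψ) x))
    (fun c φ => by
      rw [Real.mul_iSup_of_nonneg (norm_nonneg c)]
      congr 1
      funext x
      rw [hsmul, norm_mul, mul_left_comm])

/-- `p_l(φ) = sup_x exp(l|x|) |φ(x)|`. -/
def seminormP (l : Set.Ioi (0 : ℝ)) : Seminorm ℂ (GelfandShilov d) :=
  supSeminorm (fun φ => φ) (fun x => Real.exp (l * absOne x)) (fun _ => (Real.exp_pos _).le)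
    (fun _ _ _ => rfl) (fun _ _ _ => rfl) (fun φ => φ.isGelfandShilov.decay l l.2)

/-- `q_l(φ) = sup_ξ exp(l|ξ|) |φ̂(ξ)|`. -/
def seminormQ (l : Set.Ioi (0 : ℝ)) : Seminorm ℂ (GelfandShilov d) :=
  supSeminorm (fun φ => angFourier φ) (fun ξ => Real.exp (l * absOne ξ))
    (fun _ => (Real.exp_pos _).le)
    (fun φ ψ x => angFourier_add φ.isGelfandShilov.integrable ψ.isGelfandShilov.integrable x)
    (fun c φ x => angFourier_smul c φ x)
    (fun φ => φ.isGelfandShilov.decayFourier l l.2)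

lemma seminormP_apply (l : Set.Ioi (0 : ℝ)) (φ : GelfandShilov d) :
    seminormP l φ = ⨆ x, Real.exp (l * absOne x) * ‖φ x‖ := rfl

lemma seminormQ_apply (l : Set.Ioi (0 : ℝ)) (φ : GelfandShilov d) :
    seminormQ l φ = ⨆ ξ, Real.exp (l * absOne ξ) * ‖angFourier φ ξ‖ := rfl

/-- The family of all `p_l`, `q_l` with `l > 0`. -/
def seminormFamily (d : ℕ) :
    SeminormFamily ℂ (GelfandShilov d) (Set.Ioi (0 : ℝ) ⊕ Set.Ioi (0 : ℝ)) :=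
  Sum.elim seminormP seminormQ

/-- The locally convex topology generated by the seminorms `p_l`, `q_l`. -/
instance : TopologicalSpace (GelfandShilov d) :=
  (seminormFamily d).moduleFilterBasis.topology

lemma withSeminorms (d : ℕ) : WithSeminorms (seminormFamily d) := ⟨rfl⟩

end GelfandShilov

/-- The tempered ultradistributions `𝒮'_m = 𝒮'_1`: the continuous linear functionals on the
Gelfand-Shilov space. -/
abbrev UltraDistribution (d : ℕ) : Type := GelfandShilov d →L[ℂ] ℂ

/-! ### The spaces `E^s_{p,q}` -/

/-- The cube `k + [-3/2, 3/2]^d` of angular frequencies, expressed in the frequency variable of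
Mathlib's Fourier transform (angular frequency divided by `2π`). -/
def freqCube {d : ℕ} (k : Fin d → ℤ) : Set (Rd d) :=
  {ξ | ∀ i, |2 * Real.pi * ξ i - k i| ≤ 3 / 2}

/-- The (tempered distributional) Fourier transform of `f ∈ L^p` has support in
`k + [-3/2, 3/2]^d`, that is, it vanishes on the open complement of this closed cube. -/
def HasSpectrumIn {d : ℕ} {p : ℝ≥0∞} [Fact (1 ≤ p)] (f : Lp ℂ p (volume : Measure (Rd d)))
    (k : Fin d → ℤ) : Prop :=
  Distribution.IsVanishingOn (𝓕 (Lp.toTemperedDistribution f : 𝓢'(Rd d, ℂ)) : 𝓢'(Rd d, ℂ))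
    (freqCube k)ᶜ

variable (d : ℕ) (s : ℝ) (p q : ℝ≥0∞) [Fact (1 ≤ p)] [Fact (1 ≤ q)]

/-- The weighted sequence `{2^{s|k|} f_k}`. -/
def weighted {d : ℕ} (s : ℝ) {p : ℝ≥0∞} [Fact (1 ≤ p)]
    (f : (Fin d → ℤ) → Lp ℂ p (volume : Measure (Rd d))) :
    PreLp (fun _ : Fin d → ℤ => Lp ℂ p (volume : Measure (Rd d))) :=
  fun k => ((2 : ℝ) ^ (s * absOneInt k)) • f k

/-- `u = ∑_k f_k` in `𝒮'_m` with `f_k ∈ L^p`, `supp f̂_k ⊂ k + [-3/2, 3/2]^d` and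
`{2^{s|k|} f_k} ∈ ℓ^q(L^p)`. -/
structure IsDecomposition {d : ℕ} (s : ℝ) {p : ℝ≥0∞} (q : ℝ≥0∞) [Fact (1 ≤ p)]
    (u : UltraDistribution d)
    (f : (Fin d → ℤ) → Lp ℂ p (volume : Measure (Rd d))) : Prop where
  spectrum : ∀ k, HasSpectrumIn (f k) k
  hasSum : ∀ φ : GelfandShilov d, HasSum (fun k => ∫ x, f k x * φ x) (u φ)
  memlp : Memℓp (weighted s f) q

/-- The norms `‖{2^{s|k|} f_k}‖_{ℓ^q(L^p)}` of all decompositions of `u`. -/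
def decompositionNorms {d : ℕ} (u : UltraDistribution d) : Set ℝ :=
  {r | ∃ (f : (Fin d → ℤ) → Lp ℂ p (volume : Measure (Rd d))) (h : IsDecomposition s q u f),
    r = ‖(⟨weighted s f, h.memlp⟩ :
      lp (fun _ : Fin d → ℤ => Lp ℂ p (volume : Measure (Rd d))) q)‖}

variable {d s p q}

lemma integrable_mul (f : Lp ℂ p (volume : Measure (Rd d))) (φ : GelfandShilov d) :
    Integrable (fun x => f x * φ x) volume := by
  have := ENNReal.HolderConjugate.inv_one_sub_inv' (Fact.out : 1 ≤ p)
  have h1 : (1 : ℝ≥0∞) ≤ (1 - p⁻¹)⁻¹ := by simp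
  exact (Lp.memLp f).integrable_mul (φ.isGelfandShilov.memLp h1)

lemma weighted_add (f g : (Fin d → ℤ) → Lp ℂ p (volume : Measure (Rd d))) :
    weighted s (f + g) = weighted s f + weighted s g := by
  funext k; exact smul_add _ _ _

lemma weighted_smul (c : ℂ) (f : (Fin d → ℤ) → Lp ℂ p (volume : Measure (Rd d))) :
    weighted s (c • f) = c • weighted s f := by
  funext k; exact smul_comm _ c (f k)

lemma IsDecomposition.add {u v : UltraDistribution d}
    {f g : (Fin d → ℤ) → Lp ℂ p (volume : Measure (Rd d))}
    (hf : IsDecomposition s q u f) (hg : IsDecomposition s q v g) :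
    IsDecomposition s q (u + v) (f + g) := by
  refine ⟨fun k φ hφ => ?_, fun φ => ?_, ?_⟩
  · have h : Lp.toTemperedDistribution (f k + g k) =
      Lp.toTemperedDistribution (f k) + Lp.toTemperedDistribution (g k) :=
      map_add (Lp.toTemperedDistributionCLM ℂ (volume : Measure (Rd d)) p) (f k) (g k)
    have h1 := hf.spectrum k φ hφ
    have h2 := hg.spectrum k φ hφ
    rw [TemperedDistribution.fourier_apply] at h1 h2 ⊢
    rw [Pi.add_apply, h]
    exact (congrArg₂ (· + ·) h1 h2).trans (add_zero 0)
  · convert (hf.hasSum φ).add (hg.hasSum φ) using 2 with k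
    · rw [← integral_add (integrable_mul _ _) (integrable_mul _ _)]
      refine integral_congr_ae ?_
      filter_upwards [Lp.coeFn_add (f k) (g k)] with x hx
      rw [Pi.add_apply, hx, Pi.add_apply, add_mul]
    · rfl
  · rw [weighted_add]
    exact hf.memlp.add hg.memlp

lemma IsDecomposition.smul {u : UltraDistribution d}
    {f : (Fin d → ℤ) → Lp ℂ p (volume : Measure (Rd d))}
    (hf : IsDecomposition s q u f) (c : ℂ) : IsDecomposition s q (c • u) (c • f) := by
  refine ⟨fun k φ hφ => ?_, fun φ => ?_, ?_⟩
  · have h : Lp.toTemperedDistribution (c • f k) = c • Lp.toTemperedDistribution (f k) :=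
      map_smul (Lp.toTemperedDistributionCLM ℂ (volume : Measure (Rd d)) p) c (f k)
    have h1 := hf.spectrum k φ hφ
    rw [TemperedDistribution.fourier_apply] at h1 ⊢
    rw [Pi.smul_apply, h]
    exact (congrArg (c • ·) h1).trans (smul_zero c)
  · convert (hf.hasSum φ).const_smul c using 2 with k
    · rw [← integral_smul]
      refine integral_congr_ae ?_
      filter_upwards [Lp.coeFn_smul c (f k)] with x hx
      rw [Pi.smul_apply, hx, Pi.smul_apply, smul_eq_mul, smul_eq_mul, mul_assoc]
    · rfl
  · rw [weighted_smul]
    exact hf.memlp.const_smul c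

lemma isDecomposition_zero :
    IsDecomposition s q (0 : UltraDistribution d)
      (0 : (Fin d → ℤ) → Lp ℂ p (volume : Measure (Rd d))) := by
  refine ⟨fun k φ hφ => ?_, fun φ => ?_, ?_⟩
  · have h : Lp.toTemperedDistribution (0 : Lp ℂ p (volume : Measure (Rd d))) = 0 :=
      map_zero (Lp.toTemperedDistributionCLM ℂ (volume : Measure (Rd d)) p)
    rw [TemperedDistribution.fourier_apply, Pi.zero_apply, h]
    rfl
  · convert hasSum_zero (α := ℂ) (β := Fin d → ℤ) using 2 with k
    · rw [← integral_zero (Rd d) ℂ]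
      refine integral_congr_ae ?_
      filter_upwards [Lp.coeFn_zero ℂ p (volume : Measure (Rd d))] with x hx
      rw [Pi.zero_apply, hx, Pi.zero_apply, zero_mul]
    · rfl
  · have : weighted s (0 : (Fin d → ℤ) → Lp ℂ p (volume : Measure (Rd d))) = 0 := by
      funext k; exact smul_zero _
    rw [this]
    exact zero_memℓp

variable (d s p q)

/-- The elements of `𝒮'_m` that admit a decomposition. -/
def expModSubmodule : Submodule ℂ (UltraDistribution d) where
  carrier := {u | ∃ f : (Fin d → ℤ) → Lp ℂ p (volume : Measure (Rd d)), IsDecomposition s q u f}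
  zero_mem' := ⟨0, isDecomposition_zero⟩
  add_mem' := by
    rintro u v ⟨f, hf⟩ ⟨g, hg⟩
    exact ⟨f + g, hf.add hg⟩
  smul_mem' := by
    rintro c u ⟨f, hf⟩
    exact ⟨c • f, hf.smul c⟩

/-- The space `E^s_{p,q}(ℝ^d)`. It is a type of its own, so that its topology is the one
of its norm. -/
def ExpMod : Type := expModSubmodule d s p q

namespace ExpMod

variable {d s p q}

instance : AddCommGroup (ExpMod d s p q) :=
  inferInstanceAs (AddCommGroup (expModSubmodule d s p q))

instance : Module ℂ (ExpMod d s p q) :=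
  inferInstanceAs (Module ℂ (expModSubmodule d s p q))

/-- The inclusion of `E^s_{p,q}` in `𝒮'_m`. -/
def toUltra : ExpMod d s p q →ₗ[ℂ] UltraDistribution d := (expModSubmodule d s p q).subtype

/-- `‖u‖ = inf ‖{2^{s|k|} f_k}‖_{ℓ^q(L^p)}` over all decompositions `u = ∑_k f_k`. -/
instance : Norm (ExpMod d s p q) := ⟨fun u => sInf (decompositionNorms s p q u.toUltra)⟩

lemma norm_def (u : ExpMod d s p q) : ‖u‖ = sInf (decompositionNorms s p q u.toUltra) := rfl

lemma decompositionNorms_nonempty (u : ExpMod d s p q) :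
    (decompositionNorms s p q u.toUltra).Nonempty := by
  obtain ⟨f, hf⟩ := u.2
  exact ⟨_, f, hf, rfl⟩

lemma nonneg_of_mem {u : UltraDistribution d} {r : ℝ} (hr : r ∈ decompositionNorms s p q u) :
    0 ≤ r := by
  obtain ⟨f, hf, rfl⟩ := hr
  exact norm_nonneg _

lemma bddBelow (u : UltraDistribution d) : BddBelow (decompositionNorms s p q u) :=
  ⟨0, fun _ hr => nonneg_of_mem hr⟩

lemma norm_smul_le_aux (c : ℂ) (u : ExpMod d s p q) : ‖c • u‖ ≤ ‖c‖ * ‖u‖ := by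
  rw [norm_def u, ← smul_eq_mul, ← Real.sInf_smul_of_nonneg (norm_nonneg c)]
  refine le_csInf (u.decompositionNorms_nonempty.image _) ?_
  rintro _ ⟨r, ⟨f, hf, rfl⟩, rfl⟩
  refine csInf_le (bddBelow _) ⟨c • f, ?_, ?_⟩
  · rw [map_smul]; exact hf.smul c
  · simp only [smul_eq_mul]
    rw [← norm_smul]
    congr 1
    exact Subtype.ext (weighted_smul c f).symm

/-- The infimum is a seminorm on `E^s_{p,q}`. -/
lemma seminormedCore : SeminormedSpace.Core ℂ (ExpMod d s p q) where
  norm_nonneg u := Real.sInf_nonneg fun _ hr => nonneg_of_mem hr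
  norm_smul c u := by
    refine le_antisymm (norm_smul_le_aux c u) ?_
    rcases eq_or_ne c 0 with rfl | hc
    · rw [norm_zero, zero_mul]
      exact Real.sInf_nonneg fun _ hr => nonneg_of_mem hr
    · have h := norm_smul_le_aux c⁻¹ (c • u)
      rw [inv_smul_smul₀ hc, norm_inv, inv_mul_eq_div, le_div_iff₀ (norm_pos_iff.2 hc)] at h
      rwa [mul_comm]
  norm_triangle u v := by
    rw [norm_def u, norm_def v, ← csInf_add u.decompositionNorms_nonempty (bddBelow _)
      v.decompositionNorms_nonempty (bddBelow _)]
    refine le_csInf (u.decompositionNorms_nonempty.add v.decompositionNorms_nonempty) ?_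
    rintro _ ⟨_, ⟨f, hf, rfl⟩, _, ⟨g, hg, rfl⟩, rfl⟩
    have hfg : IsDecomposition s q (toUltra (u + v)) (f + g) := by
      rw [map_add]; exact hf.add hg
    refine (csInf_le (bddBelow _) ⟨f + g, hfg, rfl⟩).trans ?_
    refine le_trans (le_of_eq ?_) (norm_add_le _ _)
    congr 1
    exact Subtype.ext (weighted_add f g)

instance : SeminormedAddCommGroup (ExpMod d s p q) :=
  SeminormedAddCommGroup.ofCore seminormedCore

instance : NormedSpace ℂ (ExpMod d s p q) where
  norm_smul_le c u := (seminormedCore.norm_smul c u).le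

end ExpMod

end ExpModulation

end

noncomputable section

namespace ExpModulation

section

/-! ### Smooth frequency cutoffs -/

/-! Completeness. A decomposition of u, multiplied by the weights, is a sequence w in `ℓ^q(L^p)`
whose k-th entry has spectrum in the k-th cube, with u = ∑ 2^{-s|k|} w_k. Thus E^s_{p,q} is the
image under `quot` of a closed subspace `spectralSeq` of a Banach space, and its norm is the
quotient norm. The series converges because an entry with spectrum near k only sees the frequencies
of φ near -k, and that part of φ has norm O(e^{-l|k|/2}) in every L^r (`exists_norm_toLp_band_le`),
which beats the weight once l is large. The resulting bound `exists_norm_seqPair_le` shows that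
elements of norm zero vanish, and absolutely convergent series are summed upstairs.

Duality, from L to a distribution (`exists_expMod_of_dual`). Pull L back to `spectralSeq`, extend it
to `ℓ^q(L^p)` by Hahn-Banach and compose each component with a narrow band operator. This operator
is a convolution, so the composite has an explicit continuous kernel, which lies in L^{p'} by a
converse Hölder inequality. These kernels, with reflected index, have the right spectra and form a
sequence in `ℓ^{q'}(L^{p'})`.

Injectivity (`VanishesOnTest.eq_zero`). Gaussian damping approximates band-limited Schwartz
functions by test functions, Schwartz functions are dense in L^p, and finitely supported sequences
are dense in ℓ^q, as p, q < ∞. So a functional vanishing on test functions is zero.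

Surjectivity (`exists_dual_of_expMod`). If v = ∑ h_m with h_m of spectrum in the m-th cube, pair h_m
with the wide band of u at -m and sum over m. That band depends on u alone and not on its
decomposition (`localPart_eq_zero`), so the sum defines a functional on the quotient. The open
mapping theorem makes the bijection a homeomorphism. -/

/-- A smooth function on the line, bounded by one and supported in `[-3, 3]`. -/
structure Cutoff where
  toFun : ℝ → ℝ
  smooth : ContDiff ℝ (⊤ : ℕ∞) toFun
  eq_zero : ∀ t, 3 ≤ |t| → toFun t = 0
  abs_le_one : ∀ t, |toFun t| ≤ 1

namespace Cutoff

variable {d : ℕ}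

lemma smoothTransition_shift_eq_zero {a b : ℝ} {t : ℝ} (h : (t + a ≤ 0 ∧ t + b ≤ 0) ∨
    (1 ≤ t + a ∧ 1 ≤ t + b)) :
    Real.smoothTransition (t + a) - Real.smoothTransition (t + b) = 0 := by
  rcases h with ⟨h1, h2⟩ | ⟨h1, h2⟩
  · rw [Real.smoothTransition.zero_of_nonpos h1, Real.smoothTransition.zero_of_nonpos h2, sub_zero]
  · rw [Real.smoothTransition.one_of_one_le h1, Real.smoothTransition.one_of_one_le h2, sub_self]

lemma abs_smoothTransition_sub_le_one (u v : ℝ) :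
    |Real.smoothTransition u - Real.smoothTransition v| ≤ 1 := by
  rw [abs_le]
  constructor <;>
  linarith [Real.smoothTransition.nonneg u, Real.smoothTransition.nonneg v,
    Real.smoothTransition.le_one u, Real.smoothTransition.le_one v]

lemma contDiff_smoothTransition_shift (a b : ℝ) : ContDiff ℝ (⊤ : ℕ∞)
    (fun t : ℝ => Real.smoothTransition (t + a) - Real.smoothTransition (t + b)) :=
  (Real.smoothTransition.contDiff.comp (contDiff_id.add contDiff_const)).sub
    (Real.smoothTransition.contDiff.comp (contDiff_id.add contDiff_const))

/-- The generator of a partition of unity over the integers, supported in `[-1, 1]`. -/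
def narrow : Cutoff where
  toFun t := Real.smoothTransition (t + 1) - Real.smoothTransition (t + 0)
  smooth := contDiff_smoothTransition_shift 1 0
  eq_zero t ht := smoothTransition_shift_eq_zero <| by
    rcases le_abs.1 ht with h | h
    · right; constructor <;> linarith
    · left; constructor <;> linarith
  abs_le_one _ := abs_smoothTransition_sub_le_one _ _

/-- A cutoff that is one on `[-2, 2]`. -/
def wide : Cutoff where
  -- The plateau [-2, 2] leaves room around the cube side [-3/2, 3/2], so the cutoff is one on a
  -- whole neighbourhood of the spectrum.
  toFun t := Real.smoothTransition (t + 3) - Real.smoothTransition (t + (-2))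
  smooth := contDiff_smoothTransition_shift 3 (-2)
  eq_zero t ht := smoothTransition_shift_eq_zero <| by
    rcases le_abs.1 ht with h | h
    · right; constructor <;> linarith
    · left; constructor <;> linarith
  abs_le_one _ := abs_smoothTransition_sub_le_one _ _

lemma wide_eq_one {t : ℝ} (ht : |t| ≤ 2) : wide.toFun t = 1 := by
  obtain ⟨h1, h2⟩ := abs_le.1 ht
  simp only [wide]
  rw [Real.smoothTransition.one_of_one_le (by linarith),
    Real.smoothTransition.zero_of_nonpos (by linarith), sub_zero]

lemma narrow_eq_zero {t : ℝ} (ht : 1 ≤ |t|) : narrow.toFun t = 0 :=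
  smoothTransition_shift_eq_zero <| by
    rcases le_abs.1 ht with h | h
    · right; constructor <;> linarith
    · left; constructor <;> linarith

lemma narrow_nonneg (t : ℝ) : 0 ≤ narrow.toFun t := by
  simp only [narrow]
  rcases le_total t 0 with h | h
  · rw [Real.smoothTransition.zero_of_nonpos (x := t + 0) (by linarith), sub_zero]
    exact Real.smoothTransition.nonneg _
  · rw [Real.smoothTransition.one_of_one_le (x := t + 1) (by linarith)]
    linarith [Real.smoothTransition.le_one (t + 0)]

/-- Each summand is a difference of two consecutive integer shifts of one step function, so the sum
telescopes. -/
lemma sum_range_narrow (t : ℝ) (n : ℕ) :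
    ∑ j ∈ Finset.range n, narrow.toFun (t - j) =
      Real.smoothTransition (t + 1) - Real.smoothTransition (t + 1 - n) := by
  induction n with
  | zero => simp
  | succ n ih =>
    rw [Finset.sum_range_succ, ih]
    simp only [narrow]
    have h1 : t - n + 1 = t + 1 - n := by ring
    have h2 : t - n + 0 = t + 1 - ((n + 1 : ℕ) : ℝ) := by push_cast; ring
    rw [h1, h2]; ring

lemma sum_Icc_narrow {a b : ℤ} {t : ℝ} (h1 : (a : ℝ) ≤ t) (h2 : t ≤ b) :
    ∑ j ∈ Finset.Icc a b, narrow.toFun (t - j) = 1 := by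
  have hab : a ≤ b := by exact_mod_cast h1.trans h2
  obtain ⟨n, rfl⟩ := Int.le.dest hab
  have : ∑ j ∈ Finset.Icc a (a + n), narrow.toFun (t - j) =
      ∑ j ∈ Finset.range (n + 1), narrow.toFun (t - a - j) := by
    symm
    refine Finset.sum_bij (fun j _ => a + (j : ℤ)) ?_ ?_ ?_ ?_
    · intro j hj
      rw [Finset.mem_range] at hj
      rw [Finset.mem_Icc]; omega
    · intro i _ j _ h; omega
    · intro j hj
      rw [Finset.mem_Icc] at hj
      refine ⟨(j - a).toNat, ?_, ?_⟩
      · rw [Finset.mem_range]; omega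
      · omega
    · intro j _
      push_cast
      rw [sub_sub]
  rw [this, sum_range_narrow, Real.smoothTransition.one_of_one_le (by linarith),
    Real.smoothTransition.zero_of_nonpos, sub_zero]
  push_cast at h2 ⊢
  linarith

/-- The symbol `ξ ↦ ∏_i τ(2π ξ_i - k_i)`. -/
def symb (τ : Cutoff) (k : Fin d → ℤ) (ξ : Rd d) : ℝ :=
  ∏ i, τ.toFun (2 * Real.pi * ξ i - k i)

variable (τ : Cutoff)

lemma contDiff_symb (k : Fin d → ℤ) : ContDiff ℝ (⊤ : ℕ∞) (τ.symb k) := by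
  unfold symb
  refine contDiff_prod fun i _ => τ.smooth.comp ?_
  exact (contDiff_const.mul (contDiff_piLp_apply 2 (i := i))).sub contDiff_const

variable {τ}

lemma symb_eq_zero {k : Fin d → ℤ} {ξ : Rd d} {i : Fin d} (h : 3 ≤ |2 * Real.pi * ξ i - k i|) :
    τ.symb k ξ = 0 :=
  Finset.prod_eq_zero (Finset.mem_univ i) (τ.eq_zero _ h)

lemma narrow_symb_eq_zero {k : Fin d → ℤ} {ξ : Rd d} {i : Fin d}
    (h : 1 ≤ |2 * Real.pi * ξ i - k i|) : narrow.symb k ξ = 0 :=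
  Finset.prod_eq_zero (Finset.mem_univ i) (narrow_eq_zero h)

lemma wide_symb_eq_one {k : Fin d → ℤ} {ξ : Rd d} (h : ∀ i, |2 * Real.pi * ξ i - k i| ≤ 2) :
    wide.symb k ξ = 1 :=
  Finset.prod_eq_one fun i _ => wide_eq_one (h i)

lemma narrow_symb_nonneg (k : Fin d → ℤ) (ξ : Rd d) : 0 ≤ narrow.symb k ξ :=
  Finset.prod_nonneg fun _ _ => narrow_nonneg _

lemma abs_symb_le_one (k : Fin d → ℤ) (ξ : Rd d) : |τ.symb k ξ| ≤ 1 := by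
  rw [symb, Finset.abs_prod]
  exact Finset.prod_le_one (fun _ _ => abs_nonneg _) fun _ _ => τ.abs_le_one _

lemma sum_narrow_symb {a b : Fin d → ℤ} {ξ : Rd d} (h1 : ∀ i, (a i : ℝ) ≤ 2 * Real.pi * ξ i)
    (h2 : ∀ i, 2 * Real.pi * ξ i ≤ b i) :
    ∑ k ∈ Fintype.piFinset fun i => Finset.Icc (a i) (b i), narrow.symb k ξ = 1 := by
  simp only [symb]
  rw [← Finset.prod_univ_sum (fun i => Finset.Icc (a i) (b i))
    (fun i (j : ℤ) => narrow.toFun (2 * Real.pi * ξ i - j))]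
  exact Finset.prod_eq_one fun i _ => sum_Icc_narrow (h1 i) (h2 i)

lemma mem_piFinset_floor_ceil {k : Fin d → ℤ} {ξ : Rd d}
    (hk : ∀ i, |2 * Real.pi * ξ i - k i| < 1) :
    k ∈ Fintype.piFinset fun i => Finset.Icc ⌊2 * Real.pi * ξ i⌋ ⌈2 * Real.pi * ξ i⌉ := by
  refine Fintype.mem_piFinset.2 fun i => Finset.mem_Icc.2 ?_
  obtain ⟨h1, h2⟩ := abs_lt.1 (hk i)
  constructor
  · have : ((⌊2 * Real.pi * ξ i⌋ : ℤ) : ℝ) < (k i + 1 : ℤ) := by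
      push_cast; linarith [Int.floor_le (2 * Real.pi * ξ i)]
    have := Int.cast_lt.1 this
    omega
  · have : ((k i - 1 : ℤ) : ℝ) < (⌈2 * Real.pi * ξ i⌉ : ℤ) := by
      push_cast; linarith [Int.le_ceil (2 * Real.pi * ξ i)]
    have := Int.cast_lt.1 this
    omega

/-- Only indices within distance one of 2πξ contribute. They lie both in the given set and in the
box of floors and ceilings, so both sums reduce to the intersection. -/
lemma sum_narrow_symb_of_subset {s : Finset (Fin d → ℤ)} {ξ : Rd d}
    (hs : ∀ k, (∀ i, |2 * Real.pi * ξ i - k i| < 1) → k ∈ s) :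
    ∑ k ∈ s, narrow.symb k ξ = 1 := by
  rw [← sum_narrow_symb (a := fun i => ⌊2 * Real.pi * ξ i⌋) (b := fun i => ⌈2 * Real.pi * ξ i⌉)
    (ξ := ξ) (fun i => Int.floor_le _) (fun i => Int.le_ceil _)]
  have key : ∀ (u v : Finset (Fin d → ℤ)),
      (∀ k, (∀ i, |2 * Real.pi * ξ i - k i| < 1) → k ∈ v) →
      ∑ k ∈ u, narrow.symb k ξ = ∑ k ∈ u ∩ v, narrow.symb k ξ := by
    intro u v hv
    symm
    refine Finset.sum_subset Finset.inter_subset_left fun k hk hk' => ?_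
    have : k ∉ v := fun h => hk' (Finset.mem_inter.2 ⟨hk, h⟩)
    have h2 : ¬ ∀ i, |2 * Real.pi * ξ i - k i| < 1 := fun h => this (hv k h)
    push Not at h2
    obtain ⟨i, hi⟩ := h2
    exact narrow_symb_eq_zero hi
  rw [key s (Fintype.piFinset fun i => Finset.Icc ⌊2 * Real.pi * ξ i⌋ ⌈2 * Real.pi * ξ i⌉),
    key (Fintype.piFinset _) s hs, Finset.inter_comm]
  exact fun k hk => mem_piFinset_floor_ceil hk

lemma hasSum_narrow_symb (ξ : Rd d) : HasSum (fun k => narrow.symb k ξ) 1 := by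
  rw [← sum_narrow_symb_of_subset (s := Fintype.piFinset fun i =>
    Finset.Icc ⌊2 * Real.pi * ξ i⌋ ⌈2 * Real.pi * ξ i⌉) (ξ := ξ)]
  · refine hasSum_sum_of_ne_finset_zero fun k hk => ?_
    by_contra h
    refine hk (mem_piFinset_floor_ceil fun i => ?_)
    by_contra h4
    exact h (narrow_symb_eq_zero (not_lt.1 h4))
  · exact fun k hk => mem_piFinset_floor_ceil hk

lemma hasCompactSupport_symb (τ : Cutoff) (k : Fin d → ℤ) :
    HasCompactSupport (fun ξ => (τ.symb k ξ : ℂ)) := by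
  refine HasCompactSupport.of_support_subset_isCompact
    (isCompact_closedBall (0 : Rd d) (∑ i, ((3 + |(k i : ℝ)|) / (2 * Real.pi)))) fun ξ hξ => ?_
  rw [mem_closedBall_zero_iff]
  refine (norm_le_absOne ξ).trans (Finset.sum_le_sum fun i _ => ?_)
  have h : |2 * Real.pi * ξ i - k i| < 3 := by
    by_contra h
    exact hξ (by simp [symb_eq_zero (not_lt.1 h)])
  rw [le_div_iff₀ (by positivity)]
  have h2 : |ξ i| * (2 * Real.pi) = |2 * Real.pi * ξ i| := by
    rw [abs_mul, abs_of_pos Real.two_pi_pos, mul_comm]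
  have h3 := abs_sub_abs_le_abs_sub (2 * Real.pi * ξ i) (k i)
  linarith

/-- The symbol as a Schwartz function. -/
def schw (τ : Cutoff) (k : Fin d → ℤ) : 𝓢(Rd d, ℂ) :=
  (τ.hasCompactSupport_symb k).toSchwartzMap
    (Complex.ofRealCLM.contDiff.comp (τ.contDiff_symb k))

@[simp] lemma schw_apply (τ : Cutoff) (k : Fin d → ℤ) (ξ : Rd d) : τ.schw k ξ = (τ.symb k ξ : ℂ) :=
  rfl

/-- The reflected cutoff. -/
def reflect (τ : Cutoff) : Cutoff where
  toFun t := τ.toFun (-t)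
  smooth := τ.smooth.comp contDiff_neg
  eq_zero t ht := τ.eq_zero _ (by rwa [abs_neg])
  abs_le_one _ := τ.abs_le_one _

lemma symb_neg (τ : Cutoff) (k : Fin d → ℤ) (ξ : Rd d) :
    τ.symb k (-ξ) = τ.reflect.symb (-k) ξ := by
  simp only [symb, reflect]
  refine Finset.prod_congr rfl fun i _ => ?_
  congr 1
  simp only [PiLp.neg_apply, Pi.neg_apply, Int.cast_neg]
  ring

end Cutoff

end

section

variable {d : ℕ}

/-! ### Frequency multipliers on Schwartz functions -/

/-- The operator `ψ ↦ 𝓕⁻ (M 𝓕 ψ)`. -/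
def freqMul (M : 𝓢(Rd d, ℂ)) : 𝓢(Rd d, ℂ) →L[ℂ] 𝓢(Rd d, ℂ) :=
  SchwartzMap.convolution (ContinuousLinearMap.mul ℂ ℂ) (𝓕⁻ M)

lemma fourier_freqMul (M ψ : 𝓢(Rd d, ℂ)) (ξ : Rd d) :
    𝓕 (freqMul M ψ) ξ = M ξ * 𝓕 ψ ξ := by
  rw [freqMul, SchwartzMap.fourier_convolution, FourierTransform.fourier_fourierInv_eq]
  rfl

lemma freqMul_apply (M ψ : 𝓢(Rd d, ℂ)) (x : Rd d) :
    freqMul M ψ x = ∫ t, 𝓕⁻ M t * ψ (x - t) := by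
  rw [freqMul, SchwartzMap.convolution_apply]
  rfl

lemma fourierInv_apply_neg (ψ : 𝓢(Rd d, ℂ)) (ξ : Rd d) : 𝓕⁻ ψ ξ = 𝓕 ψ (-ξ) := by
  rw [SchwartzMap.fourierInv_apply_eq]
  rfl

/-- The pairing is bilinear, not sesquilinear: frequency ξ of one factor meets -ξ of the other, so
transposing a multiplier reflects its symbol. -/
lemma integral_freqMul_mul {M M' : 𝓢(Rd d, ℂ)} (h : ∀ ξ, M' ξ = M (-ξ)) (ψ φ : 𝓢(Rd d, ℂ)) :
    ∫ x, freqMul M ψ x * φ x = ∫ x, ψ x * freqMul M' φ x := by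
  calc ∫ x, freqMul M ψ x * φ x = ∫ x, 𝓕⁻ (𝓕 (freqMul M ψ)) x * φ x := by
        rw [FourierTransform.fourierInv_fourier_eq]
    _ = ∫ ξ, 𝓕 (freqMul M ψ) ξ * 𝓕⁻ φ ξ := SchwartzMap.integral_fourierInv_mul_eq _ _
    _ = ∫ ξ, 𝓕 ψ ξ * 𝓕⁻ (freqMul M' φ) ξ := by
        refine integral_congr_ae (Eventually.of_forall fun ξ => ?_)
        simp only [fourier_freqMul, fourierInv_apply_neg, h, neg_neg]
        ring
    _ = ∫ x, ψ x * 𝓕 (𝓕⁻ (freqMul M' φ)) x := SchwartzMap.integral_fourier_mul_eq _ _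
    _ = _ := by rw [FourierTransform.fourier_fourierInv_eq]

/-- The frequency-localised part `𝓕⁻ (τ(2π ξ - k) 𝓕 ψ)` of `ψ`. -/
def band (τ : Cutoff) (k : Fin d → ℤ) : 𝓢(Rd d, ℂ) →L[ℂ] 𝓢(Rd d, ℂ) := freqMul (τ.schw k)

lemma fourier_band (τ : Cutoff) (k : Fin d → ℤ) (ψ : 𝓢(Rd d, ℂ)) (ξ : Rd d) :
    𝓕 (band τ k ψ) ξ = (τ.symb k ξ : ℂ) * 𝓕 ψ ξ := fourier_freqMul _ _ _

lemma integral_band_mul (τ : Cutoff) (k : Fin d → ℤ) (ψ φ : 𝓢(Rd d, ℂ)) :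
    ∫ x, band τ k ψ x * φ x = ∫ x, ψ x * band τ.reflect (-k) φ x := by
  refine integral_freqMul_mul (fun ξ => ?_) ψ φ
  rw [Cutoff.schw_apply, Cutoff.schw_apply, Cutoff.symb_neg]

/-! ### Pairings with functions of bounded spectrum -/

section Spectrum

variable {p : ℝ≥0∞} [Fact (1 ≤ p)] {f : Lp ℂ p (volume : Measure (Rd d))} {k : Fin d → ℤ}

lemma hasSpectrumIn_iff : HasSpectrumIn f k ↔ ∀ u : 𝓢(Rd d, ℂ), tsupport u ⊆ (freqCube k)ᶜ →
    ∫ x, f x * 𝓕 u x = 0 := by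
  refine forall_congr' fun u => imp_congr_right fun _ => ?_
  rw [TemperedDistribution.fourier_apply, Lp.toTemperedDistribution_apply]
  simp only [smul_eq_mul, mul_comm]

lemma integrable_mul_schwartz (f : Lp ℂ p (volume : Measure (Rd d))) (φ : 𝓢(Rd d, ℂ)) :
    Integrable (fun x => f x * φ x) volume := by
  have := ENNReal.HolderConjugate.inv_one_sub_inv' (Fact.out : 1 ≤ p)
  exact (Lp.memLp f).integrable_mul (φ.memLp (1 - p⁻¹)⁻¹)

/-- The closed cube of half-side 3/2 lies in the open cube of half-side 2, so pointwise vanishing on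
the latter already controls the topological support. -/
lemma tsupport_subset_compl_freqCube {u : 𝓢(Rd d, ℂ)}
    (h : ∀ ξ : Rd d, (∀ i, |2 * Real.pi * ξ i - k i| < 2) → u ξ = 0) :
    tsupport u ⊆ (freqCube k)ᶜ := by
  have hopen : IsOpen {ξ : Rd d | ∀ i, |2 * Real.pi * ξ i - k i| < 2} := by
    simp only [Set.ofPred_forall]
    exact isOpen_iInter_of_finite fun i => isOpen_lt (by fun_prop) continuous_const
  have h1 : tsupport u ⊆ {ξ : Rd d | ∀ i, |2 * Real.pi * ξ i - k i| < 2}ᶜ :=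
    closure_minimal (fun ξ hξ hξ' => hξ (h ξ hξ')) hopen.isClosed_compl
  refine h1.trans (Set.compl_subset_compl.2 fun ξ hξ i => ?_)
  exact lt_of_le_of_lt (hξ i) (by norm_num)

/-- The plus sign reflects the bilinear pairing: a function with frequencies near k only sees
frequencies near -k. -/
lemma HasSpectrumIn.integral_eq_zero (hf : HasSpectrumIn f k) {u : 𝓢(Rd d, ℂ)}
    (hu : ∀ ξ : Rd d, (∀ i, |2 * Real.pi * ξ i + k i| < 2) → 𝓕 u ξ = 0) :
    ∫ x, f x * u x = 0 := by
  have h := hasSpectrumIn_iff.1 hf (𝓕⁻ u) (tsupport_subset_compl_freqCube fun ξ hξ => ?_)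
  · rwa [FourierTransform.fourier_fourierInv_eq] at h
  · rw [fourierInv_apply_neg]
    refine hu _ fun i => ?_
    rw [PiLp.neg_apply, ← abs_neg]
    convert hξ i using 2
    ring

lemma HasSpectrumIn.integral_congr (hf : HasSpectrumIn f k) {u v : 𝓢(Rd d, ℂ)}
    (huv : ∀ ξ : Rd d, (∀ i, |2 * Real.pi * ξ i + k i| < 2) → 𝓕 u ξ = 𝓕 v ξ) :
    ∫ x, f x * u x = ∫ x, f x * v x := by
  rw [← sub_eq_zero, ← integral_sub (integrable_mul_schwartz f u) (integrable_mul_schwartz f v)]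
  rw [← hf.integral_eq_zero (u := u - v) fun ξ hξ => ?_]
  · simp only [sub_apply, mul_sub]
  · have : 𝓕 (u - v) = 𝓕 u - 𝓕 v := map_sub (fourierCLM ℂ 𝓢(Rd d, ℂ)) u v
    rw [this, sub_apply, huv ξ hξ, sub_self]

/-- The wide symbol at -k is one wherever the pairing looks. This transfers the decay of bands of u
to the pairing itself. -/
lemma HasSpectrumIn.integral_eq_band (hf : HasSpectrumIn f k) (u : 𝓢(Rd d, ℂ)) :
    ∫ x, f x * u x = ∫ x, f x * band .wide (-k) u x := by
  refine hf.integral_congr fun ξ hξ => ?_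
  rw [fourier_band, Cutoff.wide_symb_eq_one, Complex.ofReal_one, one_mul]
  intro i
  rw [Pi.neg_apply, Int.cast_neg, sub_neg_eq_add]
  exact (hξ i).le

/-- The pairing looks within distance 2 of -k and the symbol lives within distance 3 of m, so
separation 5 = 2 + 3 in one coordinate suffices. -/
lemma HasSpectrumIn.integral_band_eq_zero (hf : HasSpectrumIn f k) (τ : Cutoff) {m : Fin d → ℤ}
    {i : Fin d} (hi : 5 ≤ |m i + k i|) (u : 𝓢(Rd d, ℂ)) :
    ∫ x, f x * band τ m u x = 0 := by
  refine hf.integral_eq_zero fun ξ hξ => ?_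
  rw [fourier_band, Cutoff.symb_eq_zero (i := i), Complex.ofReal_zero, zero_mul]
  have h1 : (5 : ℝ) ≤ |(m i : ℝ) + k i| := by exact_mod_cast hi
  have h2 := abs_sub_abs_le_abs_sub ((m i : ℝ) + k i) (2 * Real.pi * ξ i + k i)
  have h3 := hξ i
  rw [← abs_neg]
  have h4 : (m i : ℝ) + k i - (2 * Real.pi * ξ i + k i) = -(2 * Real.pi * ξ i - m i) := by ring
  rw [h4] at h2
  linarith

end Spectrum

lemma hasSpectrumIn_band {p : ℝ≥0∞} [Fact (1 ≤ p)] (k : Fin d → ℤ) (ψ : 𝓢(Rd d, ℂ)) :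
    HasSpectrumIn ((band .narrow k ψ).toLp p) k := by
  refine hasSpectrumIn_iff.2 fun u hu => ?_
  have h1 : ∫ x, (band .narrow k ψ).toLp p volume x * 𝓕 u x =
      ∫ x, band .narrow k ψ x * 𝓕 u x := by
    refine integral_congr_ae ?_
    filter_upwards [(band .narrow k ψ).coeFn_toLp p volume] with x hx
    rw [hx]
  rw [h1, ← SchwartzMap.integral_fourier_mul_eq, ← integral_zero (Rd d) ℂ]
  refine integral_congr_ae (Eventually.of_forall fun ξ => ?_)
  simp only [fourier_band]
  by_cases h : ξ ∈ freqCube k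
  · rw [image_eq_zero_of_notMem_tsupport fun h' => hu h' h, mul_zero]
  · simp only [freqCube, Set.mem_ofPred_eq, not_forall, not_le] at h
    obtain ⟨i, hi⟩ := h
    rw [Cutoff.narrow_symb_eq_zero (i := i) (by linarith), Complex.ofReal_zero, zero_mul, zero_mul]

/-! ### Decay of frequency-localised parts -/

lemma absOne_nonneg (x : Rd d) : 0 ≤ absOne x := Finset.sum_nonneg fun _ _ => abs_nonneg _

lemma absOneInt_nonneg (k : Fin d → ℤ) : 0 ≤ absOneInt k := Finset.sum_nonneg fun _ _ => abs_nonneg _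

lemma absOneInt_neg (k : Fin d → ℤ) : absOneInt (-k) = absOneInt k := by
  simp [absOneInt]

lemma absOneInt_add_le (k l : Fin d → ℤ) : absOneInt (k + l) ≤ absOneInt k + absOneInt l := by
  rw [absOneInt, absOneInt, absOneInt, ← Finset.sum_add_distrib]
  refine Finset.sum_le_sum fun i _ => ?_
  rw [Pi.add_apply, Int.cast_add]
  exact abs_add_le _ _

/-- Polynomial decay of `φ` and exponential decay of its Fourier transform, with constants. -/
structure DecayBound (l P Q : ℝ) (φ : 𝓢(Rd d, ℂ)) : Prop where
  -- The exponent is doubled because a geometric mean with the frequency bound will halve it; the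
  -- remaining d + 1 makes the reciprocal weight integrable.
  space : ∀ x, (1 + ‖x‖) ^ (2 * (d + 1)) * ‖φ x‖ ≤ P
  freq : ∀ ξ, Real.exp (l * absOne ξ) * ‖angFourier φ ξ‖ ≤ Q

lemma DecayBound.space_nonneg {l P Q : ℝ} {φ : 𝓢(Rd d, ℂ)} (h : DecayBound l P Q φ) : 0 ≤ P :=
  le_trans (by positivity) (h.space 0)

lemma DecayBound.freq_nonneg {l P Q : ℝ} {φ : 𝓢(Rd d, ℂ)} (h : DecayBound l P Q φ) : 0 ≤ Q :=
  le_trans (by positivity) (h.freq 0)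

lemma fourier_eq_angFourier (φ : Rd d → ℂ) (ξ : Rd d) :
    𝓕 φ ξ = angFourier φ ((2 * Real.pi) • ξ) := by
  rw [angFourier, inv_smul_smul₀ Real.two_pi_pos.ne']

/-- The centre of the frequency cube of index `k`, in the variable of Mathlib's transform. -/
def freqCentre (k : Fin d → ℤ) : Rd d := WithLp.toLp 2 fun i => (k i : ℝ) / (2 * Real.pi)

lemma Cutoff.symb_eq_symb_zero (τ : Cutoff) (k : Fin d → ℤ) (ξ : Rd d) :
    τ.symb k ξ = τ.symb 0 (ξ + -freqCentre k) := by
  simp only [Cutoff.symb]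
  refine Finset.prod_congr rfl fun i _ => ?_
  congr 1
  simp only [freqCentre, PiLp.add_apply, PiLp.neg_apply, Pi.zero_apply, Int.cast_zero, sub_zero]
  field_simp
  ring

/-- Translating the symbol modulates its inverse transform. This is why the constants of all band
operators are uniform in k. -/
lemma norm_fourierInv_schw (τ : Cutoff) (k : Fin d → ℤ) (x : Rd d) :
    ‖𝓕⁻ (τ.schw k) x‖ = ‖𝓕⁻ (τ.schw (0 : Fin d → ℤ)) x‖ := by
  rw [fourierInv_apply_neg, fourierInv_apply_neg]
  have h : (τ.schw k : Rd d → ℂ) = τ.schw (0 : Fin d → ℤ) ∘ fun ξ => ξ + -freqCentre k := by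
    funext ξ
    rw [Function.comp_apply, Cutoff.schw_apply, Cutoff.symb_eq_symb_zero, Cutoff.schw_apply]
  rw [SchwartzMap.fourier_coe, SchwartzMap.fourier_coe, h]
  have := congrFun (VectorFourier.fourierIntegral_comp_add_right Real.fourierChar volume
    (innerₗ (Rd d)) (τ.schw (0 : Fin d → ℤ)) (-freqCentre k)) (-x)
  change ‖VectorFourier.fourierIntegral Real.fourierChar volume (innerₗ (Rd d)) _ (-x)‖ = _
  rw [this, Circle.norm_smul]
  rfl

lemma integral_norm_schw (τ : Cutoff) (k : Fin d → ℤ) :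
    ∫ ξ, ‖τ.schw k ξ‖ = ∫ ξ, ‖τ.schw (0 : Fin d → ℤ) ξ‖ := by
  rw [← integral_add_right_eq_self (fun ξ => ‖τ.schw (0 : Fin d → ℤ) ξ‖) (-freqCentre k)]
  simp only [Cutoff.schw_apply, ← Cutoff.symb_eq_symb_zero]

lemma absOne_ge_of_symb_ne_zero {τ : Cutoff} {k : Fin d → ℤ} {ξ : Rd d} (h : τ.symb k ξ ≠ 0) :
    absOneInt k - 3 * d ≤ absOne ((2 * Real.pi) • ξ) := by
  have h1 : ∀ i, |(k i : ℝ)| - 3 ≤ |((2 * Real.pi) • ξ) i| := fun i => by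
    have h2 : |2 * Real.pi * ξ i - k i| < 3 := by
      by_contra h3
      exact h (Cutoff.symb_eq_zero (not_lt.1 h3))
    have h4 := abs_sub_abs_le_abs_sub (k i : ℝ) (2 * Real.pi * ξ i)
    rw [abs_sub_comm] at h4
    simp only [PiLp.smul_apply, smul_eq_mul]
    linarith
  calc absOneInt k - 3 * d = ∑ i, (|(k i : ℝ)| - 3) := by
        simp [absOneInt, Finset.sum_sub_distrib, mul_comm]
    _ ≤ _ := Finset.sum_le_sum fun i _ => h1 i

/-- On the support of the symbol the angular frequency has size at least |k| - 3d, so the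
exponential decay of the transform yields e^{-l|k|} at the cost of e^{3dl}. -/
lemma norm_band_le_freq (τ : Cutoff) {l P Q : ℝ} (hl : 0 ≤ l) {φ : 𝓢(Rd d, ℂ)}
    (h : DecayBound l P Q φ) (k : Fin d → ℤ) (x : Rd d) :
    ‖band τ k φ x‖ ≤ (∫ ξ, ‖τ.schw (0 : Fin d → ℤ) ξ‖) *
      (Real.exp (3 * d * l) * (Real.exp (-l * absOneInt k) * Q)) := by
  rw [← integral_norm_schw τ k, ← integral_mul_const]
  have h1 : band τ k φ x = 𝓕 (𝓕 (band τ k φ) : 𝓢(Rd d, ℂ)) (-x) := by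
    rw [← fourierInv_apply_neg, FourierTransform.fourierInv_fourier_eq]
  rw [h1]
  refine (VectorFourier.norm_fourierIntegral_le_integral_norm _ _ _ _ _).trans ?_
  refine integral_mono (𝓕 (band τ k φ) : 𝓢(Rd d, ℂ)).integrable.norm
    ((τ.schw k).integrable.norm.mul_const _) fun ξ => ?_
  simp only [fourier_band, norm_mul, ← Cutoff.schw_apply]
  by_cases h0 : τ.symb k ξ = 0
  · simp [h0]
  refine mul_le_mul_of_nonneg_left ?_ (norm_nonneg _)
  have h2 := h.freq ((2 * Real.pi) • ξ)
  rw [← fourier_eq_angFourier, ← SchwartzMap.fourier_coe] at h2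
  have h3 := absOne_ge_of_symb_ne_zero h0
  have h4 : 1 ≤ Real.exp (3 * d * l) * Real.exp (-l * absOneInt k) *
      Real.exp (l * absOne ((2 * Real.pi) • ξ)) := by
    rw [← Real.exp_add, ← Real.exp_add, Real.one_le_exp_iff]
    nlinarith
  calc ‖𝓕 φ ξ‖ ≤ (Real.exp (3 * d * l) * Real.exp (-l * absOneInt k) *
      Real.exp (l * absOne ((2 * Real.pi) • ξ))) * ‖𝓕 φ ξ‖ :=
        le_mul_of_one_le_left (norm_nonneg _) h4
    _ = Real.exp (3 * d * l) * (Real.exp (-l * absOneInt k) *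
      (Real.exp (l * absOne ((2 * Real.pi) • ξ)) * ‖𝓕 φ ξ‖)) := by ring
    _ ≤ _ := by gcongr

lemma integrable_one_add_norm_pow_mul (u : 𝓢(Rd d, ℂ)) (n : ℕ) :
    Integrable (fun t => (1 + ‖t‖) ^ n * ‖u t‖) volume := by
  have h : Integrable (fun t => 2 ^ (n - 1) * (‖u t‖ + ‖t‖ ^ n * ‖u t‖)) volume :=
    (u.integrable.norm.add (u.integrable_pow_mul volume n)).const_mul _
  refine h.mono (by fun_prop) (Eventually.of_forall fun t => ?_)
  rw [Real.norm_of_nonneg (by positivity), Real.norm_of_nonneg (by positivity)]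
  have h1 := add_pow_le (zero_le_one (α := ℝ)) (norm_nonneg t) n
  calc _ ≤ 2 ^ (n - 1) * (1 ^ n + ‖t‖ ^ n) * ‖u t‖ := by gcongr
    _ = _ := by rw [one_pow]; ring

/-- The band is a convolution, and the submultiplicativity 1 + ‖x‖ ≤ (1 + ‖t‖)(1 + ‖x - t‖) carries
the weight through it. -/
lemma norm_band_le_space (τ : Cutoff) {l P Q : ℝ} {φ : 𝓢(Rd d, ℂ)}
    (h : DecayBound l P Q φ) (k : Fin d → ℤ) (x : Rd d) :
    (1 + ‖x‖) ^ (2 * (d + 1)) * ‖band τ k φ x‖ ≤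
      (∫ t, (1 + ‖t‖) ^ (2 * (d + 1)) * ‖𝓕⁻ (τ.schw (0 : Fin d → ℤ)) t‖) * P := by
  have h0 : ‖band τ k φ x‖ ≤ ∫ t, ‖𝓕⁻ (τ.schw (0 : Fin d → ℤ)) t‖ * ‖φ (x - t)‖ := by
    rw [band, freqMul_apply]
    refine (norm_integral_le_integral_norm _).trans (le_of_eq ?_)
    simp only [norm_mul, norm_fourierInv_schw]
  refine (mul_le_mul_of_nonneg_left h0 (by positivity)).trans ?_
  rw [← integral_const_mul, ← integral_mul_const]
  have hint := integrable_one_add_norm_pow_mul (𝓕⁻ (τ.schw (0 : Fin d → ℤ))) (2 * (d + 1))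
  refine integral_mono_of_nonneg (Eventually.of_forall fun t => by positivity)
    (hint.mul_const P) (Eventually.of_forall fun t => ?_)
  have h1 : 1 + ‖x‖ ≤ (1 + ‖t‖) * (1 + ‖x - t‖) := by
    have := norm_add_le t (x - t)
    rw [add_sub_cancel] at this
    nlinarith [norm_nonneg t, norm_nonneg (x - t), mul_nonneg (norm_nonneg t) (norm_nonneg (x - t))]
  have h2 : (1 + ‖x‖) ^ (2 * (d + 1)) ≤
      (1 + ‖t‖) ^ (2 * (d + 1)) * (1 + ‖x - t‖) ^ (2 * (d + 1)) := by
    rw [← mul_pow]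
    exact pow_le_pow_left₀ (by positivity) h1 _
  calc (1 + ‖x‖) ^ (2 * (d + 1)) * (‖𝓕⁻ (τ.schw (0 : Fin d → ℤ)) t‖ * ‖φ (x - t)‖)
      ≤ ((1 + ‖t‖) ^ (2 * (d + 1)) * (1 + ‖x - t‖) ^ (2 * (d + 1))) *
        (‖𝓕⁻ (τ.schw (0 : Fin d → ℤ)) t‖ * ‖φ (x - t)‖) := by gcongr
    _ = ((1 + ‖t‖) ^ (2 * (d + 1)) * ‖𝓕⁻ (τ.schw (0 : Fin d → ℤ)) t‖) *
        ((1 + ‖x - t‖) ^ (2 * (d + 1)) * ‖φ (x - t)‖) := by ring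
    _ ≤ _ := mul_le_mul_of_nonneg_left (h.space _) (by positivity)

/-- Interpolating the two bounds on `band τ k φ`. -/
lemma exists_norm_band_le (τ : Cutoff) {l : ℝ} (hl : 0 ≤ l) : ∃ C : ℝ, 0 ≤ C ∧
    ∀ (φ : 𝓢(Rd d, ℂ)) (P Q : ℝ), DecayBound l P Q φ → ∀ (k : Fin d → ℤ) (x : Rd d),
      (1 + ‖x‖) ^ (d + 1) * ‖band τ k φ x‖ ≤
        C * (Real.exp (-(l / 2) * absOneInt k) * Real.sqrt (P * Q)) := by
  set A := (∫ ξ, ‖τ.schw (0 : Fin d → ℤ) ξ‖) * Real.exp (3 * d * l) with hA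
  set D := ∫ t, (1 + ‖t‖) ^ (2 * (d + 1)) * ‖𝓕⁻ (τ.schw (0 : Fin d → ℤ)) t‖ with hD
  have hA0 : 0 ≤ A := by positivity
  have hD0 : 0 ≤ D := by positivity
  refine ⟨Real.sqrt (A * D), Real.sqrt_nonneg _, fun φ P Q h k x => ?_⟩
  have hP := h.space_nonneg
  have hQ := h.freq_nonneg
  have h1 := norm_band_le_freq τ hl h k x
  have h2 := norm_band_le_space τ h k x
  have h3 : Real.exp (-(l / 2) * absOneInt k) = Real.sqrt (Real.exp (-l * absOneInt k)) := by
    rw [← Real.exp_half]; congr 1; ring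
  rw [h3, ← Real.sqrt_mul (by positivity), ← Real.sqrt_mul (by positivity)]
  refine Real.le_sqrt_of_sq_le ?_
  -- One factor of the square takes the whole spatial weight, the other the exponential decay in k.
  calc ((1 + ‖x‖) ^ (d + 1) * ‖band τ k φ x‖) ^ 2
      = ((1 + ‖x‖) ^ (2 * (d + 1)) * ‖band τ k φ x‖) * ‖band τ k φ x‖ := by
        rw [mul_pow, ← pow_mul]; ring
    _ ≤ (D * P) * (A * (Real.exp (-l * absOneInt k) * Q)) := by
        refine mul_le_mul h2 ?_ (norm_nonneg _) (by positivity)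
        rw [hA, mul_assoc]; exact h1
    _ = _ := by ring

/-- The weight (1 + ‖x‖)^{-(d+1)} belongs to every L^r with r ≥ 1, and K is its norm. -/
lemma exists_norm_toLp_le (r : ℝ≥0∞) (hr : 1 ≤ r) : ∃ K : ℝ, 0 ≤ K ∧
    ∀ (u : 𝓢(Rd d, ℂ)) (c : ℝ), (∀ x, (1 + ‖x‖) ^ (d + 1) * ‖u x‖ ≤ c) →
      ‖u.toLp r‖ ≤ K * c := by
  set w : Rd d → ℝ := fun x => ((1 + ‖x‖) ^ (d + 1))⁻¹ with hw
  have hwc : Continuous w := by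
    refine Continuous.inv₀ (by fun_prop) fun x => by positivity
  have hwm : MemLp w r volume := by
    by_cases hrt : r = ∞
    · subst hrt
      refine memLp_top_of_bound hwc.aestronglyMeasurable 1 (Eventually.of_forall fun x => ?_)
      rw [Real.norm_of_nonneg (by positivity)]
      exact inv_le_one_of_one_le₀ (one_le_pow₀ (by linarith [norm_nonneg x]))
    have hr0 : r ≠ 0 := (zero_lt_one.trans_le hr).ne'
    have hr1 : 1 ≤ r.toReal := by
      simpa using (ENNReal.toReal_le_toReal ENNReal.one_ne_top hrt).2 hr
    rw [← integrable_norm_rpow_iff hwc.aestronglyMeasurable hr0 hrt]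
    have hint : Integrable
        (fun x : Rd d => (1 + ‖x‖) ^ (-(((d : ℝ) + 1) * r.toReal))) volume := by
      refine integrable_one_add_norm ?_
      rw [finrank_euclideanSpace_fin]
      nlinarith [(Nat.cast_nonneg d : (0 : ℝ) ≤ d)]
    refine hint.congr (Eventually.of_forall fun x => ?_)
    simp only [hw]
    rw [Real.norm_of_nonneg (by positivity), Real.rpow_neg (by positivity),
      Real.inv_rpow (by positivity), ← Real.rpow_natCast, ← Real.rpow_mul (by positivity)]
    push_cast
    rfl
  refine ⟨(eLpNorm w r volume).toReal, ENNReal.toReal_nonneg, fun u c hc => ?_⟩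
  have hc0 : 0 ≤ c := le_trans (by positivity) (hc 0)
  rw [SchwartzMap.norm_toLp]
  have h1 : eLpNorm u r volume ≤ eLpNorm (c • w) r volume := by
    refine eLpNorm_mono fun x => ?_
    rw [Pi.smul_apply, smul_eq_mul, Real.norm_of_nonneg (by positivity), hw]
    dsimp only
    rw [← div_eq_mul_inv, le_div_iff₀ (by positivity), mul_comm]
    exact hc x
  rw [eLpNorm_const_smul] at h1
  have h2 := ENNReal.toReal_mono (ENNReal.mul_ne_top (by simp) hwm.eLpNorm_ne_top) h1
  rw [ENNReal.toReal_mul] at h2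
  simpa [abs_of_nonneg hc0, mul_comm] using h2

lemma exists_norm_toLp_band_le (τ : Cutoff) {l : ℝ} (hl : 0 ≤ l) (r : ℝ≥0∞) (hr : 1 ≤ r) :
    ∃ C : ℝ, 0 ≤ C ∧ ∀ (φ : 𝓢(Rd d, ℂ)) (P Q : ℝ), DecayBound l P Q φ → ∀ k : Fin d → ℤ,
      ‖(band τ k φ).toLp r‖ ≤ C * (Real.exp (-(l / 2) * absOneInt k) * Real.sqrt (P * Q)) := by
  obtain ⟨C, hC0, hC⟩ := exists_norm_band_le (d := d) τ hl
  obtain ⟨K, hK0, hK⟩ := exists_norm_toLp_le (d := d) r hr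
  refine ⟨K * C, by positivity, fun φ P Q h k => ?_⟩
  rw [mul_assoc]
  exact hK _ _ fun x => hC φ P Q h k x

/-- The bilinear pairing `∫ f g` of `L^p` and `L^{p'}`. -/
def pair (p p' : ℝ≥0∞) [ENNReal.HolderConjugate p p'] [Fact (1 ≤ p)] [Fact (1 ≤ p')] :
    Lp ℂ p (volume : Measure (Rd d)) →L[ℂ] Lp ℂ p' (volume : Measure (Rd d)) →L[ℂ] ℂ :=
  (ContinuousLinearMap.mul ℂ ℂ).lpPairing volume p p'

section Pair

variable {p p' : ℝ≥0∞} [ENNReal.HolderConjugate p p'] [Fact (1 ≤ p)] [Fact (1 ≤ p')]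

lemma pair_apply (f : Lp ℂ p (volume : Measure (Rd d)))
    (g : Lp ℂ p' (volume : Measure (Rd d))) : pair p p' f g = ∫ x, f x * g x :=
  ContinuousLinearMap.lpPairing_eq_integral _ _ _

lemma norm_pair_le (f : Lp ℂ p (volume : Measure (Rd d)))
    (g : Lp ℂ p' (volume : Measure (Rd d))) : ‖pair p p' f g‖ ≤ ‖f‖ * ‖g‖ := by
  have h := ContinuousLinearMap.norm_holder_apply_apply_le (r := 1)
    (ContinuousLinearMap.mul ℂ ℂ) f g (μ := (volume : Measure (Rd d)))
  have h1 : pair p p' f g =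
      L1.integral ((ContinuousLinearMap.mul ℂ ℂ).holder (μ := volume) 1 f g) := by
    rw [pair_apply, L1.integral_eq_integral]
    exact (integral_congr_ae ((ContinuousLinearMap.mul ℂ ℂ).coeFn_holder f g)).symm
  rw [h1]
  refine (L1.norm_integral_le _).trans (h.trans ?_)
  rw [mul_assoc]
  exact mul_le_of_le_one_left (by positivity) (ContinuousLinearMap.opNorm_mul_le ℂ ℂ)

lemma pair_toLp (f : Lp ℂ p (volume : Measure (Rd d))) (φ : 𝓢(Rd d, ℂ)) :
    pair p p' f (φ.toLp p') = ∫ x, f x * φ x := by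
  rw [pair_apply]
  refine integral_congr_ae ?_
  filter_upwards [φ.coeFn_toLp p' volume] with x hx
  rw [hx]

lemma toLp_pair (φ : 𝓢(Rd d, ℂ)) (g : Lp ℂ p' (volume : Measure (Rd d))) :
    pair p p' (φ.toLp p) g = ∫ x, φ x * g x := by
  rw [pair_apply]
  refine integral_congr_ae ?_
  filter_upwards [φ.coeFn_toLp p volume] with x hx
  rw [hx]

end Pair

/-- The pairing of a function with bounded spectrum with a test function decays exponentially. -/
lemma exists_norm_integral_mul_le (p : ℝ≥0∞) [Fact (1 ≤ p)] {l : ℝ} (hl : 0 ≤ l) :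
    ∃ C : ℝ, 0 ≤ C ∧ ∀ (k : Fin d → ℤ) (f : Lp ℂ p (volume : Measure (Rd d))),
      HasSpectrumIn f k → ∀ (φ : 𝓢(Rd d, ℂ)) (P Q : ℝ), DecayBound l P Q φ →
      ‖∫ x, f x * φ x‖ ≤ C * (Real.exp (-(l / 2) * absOneInt k) * (‖f‖ * Real.sqrt (P * Q))) := by
  have hpq := ENNReal.HolderConjugate.inv_one_sub_inv' (Fact.out : 1 ≤ p)
  have h1 : (1 : ℝ≥0∞) ≤ (1 - p⁻¹)⁻¹ := by simp
  have : Fact (1 ≤ (1 - p⁻¹)⁻¹) := ⟨h1⟩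
  obtain ⟨C, hC0, hC⟩ := exists_norm_toLp_band_le (d := d) .wide hl _ h1
  refine ⟨C, hC0, fun k f hf φ P Q h => ?_⟩
  rw [hf.integral_eq_band]
  rw [← pair_toLp (p' := (1 - p⁻¹)⁻¹)]
  refine (norm_pair_le _ _).trans ?_
  refine (mul_le_mul_of_nonneg_left (hC φ P Q h (-k)) (norm_nonneg _)).trans (le_of_eq ?_)
  rw [absOneInt_neg]; ring

end

section

/-! ### Gelfand-Shilov functions are Schwartz functions -/

/-- A Landau inequality: if `F` decays rapidly and its derivative is Lipschitz, then the derivative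
decays rapidly. -/
lemma rapid_decay_fderiv {E G : Type*} [NormedAddCommGroup E] [NormedSpace ℝ E]
    [NormedAddCommGroup G] [NormedSpace ℝ G] {F : E → G} (hF : Differentiable ℝ F) {B : ℝ}
    (hB : ∀ x y, ‖fderiv ℝ F y - fderiv ℝ F x‖ ≤ B * ‖y - x‖)
    (h : ∀ m : ℕ, ∃ C : ℝ, ∀ x, (1 + ‖x‖) ^ m * ‖F x‖ ≤ C) (m : ℕ) :
    ∃ C : ℝ, ∀ x, (1 + ‖x‖) ^ m * ‖fderiv ℝ F x‖ ≤ C := by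
  obtain ⟨C, hC⟩ := h (2 * m)
  have hC0 : 0 ≤ C := le_trans (by positivity) (hC 0)
  refine ⟨2 ^ (2 * m) * C + C + |B|, fun x => ?_⟩
  set r := (1 + ‖x‖) ^ m with hr
  have hr1 : 1 ≤ r := one_le_pow₀ (by linarith [norm_nonneg x])
  have hr0 : 0 < r := by linarith
  have hrr : r * r = (1 + ‖x‖) ^ (2 * m) := by rw [hr, ← pow_add, two_mul]
  rw [← le_div_iff₀' hr0]
  refine ContinuousLinearMap.opNorm_le_of_unit_norm (by positivity) fun v hv => ?_
  -- With step length (1 + ‖x‖)^{-m} the difference quotient costs one factor r and the Lipschitz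
  -- error gains one, so decay of order 2m of F yields order m for its derivative.
  set y := x + r⁻¹ • v with hy
  have hri : r⁻¹ ≤ 1 := inv_le_one_of_one_le₀ hr1
  have hyx : ‖y - x‖ = r⁻¹ := by
    rw [hy, add_sub_cancel_left, norm_smul, hv, mul_one, Real.norm_of_nonneg (by positivity)]
  have h1 : ‖F y - F x - fderiv ℝ F x (y - x)‖ ≤ (|B| * r⁻¹) * ‖y - x‖ := by
    refine (convex_closedBall x r⁻¹).norm_image_sub_le_of_norm_fderiv_le' (𝕜 := ℝ)
      (fun z _ => hF z) (fun z hz => ?_) (Metric.mem_closedBall_self (by positivity)) ?_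
    · refine (hB x z).trans ?_
      rw [mem_closedBall_iff_norm] at hz
      calc B * ‖z - x‖ ≤ |B| * ‖z - x‖ := by gcongr; exact le_abs_self B
        _ ≤ _ := by gcongr
    · rw [mem_closedBall_iff_norm, hyx]
  have h2 : r * r * ‖F x‖ ≤ C := by rw [hrr]; exact hC x
  have h3 : r * r * ‖F y‖ ≤ 2 ^ (2 * m) * C := by
    have h4 : 1 + ‖x‖ ≤ 2 * (1 + ‖y‖) := by
      have := norm_le_norm_add_norm_sub y x
      linarith [norm_nonneg y]
    calc r * r * ‖F y‖ ≤ (2 * (1 + ‖y‖)) ^ (2 * m) * ‖F y‖ := by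
          rw [hrr]; gcongr
      _ = 2 ^ (2 * m) * ((1 + ‖y‖) ^ (2 * m) * ‖F y‖) := by rw [mul_pow]; ring
      _ ≤ _ := by gcongr; exact hC y
  have h5 : fderiv ℝ F x (y - x) = r⁻¹ • fderiv ℝ F x v := by
    rw [hy, add_sub_cancel_left, map_smul]
  have h6 : ‖fderiv ℝ F x (y - x)‖ ≤ ‖F y‖ + ‖F x‖ + |B| * r⁻¹ * r⁻¹ := by
    rw [hyx] at h1
    have h7 : fderiv ℝ F x (y - x) = (F y - F x) - (F y - F x - fderiv ℝ F x (y - x)) := by abel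
    rw [h7]
    exact (norm_sub_le _ _).trans (add_le_add (norm_sub_le _ _) h1)
  rw [h5, norm_smul, Real.norm_of_nonneg (by positivity : 0 ≤ r⁻¹)] at h6
  rw [le_div_iff₀ hr0]
  have h8 := mul_le_mul_of_nonneg_left h6 (by positivity : 0 ≤ r * r)
  have h9 : r * r * (r⁻¹ * ‖fderiv ℝ F x v‖) = ‖fderiv ℝ F x v‖ * r := by field_simp
  have h10 : r * r * (‖F y‖ + ‖F x‖ + |B| * r⁻¹ * r⁻¹) =
      r * r * ‖F y‖ + r * r * ‖F x‖ + |B| := by field_simp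
  rw [h9, h10] at h8
  linarith

/-- Induction on the order: a bound on the derivative of order n + 2 makes that of order n + 1
Lipschitz, and the Landau inequality passes rapid decay from order n to n + 1. -/
lemma rapid_decay_iteratedFDeriv {E G : Type*} [NormedAddCommGroup E] [NormedSpace ℝ E]
    [NormedAddCommGroup G] [NormedSpace ℝ G] {g : E → G} (hg : ContDiff ℝ (⊤ : ℕ∞) g)
    (hbdd : ∀ n : ℕ, ∃ B : ℝ, ∀ x, ‖iteratedFDeriv ℝ n g x‖ ≤ B)
    (h : ∀ m : ℕ, ∃ C : ℝ, ∀ x, (1 + ‖x‖) ^ m * ‖g x‖ ≤ C) (n : ℕ) :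
    ∀ m : ℕ, ∃ C : ℝ, ∀ x, (1 + ‖x‖) ^ m * ‖iteratedFDeriv ℝ n g x‖ ≤ C := by
  have hdiff : ∀ n : ℕ, Differentiable ℝ (iteratedFDeriv ℝ n g) := fun n =>
    hg.differentiable_iteratedFDeriv (mod_cast ENat.natCast_lt_top n)
  induction n with
  | zero => simpa only [norm_iteratedFDeriv_zero] using h
  | succ n ih =>
    intro m
    obtain ⟨B, hB⟩ := hbdd (n + 2)
    have hlip : ∀ x y, ‖fderiv ℝ (iteratedFDeriv ℝ n g) y - fderiv ℝ (iteratedFDeriv ℝ n g) x‖ ≤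
        B * ‖y - x‖ := fun x y => by
      have h1 : ‖fderiv ℝ (iteratedFDeriv ℝ n g) y - fderiv ℝ (iteratedFDeriv ℝ n g) x‖ =
          ‖iteratedFDeriv ℝ (n + 1) g y - iteratedFDeriv ℝ (n + 1) g x‖ := by
        rw [fderiv_iteratedFDeriv]
        let e := continuousMultilinearCurryLeftEquiv ℝ (fun _ : Fin (n + 1) => E) G
        exact (congrArg norm (e.map_sub _ _).symm).trans (e.norm_map _)
      rw [h1]
      refine convex_univ.norm_image_sub_le_of_norm_fderiv_le (𝕜 := ℝ) (fun z _ => hdiff (n + 1) z)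
        (fun z _ => ?_) (Set.mem_univ _) (Set.mem_univ _)
      rw [norm_fderiv_iteratedFDeriv]
      exact hB z
    obtain ⟨C, hC⟩ := rapid_decay_fderiv (hdiff n) hlip ih m
    refine ⟨C, fun x => ?_⟩
    rw [← norm_fderiv_iteratedFDeriv]
    exact hC x

variable {d : ℕ}

lemma norm_le_of_exp_bound {C : ℝ} {n : ℕ} {u : Rd d → ℂ}
    (h : ∀ x, Real.exp (n * absOne x) * ‖u x‖ ≤ C) (x : Rd d) :
    (1 + ‖x‖) ^ n * ‖u x‖ ≤ C := by
  refine le_trans (mul_le_mul_of_nonneg_right ?_ (norm_nonneg _)) (h x)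
  rw [Real.exp_nat_mul]
  refine pow_le_pow_left₀ (by positivity) ?_ n
  linarith [norm_le_absOne x, Real.add_one_le_exp (absOne x)]

lemma absOne_smul {c : ℝ} (hc : 0 ≤ c) (x : Rd d) : absOne (c • x) = c * absOne x := by
  simp [absOne, abs_mul, abs_of_nonneg hc, Finset.mul_sum]

lemma IsGelfandShilov.exists_space_bound {f : Rd d → ℂ} (hf : IsGelfandShilov f) (n : ℕ) :
    ∃ C : ℝ, ∀ x, (1 + ‖x‖) ^ n * ‖f x‖ ≤ C := by
  obtain ⟨C, hC⟩ := hf.decay (n + 1) (by positivity)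
  refine ⟨C, norm_le_of_exp_bound fun x => le_trans ?_ (hC x)⟩
  gcongr
  · exact absOne_nonneg x
  · linarith

lemma IsGelfandShilov.exists_freq_bound {f : Rd d → ℂ} (hf : IsGelfandShilov f) (n : ℕ) :
    ∃ C : ℝ, ∀ x, (1 + ‖x‖) ^ n * ‖𝓕 f x‖ ≤ C := by
  obtain ⟨C, hC⟩ := hf.decayFourier (n + 1) (by positivity)
  refine ⟨C, norm_le_of_exp_bound fun x => le_trans ?_ (hC ((2 * Real.pi) • x))⟩
  rw [fourier_eq_angFourier, absOne_smul Real.two_pi_pos.le]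
  have h1 := absOne_nonneg x
  gcongr
  · linarith
  · nlinarith [Real.pi_gt_three]

lemma integrable_of_pow_bound {u : Rd d → ℂ} (hu : Continuous u) {C : ℝ} {n : ℕ}
    (h : ∀ x, (1 + ‖x‖) ^ (n + (d + 1)) * ‖u x‖ ≤ C) :
    Integrable (fun x => ‖x‖ ^ n * ‖u x‖) volume := by
  have hint : Integrable (fun x : Rd d => C * (1 + ‖x‖) ^ (-((d : ℝ) + 1))) volume := by
    refine (integrable_one_add_norm ?_).const_mul C
    rw [finrank_euclideanSpace_fin]
    linarith
  refine hint.mono' (by fun_prop) (Eventually.of_forall fun x => ?_)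
  rw [Real.norm_of_nonneg (by positivity), Real.rpow_neg (by positivity), ← div_eq_mul_inv,
    le_div_iff₀ (by positivity)]
  rw [← Nat.cast_one (R := ℝ), ← Nat.cast_add, Real.rpow_natCast, Nat.cast_one]
  calc ‖x‖ ^ n * ‖u x‖ * (1 + ‖x‖) ^ (d + 1) ≤
      (1 + ‖x‖) ^ n * ‖u x‖ * (1 + ‖x‖) ^ (d + 1) := by
        gcongr
        linarith [norm_nonneg x]
    _ = (1 + ‖x‖) ^ (n + (d + 1)) * ‖u x‖ := by rw [pow_add]; ring
    _ ≤ C := h x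

/-- The definition bounds only f and its transform. The moments of the transform are finite, so all
derivatives of f are bounded, and rapid decay of f then spreads to them by the Landau induction. -/
lemma IsGelfandShilov.exists_schwartz {f : Rd d → ℂ} (hf : IsGelfandShilov f) :
    ∃ φ : 𝓢(Rd d, ℂ), (φ : Rd d → ℂ) = f := by
  have hcont : Continuous (𝓕 f) :=
    VectorFourier.fourierIntegral_continuous Real.continuous_fourierChar
      (L := innerₗ (Rd d)) continuous_inner hf.integrable
  have hint : ∀ n : ℕ, Integrable (fun x => ‖x‖ ^ n * ‖𝓕 f x‖) volume := fun n => by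
    obtain ⟨C, hC⟩ := hf.exists_freq_bound (n + (d + 1))
    exact integrable_of_pow_bound hcont hC
  have hint0 : Integrable (𝓕 f) volume := by
    have := hint 0
    simp only [pow_zero, one_mul] at this
    exact (integrable_norm_iff hcont.aestronglyMeasurable).1 this
  have hinv : 𝓕⁻ (𝓕 f) = f :=
    hf.smooth.continuous.fourierInv_fourier_eq hf.integrable hint0
  -- The double transform is f reflected; written this way, its derivatives are bounded by moments
  -- of the inner transform.
  set g : Rd d → ℂ := 𝓕 (𝓕 f) with hg
  have hgf : ∀ x, g x = f (-x) := fun x => by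
    rw [← congrFun hinv (-x), Real.fourierInv_eq_fourier_neg, neg_neg]
  have hgs : ContDiff ℝ (⊤ : ℕ∞) g := by
    have : g = f ∘ fun x => -x := funext hgf
    rw [this]
    exact hf.smooth.comp contDiff_neg
  have hdec := rapid_decay_iteratedFDeriv hgs (fun n => ?_) (fun m => ?_)
  · let ψ : 𝓢(Rd d, ℂ) :=
      { toFun := g
        smooth' := hgs
        decay' := fun k n => by
          obtain ⟨C, hC⟩ := hdec n k
          refine ⟨C, fun x => le_trans ?_ (hC x)⟩
          gcongr
          linarith [norm_nonneg x] }
    refine ⟨SchwartzMap.compCLMOfContinuousLinearEquiv ℂ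
      (LinearIsometryEquiv.neg ℝ (E := Rd d)) ψ, funext fun x => ?_⟩
    change g (-x) = f x
    rw [hgf, neg_neg]
  · have hint' : ∀ k m : ℕ, (k : ℕ∞) ≤ ⊤ → (m : ℕ∞) ≤ 0 →
        Integrable (fun v => ‖v‖ ^ k * ‖iteratedFDeriv ℝ m (𝓕 f) v‖) volume := by
      intro k m _ hm
      obtain rfl : m = 0 := by simpa using hm
      simpa only [norm_iteratedFDeriv_zero] using hint k
    have := Real.pow_mul_norm_iteratedFDeriv_fourier_le
      (contDiff_zero.2 hcont : ContDiff ℝ ((0 : ℕ∞) : WithTop ℕ∞) (𝓕 f)) hint'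
      (k := n) (n := 0) le_top le_rfl
    simp only [pow_zero, one_mul] at this
    exact ⟨_, this⟩
  · obtain ⟨C, hC⟩ := hf.exists_space_bound m
    refine ⟨C, fun x => ?_⟩
    rw [hgf, ← norm_neg x]
    exact hC _

/-! ### Schwartz representatives and seminorm bounds of test functions -/

namespace GelfandShilov

/-- A Gelfand-Shilov function as a Schwartz function. -/
def toSchwartz (φ : GelfandShilov d) : 𝓢(Rd d, ℂ) := φ.isGelfandShilov.exists_schwartz.choose

@[simp] lemma coe_toSchwartz (φ : GelfandShilov d) : (φ.toSchwartz : Rd d → ℂ) = φ.1 :=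
  φ.isGelfandShilov.exists_schwartz.choose_spec

lemma toSchwartz_apply (φ : GelfandShilov d) (x : Rd d) : φ.toSchwartz x = φ x :=
  congrFun φ.coe_toSchwartz x

lemma toSchwartz_add (φ ψ : GelfandShilov d) :
    (φ + ψ).toSchwartz = φ.toSchwartz + ψ.toSchwartz := by
  ext x
  rw [add_apply, toSchwartz_apply, toSchwartz_apply, toSchwartz_apply]
  rfl

lemma toSchwartz_smul (c : ℂ) (φ : GelfandShilov d) :
    (c • φ).toSchwartz = c • φ.toSchwartz := by
  ext x
  rw [smul_apply, toSchwartz_apply, toSchwartz_apply]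
  rfl

lemma le_seminormP (l : Set.Ioi (0 : ℝ)) (φ : GelfandShilov d) (x : Rd d) :
    Real.exp (l * absOne x) * ‖φ x‖ ≤ seminormP l φ := by
  rw [seminormP_apply]
  obtain ⟨C, hC⟩ := φ.isGelfandShilov.decay l l.2
  exact le_ciSup (f := fun x => Real.exp (l * absOne x) * ‖φ x‖)
    ⟨C, by rintro _ ⟨x, rfl⟩; exact hC x⟩ x

lemma le_seminormQ (l : Set.Ioi (0 : ℝ)) (φ : GelfandShilov d) (ξ : Rd d) :
    Real.exp (l * absOne ξ) * ‖angFourier φ ξ‖ ≤ seminormQ l φ := by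
  rw [seminormQ_apply]
  obtain ⟨C, hC⟩ := φ.isGelfandShilov.decayFourier l l.2
  exact le_ciSup (f := fun ξ => Real.exp (l * absOne ξ) * ‖angFourier φ ξ‖)
    ⟨C, by rintro _ ⟨x, rfl⟩; exact hC x⟩ ξ

/-- The exponent of the seminorm that controls the spatial decay used in `DecayBound`. -/
def spaceExponent (d : ℕ) : Set.Ioi (0 : ℝ) :=
  ⟨((2 * (d + 1) : ℕ) : ℝ), by rw [Set.mem_Ioi]; positivity⟩

lemma decayBound (l : Set.Ioi (0 : ℝ)) (φ : GelfandShilov d) :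
    DecayBound l (seminormP (spaceExponent d) φ) (seminormQ l φ) φ.toSchwartz where
  space x := by
    rw [toSchwartz_apply]
    exact norm_le_of_exp_bound (le_seminormP (spaceExponent d) φ) x
  freq ξ := by
    rw [coe_toSchwartz]
    exact le_seminormQ l φ ξ

end GelfandShilov

end

section

variable {d : ℕ}

/-! ### Summability over the integer lattice -/

/-- A finite index set lies in the box of its coordinate projections, over which the sum factors
into one-dimensional sums. -/
lemma summable_exp_neg_absOneInt (d : ℕ) :
    Summable fun k : Fin d → ℤ => Real.exp (-absOneInt k) := by
  have hZ : Summable fun j : ℤ => Real.exp (-|(j : ℝ)|) := by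
    refine Summable.of_nat_of_neg ?_ ?_
    · simpa using Real.summable_exp_neg_nat
    · simpa using Real.summable_exp_neg_nat
  refine summable_of_sum_le (c := (∑' j : ℤ, Real.exp (-|(j : ℝ)|)) ^ d)
    (fun k => (Real.exp_pos _).le) fun S => ?_
  have h1 : S ⊆ Fintype.piFinset fun i => S.image fun k : Fin d → ℤ => k i := fun k hk =>
    Fintype.mem_piFinset.2 fun i => Finset.mem_image_of_mem _ hk
  calc ∑ k ∈ S, Real.exp (-absOneInt k) ≤
      ∑ k ∈ Fintype.piFinset fun i => S.image fun k : Fin d → ℤ => k i, Real.exp (-absOneInt k) :=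
        Finset.sum_le_sum_of_subset_of_nonneg h1 fun _ _ _ => (Real.exp_pos _).le
    _ = ∑ k ∈ Fintype.piFinset fun i => S.image fun k : Fin d → ℤ => k i,
        ∏ i, Real.exp (-|(k i : ℝ)|) := by
        refine Finset.sum_congr rfl fun k _ => ?_
        rw [← Real.exp_sum, Finset.sum_neg_distrib]
        rfl
    _ = ∏ i, ∑ j ∈ S.image fun k : Fin d → ℤ => k i, Real.exp (-|(j : ℝ)|) :=
        (Finset.prod_univ_sum (fun i => S.image fun k : Fin d → ℤ => k i)
          (fun _ (j : ℤ) => Real.exp (-|(j : ℝ)|))).symm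
    _ ≤ ∏ _i : Fin d, ∑' j : ℤ, Real.exp (-|(j : ℝ)|) :=
        Finset.prod_le_prod (fun i _ => Finset.sum_nonneg fun j _ => (Real.exp_pos _).le)
          fun i _ => hZ.sum_le_tsum _ fun j _ => (Real.exp_pos _).le
    _ = _ := by simp

/-- The weight `2^{s|k|}`. -/
def weight (s : ℝ) (k : Fin d → ℤ) : ℝ := (2 : ℝ) ^ (s * absOneInt k)

lemma weight_pos (s : ℝ) (k : Fin d → ℤ) : 0 < weight s k := Real.rpow_pos_of_pos two_pos _

lemma weight_neg_mul (s : ℝ) (k : Fin d → ℤ) : weight (-s) k * weight s k = 1 := by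
  rw [weight, weight, ← Real.rpow_add two_pos, neg_mul, neg_add_cancel, Real.rpow_zero]

lemma weight_mul_neg (s : ℝ) (k : Fin d → ℤ) : weight s k * weight (-s) k = 1 := by
  rw [mul_comm, weight_neg_mul]

lemma weight_neg_index (s : ℝ) (k : Fin d → ℤ) : weight s (-k) = weight s k := by
  rw [weight, weight, absOneInt_neg]

/-- An exponent for which the seminorms `p_l`, `q_l` control the pairing with `E^s_{p,q}`. -/
def rate (s : ℝ) : Set.Ioi (0 : ℝ) :=
  -- The factor 2 compensates the halving of the rate in the geometric mean, |s| log 2 absorbs the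
  -- weight, and the extra 1 leaves the summable factor e^{-|k|}.
  ⟨2 * (|s| * Real.log 2 + 1), by
    have := Real.log_pos one_lt_two
    rw [Set.mem_Ioi]; positivity⟩

lemma rate_neg (s : ℝ) : rate (-s) = rate s := by simp [rate]

lemma weight_mul_exp_le (s : ℝ) (k : Fin d → ℤ) :
    weight s k * Real.exp (-((rate s : ℝ) / 2) * absOneInt k) ≤ Real.exp (-absOneInt k) := by
  rw [weight, Real.rpow_def_of_pos two_pos, ← Real.exp_add, Real.exp_le_exp]
  have h1 := Real.log_pos one_lt_two
  have h2 := mul_le_mul_of_nonneg_right (le_abs_self s) (mul_nonneg h1.le (absOneInt_nonneg k))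
  simp only [rate]
  nlinarith

/-! ### Sequences with bounded spectra -/

section Act

variable (p : ℝ≥0∞) [Fact (1 ≤ p)]

instance : Fact (1 ≤ (1 - p⁻¹)⁻¹) := ⟨by simp⟩

instance : ENNReal.HolderConjugate p (1 - p⁻¹)⁻¹ :=
  ENNReal.HolderConjugate.inv_one_sub_inv' (Fact.out : 1 ≤ p)

/-- The functional `f ↦ ∫ f φ` on `L^p`. -/
def act : 𝓢(Rd d, ℂ) →ₗ[ℂ] Lp ℂ p (volume : Measure (Rd d)) →L[ℂ] ℂ :=
  (pair p (1 - p⁻¹)⁻¹).flip.toLinearMap ∘ₗ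
    (SchwartzMap.toLpCLM ℂ ℂ (1 - p⁻¹)⁻¹ (volume : Measure (Rd d))).toLinearMap

variable {p}

lemma act_apply (φ : 𝓢(Rd d, ℂ)) (f : Lp ℂ p (volume : Measure (Rd d))) :
    act p φ f = ∫ x, f x * φ x := pair_toLp f φ

variable (p)

/-- The functions in `L^p` with spectrum in the cube of index `k`. -/
def spectral (k : Fin d → ℤ) : Submodule ℂ (Lp ℂ p (volume : Measure (Rd d))) :=
  ⨅ (u : 𝓢(Rd d, ℂ)) (_ : tsupport u ⊆ (freqCube k)ᶜ), (act p (𝓕 u)).ker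

variable {p}

lemma mem_spectral {k : Fin d → ℤ} {f : Lp ℂ p (volume : Measure (Rd d))} :
    f ∈ spectral p k ↔ HasSpectrumIn f k := by
  simp [spectral, Submodule.mem_iInf, hasSpectrumIn_iff, act_apply]

/-- An intersection of kernels of continuous functionals; completeness of E^s_{p,q} rests on this.
-/
lemma isClosed_spectral (k : Fin d → ℤ) :
    IsClosed (spectral p k : Set (Lp ℂ p (volume : Measure (Rd d)))) := by
  simp only [spectral, Submodule.coe_iInf]
  exact isClosed_iInter fun u => isClosed_iInter fun _ => (act p (𝓕 u)).isClosed_ker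

end Act

section Sequences

variable (d) (p q : ℝ≥0∞) [Fact (1 ≤ p)] [Fact (1 ≤ q)]

/-- The space `ℓ^q(ℤ^d; L^p)`. -/
abbrev SeqLp : Type := lp (fun _ : Fin d → ℤ => Lp ℂ p (volume : Measure (Rd d))) q

/-- The sequences in `ℓ^q(L^p)` whose `k`-th entry has spectrum in the cube of index `k`. -/
def spectralSeq : Submodule ℂ (SeqLp d p q) :=
  ⨅ k, (spectral p k).comap (lp.evalₗ (𝕜 := ℂ) _ q k)

variable {d p q}

lemma mem_spectralSeq {w : SeqLp d p q} : w ∈ spectralSeq d p q ↔ ∀ k, HasSpectrumIn (w k) k := by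
  simp [spectralSeq, Submodule.mem_iInf, mem_spectral]

lemma isClosed_spectralSeq : IsClosed (spectralSeq d p q : Set (SeqLp d p q)) := by
  simp only [spectralSeq, Submodule.coe_iInf]
  refine isClosed_iInter fun k => ?_
  have h : Continuous fun w : SeqLp d p q => w k :=
    (lp.evalCLM ℂ (fun _ : Fin d → ℤ => Lp ℂ p (volume : Measure (Rd d))) q k).continuous
  exact IsClosed.preimage h (isClosed_spectral k)

instance : CompleteSpace (spectralSeq d p q) :=
  isClosed_spectralSeq.completeSpace_coe

lemma norm_apply_le (w : SeqLp d p q) (k : Fin d → ℤ) : ‖w k‖ ≤ ‖w‖ :=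
  lp.norm_apply_le_norm (zero_lt_one.trans_le (Fact.out : 1 ≤ q)).ne' w k

/-- The pairing `∑_k 2^{-s|k|} ∫ w_k φ`. -/
def seqPair (s : ℝ) (w : SeqLp d p q) (φ : 𝓢(Rd d, ℂ)) : ℂ :=
  ∑' k, (weight (-s) k : ℂ) * act p φ (w k)

-- The exponential decay in k beats the weight, leaving e^{-|k|}. Only the sup over k of ‖w k‖ is
-- used, so every q is covered at once.
variable (p q) in
lemma exists_norm_seqPair_term_le (d : ℕ) (s : ℝ) : ∃ C : ℝ, 0 ≤ C ∧
    ∀ w ∈ spectralSeq d p q, ∀ (φ : 𝓢(Rd d, ℂ)) (P Q : ℝ), DecayBound (rate s) P Q φ →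
      ∀ k, ‖(weight (-s) k : ℂ) * act p φ (w k)‖ ≤
        C * (‖w‖ * Real.sqrt (P * Q)) * Real.exp (-absOneInt k) := by
  obtain ⟨C, hC0, hC⟩ := exists_norm_integral_mul_le (d := d) p (rate s).2.le
  refine ⟨C, hC0, fun w hw φ P Q h k => ?_⟩
  rw [norm_mul, Complex.norm_real, Real.norm_of_nonneg (weight_pos _ _).le, act_apply]
  refine (mul_le_mul_of_nonneg_left (hC k _ (mem_spectralSeq.1 hw k) φ P Q h)
    (weight_pos _ _).le).trans ?_
  have h1 := weight_mul_exp_le (-s) k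
  rw [rate_neg] at h1
  calc weight (-s) k * (C * (Real.exp (-((rate s : ℝ) / 2) * absOneInt k) *
      (‖w k‖ * Real.sqrt (P * Q)))) = C * (‖w k‖ * Real.sqrt (P * Q)) *
      (weight (-s) k * Real.exp (-((rate s : ℝ) / 2) * absOneInt k)) := by ring
    _ ≤ _ := by
      have h2 := (weight_pos (-s) k).le
      have h3 := norm_apply_le w k
      gcongr

lemma summable_seqPair {s : ℝ} {w : SeqLp d p q} (hw : w ∈ spectralSeq d p q) {φ : 𝓢(Rd d, ℂ)}
    {P Q : ℝ} (h : DecayBound (rate s) P Q φ) :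
    Summable fun k => (weight (-s) k : ℂ) * act p φ (w k) := by
  obtain ⟨C, -, hC⟩ := exists_norm_seqPair_term_le p q d s
  exact Summable.of_norm_bounded ((summable_exp_neg_absOneInt d).mul_left _) (hC w hw φ P Q h)

variable (p q) in
lemma exists_norm_seqPair_le (d : ℕ) (s : ℝ) : ∃ C : ℝ, 0 ≤ C ∧
    ∀ w ∈ spectralSeq d p q, ∀ (φ : 𝓢(Rd d, ℂ)) (P Q : ℝ), DecayBound (rate s) P Q φ →
      ‖seqPair s w φ‖ ≤ C * (‖w‖ * Real.sqrt (P * Q)) := by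
  obtain ⟨C, hC0, hC⟩ := exists_norm_seqPair_term_le p q d s
  refine ⟨C * ∑' k : Fin d → ℤ, Real.exp (-absOneInt k), by positivity, fun w hw φ P Q h => ?_⟩
  refine (tsum_of_norm_bounded ((summable_exp_neg_absOneInt d).hasSum.mul_left _)
    (hC w hw φ P Q h)).trans (le_of_eq ?_)
  ring

/-- The element `∑_k 2^{-s|k|} w_k` of `𝒮'_m`, as a linear map. -/
def distLinear (s : ℝ) (w : spectralSeq d p q) : GelfandShilov d →ₗ[ℂ] ℂ where
  toFun φ := seqPair s w.1 φ.toSchwartz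
  map_add' φ ψ := by
    rw [seqPair, GelfandShilov.toSchwartz_add, map_add]
    simp only [add_apply, mul_add]
    exact (summable_seqPair w.2 (φ.decayBound _)).tsum_add (summable_seqPair w.2 (ψ.decayBound _))
  map_smul' c φ := by
    rw [seqPair, GelfandShilov.toSchwartz_smul, map_smul]
    simp only [smul_apply, smul_eq_mul, RingHom.id_apply, seqPair, ← tsum_mul_left, mul_left_comm]

/-- A geometric mean is at most the maximum, so this is a bound by finitely many defining seminorms.
-/
lemma continuous_of_seminorm_bound {u : GelfandShilov d →ₗ[ℂ] ℂ} {C : ℝ} (hC : 0 ≤ C)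
    {a b : Set.Ioi (0 : ℝ)}
    (h : ∀ φ, ‖u φ‖ ≤ C * Real.sqrt (GelfandShilov.seminormP a φ * GelfandShilov.seminormQ b φ)) :
    Continuous u := by
  refine WithSeminorms.continuous_normedSpace_rng ℂ (GelfandShilov.withSeminorms d) u
    ⟨{Sum.inl a, Sum.inr b}, ⟨C, hC⟩, fun φ => ?_⟩
  rw [Finset.sup_insert, Finset.sup_singleton]
  change ‖u φ‖ ≤ C * (GelfandShilov.seminormP a φ ⊔ GelfandShilov.seminormQ b φ)
  refine (h φ).trans (mul_le_mul_of_nonneg_left ?_ hC)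
  refine Real.sqrt_le_iff.2 ⟨le_sup_of_le_left (apply_nonneg _ _), ?_⟩
  rw [sq]
  exact mul_le_mul le_sup_left le_sup_right (apply_nonneg _ _)
    (le_sup_of_le_left (apply_nonneg _ _))

lemma continuous_distLinear (s : ℝ) (w : spectralSeq d p q) : Continuous (distLinear s w) := by
  obtain ⟨C, hC0, hC⟩ := exists_norm_seqPair_le p q d s
  refine continuous_of_seminorm_bound (C := C * ‖w‖)
    (a := GelfandShilov.spaceExponent d) (b := rate s) (by positivity) fun φ => ?_
  rw [mul_assoc]
  exact hC w.1 w.2 _ _ _ (φ.decayBound _)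

/-- The map `w ↦ ∑_k 2^{-s|k|} w_k` into `𝒮'_m`. -/
def toDist (s : ℝ) : spectralSeq d p q →ₗ[ℂ] UltraDistribution d where
  toFun w := ⟨distLinear s w, continuous_distLinear s w⟩
  map_add' w v := by
    ext φ
    change seqPair s (w + v).1 _ = seqPair s w.1 _ + seqPair s v.1 _
    rw [seqPair, seqPair, seqPair, ← (summable_seqPair w.2 (φ.decayBound (rate s))).tsum_add
      (summable_seqPair v.2 (φ.decayBound (rate s)))]
    refine tsum_congr fun k => ?_
    rw [← mul_add, ← map_add]
    rfl
  map_smul' c w := by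
    ext φ
    change seqPair s (c • w).1 _ = c * seqPair s w.1 _
    rw [seqPair, seqPair, ← tsum_mul_left]
    refine tsum_congr fun k => ?_
    rw [mul_left_comm, ← smul_eq_mul (a := c), ← map_smul]
    rfl

lemma toDist_apply (s : ℝ) (w : spectralSeq d p q) (φ : GelfandShilov d) :
    toDist s w φ = seqPair s w.1 φ.toSchwartz := rfl

lemma weight_smul_apply (s : ℝ) (f : Lp ℂ p (volume : Measure (Rd d))) (k : Fin d → ℤ)
    (φ : GelfandShilov d) :
    (weight (-s) k : ℂ) * act p φ.toSchwartz f = ∫ x, ((weight (-s) k) • f) x * φ x := by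
  have h : (weight (-s) k) • f = (weight (-s) k : ℂ) • f := (Complex.coe_smul _ _).symm
  rw [h, ← smul_eq_mul, ← map_smul, act_apply, GelfandShilov.coe_toSchwartz]

lemma weighted_weight_smul (s : ℝ) (w : (Fin d → ℤ) → Lp ℂ p (volume : Measure (Rd d))) :
    weighted s (fun k => (weight (-s) k) • w k) = w := by
  funext k
  change weight s k • (weight (-s) k • w k) = w k
  rw [smul_smul, weight_mul_neg, one_smul]

/-- The components of a weighted sequence form a decomposition. -/
lemma isDecomposition_toDist (s : ℝ) (w : spectralSeq d p q) :
    IsDecomposition s q (toDist s w) fun k => (weight (-s) k) • w.1 k where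
  spectrum k := by
    rw [← mem_spectral]
    exact Submodule.smul_of_tower_mem _ _ (mem_spectral.2 (mem_spectralSeq.1 w.2 k))
  hasSum φ := by
    simp only [← weight_smul_apply]
    exact (summable_seqPair w.2 (φ.decayBound (rate s))).hasSum
  memlp := by
    rw [weighted_weight_smul]
    exact lp.memℓp w.1

/-- Together with `isDecomposition_toDist` this identifies the decompositions of u with the fibre of
`toDist` over u, norms included; hence the infimum is a quotient norm. -/
lemma IsDecomposition.exists_spectralSeq {s : ℝ} {u : UltraDistribution d}
    {f : (Fin d → ℤ) → Lp ℂ p (volume : Measure (Rd d))} (hf : IsDecomposition s q u f) :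
    ∃ w : spectralSeq d p q, w.1 = ⟨weighted s f, hf.memlp⟩ ∧ toDist s w = u := by
  have hw : (⟨weighted s f, hf.memlp⟩ : SeqLp d p q) ∈ spectralSeq d p q :=
    mem_spectralSeq.2 fun k => by
      rw [← mem_spectral]
      exact Submodule.smul_of_tower_mem _ _ (mem_spectral.2 (hf.spectrum k))
  refine ⟨⟨_, hw⟩, rfl, ?_⟩
  ext φ
  rw [toDist_apply, seqPair, ← (hf.hasSum φ).tsum_eq]
  refine tsum_congr fun k => ?_
  rw [weight_smul_apply]
  have : weight (-s) k • (weighted s f k) = f k := by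
    change weight (-s) k • (weight s k • f k) = f k
    rw [smul_smul, weight_neg_mul, one_smul]
  rw [← this]

end Sequences

/-! ### `E^s_{p,q}` as a quotient of a Banach space -/

namespace ExpMod

variable {s : ℝ} {p q : ℝ≥0∞} [Fact (1 ≤ p)] [Fact (1 ≤ q)]

lemma toUltra_injective : Function.Injective (toUltra : ExpMod d s p q → UltraDistribution d) :=
  Subtype.val_injective

lemma ext_apply {u v : ExpMod d s p q} (h : ∀ φ : GelfandShilov d, u.toUltra φ = v.toUltra φ) :
    u = v := toUltra_injective (ContinuousLinearMap.ext h)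

/-- The quotient map, as a linear map. -/
def quotLinear (s : ℝ) : spectralSeq d p q →ₗ[ℂ] ExpMod d s p q :=
  (toDist s).codRestrict (expModSubmodule d s p q) fun w => ⟨_, isDecomposition_toDist s w⟩

lemma norm_quotLinear_le (w : spectralSeq d p q) : ‖quotLinear s w‖ ≤ ‖w‖ := by
  refine csInf_le (bddBelow _) ⟨_, isDecomposition_toDist s w, ?_⟩
  rw [Submodule.coe_norm]
  congr 1
  exact Subtype.ext (weighted_weight_smul s w.1).symm

/-- The quotient map `w ↦ ∑_k 2^{-s|k|} w_k` onto `E^s_{p,q}`. -/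
def quot (s : ℝ) : spectralSeq d p q →L[ℂ] ExpMod d s p q :=
  LinearMap.mkContinuous (quotLinear (d := d) (p := p) (q := q) s) 1 fun w => by rw [one_mul]; exact norm_quotLinear_le w

lemma toUltra_quot (w : spectralSeq d p q) : (quot s w).toUltra = toDist s w := rfl

lemma norm_quot_le (w : spectralSeq d p q) : ‖quot s w‖ ≤ ‖w‖ := norm_quotLinear_le w

lemma exists_quot_eq_norm_lt (u : ExpMod d s p q) {ε : ℝ} (hε : 0 < ε) :
    ∃ w : spectralSeq d p q, quot s w = u ∧ ‖w‖ < ‖u‖ + ε := by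
  obtain ⟨_, ⟨f, hf, rfl⟩, hlt⟩ :=
    exists_lt_of_csInf_lt u.decompositionNorms_nonempty
      (show sInf (decompositionNorms s p q u.toUltra) < ‖u‖ + ε by rw [norm_def]; linarith)
  obtain ⟨w, hw1, hw2⟩ := hf.exists_spectralSeq
  refine ⟨w, toUltra_injective hw2, ?_⟩
  rw [Submodule.coe_norm, hw1]
  exact hlt

lemma quot_surjective : Function.Surjective (quot s : spectralSeq d p q → ExpMod d s p q) := fun u =>
  let ⟨w, hw, _⟩ := u.exists_quot_eq_norm_lt one_pos
  ⟨w, hw⟩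

/-- Each value on a test function is bounded by a constant times the norm of any representing
sequence, and these norms can be made arbitrarily small. -/
lemma norm_eq_zero_iff (u : ExpMod d s p q) : ‖u‖ = 0 ↔ u = 0 := by
  refine ⟨fun h => ext_apply fun φ => ?_, fun h => by rw [h, norm_zero]⟩
  obtain ⟨C, hC0, hC⟩ := exists_norm_seqPair_le p q d s
  rw [map_zero, zero_apply, ← norm_le_zero_iff]
  set R := C * Real.sqrt (GelfandShilov.seminormP (GelfandShilov.spaceExponent d) φ *
    GelfandShilov.seminormQ (rate s) φ) with hR
  have hR0 : 0 ≤ R := by positivity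
  have key : ∀ ε : ℝ, 0 < ε → ‖u.toUltra φ‖ ≤ R * ε := fun ε hε => by
    obtain ⟨w, rfl, hlt⟩ := u.exists_quot_eq_norm_lt hε
    rw [h, zero_add] at hlt
    rw [toUltra_quot, toDist_apply]
    refine (hC w.1 w.2 _ _ _ (φ.decayBound _)).trans ?_
    rw [hR, mul_comm ‖w.1‖, ← mul_assoc]
    exact mul_le_mul_of_nonneg_left hlt.le hR0
  have hlim : Tendsto (fun ε : ℝ => R * ε) (𝓝[>] 0) (𝓝 (R * 0)) :=
    ((continuous_const.mul continuous_id).tendsto 0).mono_left nhdsWithin_le_nhds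
  rw [mul_zero] at hlim
  exact ge_of_tendsto hlim (eventually_mem_nhdsWithin.mono key)

instance : NormedAddCommGroup (ExpMod d s p q) :=
  NormedAddCommGroup.ofSeparation fun u h => (norm_eq_zero_iff u).1 h

/-- Lift the terms of an absolutely convergent series with errors 2^{-n}; the lifts are summable in
the Banach space `spectralSeq`, and `quot` maps their sum down. -/
instance : CompleteSpace (ExpMod d s p q) := by
  refine NormedAddCommGroup.completeSpace_of_summable_imp_tendsto fun u hu => ?_
  choose w hw hlt using fun n => (u n).exists_quot_eq_norm_lt (pow_pos (one_half_pos (α := ℝ)) n)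
  have hsum : Summable w := by
    refine Summable.of_norm_bounded (hu.add summable_geometric_two) fun n => ?_
    exact (hlt n).le
  refine ⟨quot s (∑' n, w n), ?_⟩
  have := ((quot s).hasSum hsum.hasSum).tendsto_sum_nat
  simpa only [hw] using this

end ExpMod

end

section

variable {d : ℕ} {p : ℝ≥0∞} [Fact (1 ≤ p)]

/-! ### Frequency multipliers on `L^p` -/

/-- The embedding of L^p in tempered distributions is injective. -/
lemma ext_act {f g : Lp ℂ p (volume : Measure (Rd d))} (h : ∀ η, act p η f = act p η g) :
    f = g := by
  have h1 : f - g ∈ (Lp.toTemperedDistributionCLM ℂ (volume : Measure (Rd d)) p).ker := by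
    rw [LinearMap.mem_ker]
    ext η
    have h2 := h η
    rw [← sub_eq_zero, ← map_sub, act_apply] at h2
    change Lp.toTemperedDistribution (f - g) η = 0
    rw [Lp.toTemperedDistribution_apply]
    simpa only [smul_eq_mul, mul_comm] using h2
  rw [Lp.ker_toTemperedDistributionCLM_eq_bot] at h1
  exact sub_eq_zero.1 ((Submodule.mem_bot ℂ).1 h1)

variable (p) in
/-- Translation by `t` on `L^p`. -/
def trans (t : Rd d) :
    Lp ℂ p (volume : Measure (Rd d)) →ₗᵢ[ℂ] Lp ℂ p (volume : Measure (Rd d)) :=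
  Lp.compMeasurePreservingₗᵢ ℂ (fun x => x - t) (measurePreserving_sub_right volume t)

lemma coeFn_trans_toLp (t : Rd d) (ψ : 𝓢(Rd d, ℂ)) :
    trans p t (ψ.toLp p) =ᵐ[volume] fun x => ψ (x - t) := by
  refine (Lp.coeFn_compMeasurePreserving _ _).trans ?_
  exact (measurePreserving_sub_right volume t).quasiMeasurePreserving.ae_eq_comp
    (ψ.coeFn_toLp p volume)

/-- Strong continuity of translations, which requires p < ∞; it makes convolution available as a
Bochner integral in L^p. -/
lemma continuous_trans (hp : p ≠ ∞) (f : Lp ℂ p (volume : Measure (Rd d))) :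
    Continuous fun t => trans p t f := by
  refine Continuous.compMeasurePreservingLp (f := fun _ : Rd d => f)
    (g := fun t : Rd d => (⟨fun x => x - t, by fun_prop⟩ : C(Rd d, Rd d))) continuous_const ?_
    (fun t => measurePreserving_sub_right volume t) hp
  refine ContinuousMap.continuous_of_continuous_uncurry _ ?_
  exact continuous_snd.sub continuous_fst

lemma integrable_smul_trans (hp : p ≠ ∞) (K : 𝓢(Rd d, ℂ))
    (f : Lp ℂ p (volume : Measure (Rd d))) : Integrable (fun t => K t • trans p t f) volume := by
  refine (K.integrable.norm.mul_const ‖f‖).mono'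
    (K.continuous.smul (continuous_trans hp f)).aestronglyMeasurable
    (Eventually.of_forall fun t => ?_)
  rw [norm_smul, LinearIsometry.norm_map]

/-- The extension of `freqMul M` to `L^p`, `p < ∞`. -/
def freqMulLp (hp : p ≠ ∞) (M : 𝓢(Rd d, ℂ)) :
    Lp ℂ p (volume : Measure (Rd d)) →L[ℂ] Lp ℂ p (volume : Measure (Rd d)) :=
  LinearMap.mkContinuous
    -- Convolution as an average of translates: Young's inequality becomes the triangle inequality
    -- for the Bochner integral.
    { toFun := fun f => ∫ t, (𝓕⁻ M) t • trans p t f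
      map_add' := fun f g => by
        rw [← integral_add (integrable_smul_trans hp _ f) (integrable_smul_trans hp _ g)]
        simp only [map_add, smul_add]
      map_smul' := fun c f => by
        simp only [map_smul, RingHom.id_apply]
        rw [← integral_smul]
        simp only [smul_comm c] }
    (∫ t, ‖(𝓕⁻ M) t‖) fun f => by
      refine (norm_integral_le_integral_norm _).trans (le_of_eq ?_)
      simp only [norm_smul, LinearIsometry.norm_map, integral_mul_const]

lemma freqMulLp_apply (hp : p ≠ ∞) (M : 𝓢(Rd d, ℂ)) (f : Lp ℂ p (volume : Measure (Rd d))) :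
    freqMulLp hp M f = ∫ t, (𝓕⁻ M) t • trans p t f := rfl

lemma norm_freqMulLp_le (hp : p ≠ ∞) (M : 𝓢(Rd d, ℂ)) :
    ‖freqMulLp (p := p) hp M‖ ≤ ∫ t, ‖(𝓕⁻ M) t‖ :=
  LinearMap.mkContinuous_norm_le _ (by positivity) _

/-- Test both sides against a Schwartz function and exchange the two integrals. -/
lemma freqMulLp_toLp (hp : p ≠ ∞) (M ψ : 𝓢(Rd d, ℂ)) :
    freqMulLp hp M (ψ.toLp p) = (freqMul M ψ).toLp p := by
  refine ext_act fun η => ?_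
  rw [freqMulLp_apply, ← ContinuousLinearMap.integral_comp_comm _ (integrable_smul_trans hp _ _)]
  have h1 : ∀ t, act p η ((𝓕⁻ M) t • trans p t (ψ.toLp p)) =
      ∫ x, (𝓕⁻ M) t * ψ (x - t) * η x := fun t => by
    rw [map_smul, act_apply, smul_eq_mul, ← integral_const_mul]
    refine integral_congr_ae ?_
    filter_upwards [coeFn_trans_toLp (p := p) t ψ] with x hx
    rw [hx, mul_assoc]
  simp only [h1]
  rw [integral_integral_swap]
  · rw [act_apply]
    refine integral_congr_ae ?_
    filter_upwards [(freqMul M ψ).coeFn_toLp p volume] with x hx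
    rw [hx, freqMul_apply, integral_mul_const]
  · have h2 : Integrable (fun z : Rd d × Rd d => (𝓕⁻ M) z.1 * η z.2) (volume.prod volume) :=
      (𝓕⁻ M).integrable.mul_prod η.integrable
    have h3 := h2.bdd_mul (c := ‖ψ.toBoundedContinuousFunction‖)
      (f := fun z : Rd d × Rd d => ψ (z.2 - z.1))
      (by fun_prop) (Eventually.of_forall fun z =>
        ψ.toBoundedContinuousFunction.norm_coe_le_norm (z.2 - z.1))
    refine h3.congr (Eventually.of_forall fun z => ?_)
    simp only [Function.uncurry]
    ring

lemma norm_toLp_freqMul_le (hp : p ≠ ∞) (M ψ : 𝓢(Rd d, ℂ)) :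
    ‖(freqMul M ψ).toLp p‖ ≤ (∫ t, ‖(𝓕⁻ M) t‖) * ‖ψ.toLp p‖ := by
  rw [← freqMulLp_toLp hp]
  exact (freqMulLp hp M).le_of_opNorm_le (norm_freqMulLp_le hp M) _

lemma denseRange_toLp (hp : p ≠ ∞) : DenseRange fun ψ : 𝓢(Rd d, ℂ) => ψ.toLp p volume :=
  SchwartzMap.denseRange_toLpCLM hp

lemma exists_seq_toLp_tendsto (hp : p ≠ ∞) (f : Lp ℂ p (volume : Measure (Rd d))) :
    ∃ ψ : ℕ → 𝓢(Rd d, ℂ), Tendsto (fun n => (ψ n).toLp p volume) atTop (𝓝 f) := by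
  obtain ⟨x, hx, hlim⟩ := mem_closure_iff_seq_limit.1 (denseRange_toLp hp f)
  choose ψ hψ using hx
  exact ⟨ψ, by simpa only [hψ] using hlim⟩

/-- The extension of `band τ k` to `L^p`, `p < ∞`. -/
def bandLp (hp : p ≠ ∞) (τ : Cutoff) (k : Fin d → ℤ) :
    Lp ℂ p (volume : Measure (Rd d)) →L[ℂ] Lp ℂ p (volume : Measure (Rd d)) :=
  freqMulLp hp (τ.schw k)

lemma bandLp_toLp (hp : p ≠ ∞) (τ : Cutoff) (k : Fin d → ℤ) (ψ : 𝓢(Rd d, ℂ)) :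
    bandLp hp τ k (ψ.toLp p) = (band τ k ψ).toLp p := freqMulLp_toLp hp _ _

lemma norm_bandLp_le (hp : p ≠ ∞) (τ : Cutoff) (k : Fin d → ℤ) :
    ‖bandLp (p := p) hp τ k‖ ≤ ∫ t, ‖(𝓕⁻ (τ.schw (0 : Fin d → ℤ))) t‖ := by
  refine (norm_freqMulLp_le hp _).trans (le_of_eq ?_)
  simp only [norm_fourierInv_schw τ k]

lemma act_toLp (η ψ : 𝓢(Rd d, ℂ)) : act p η (ψ.toLp p) = ∫ x, ψ x * η x := by
  rw [act_apply]
  refine integral_congr_ae ?_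
  filter_upwards [ψ.coeFn_toLp p volume] with x hx
  rw [hx]

lemma act_bandLp (hp : p ≠ ∞) (τ : Cutoff) (k : Fin d → ℤ) (η : 𝓢(Rd d, ℂ))
    (f : Lp ℂ p (volume : Measure (Rd d))) :
    act p η (bandLp hp τ k f) = act p (band τ.reflect (-k) η) f := by
  refine congrFun ((denseRange_toLp hp).equalizer
    ((act p η).continuous.comp (bandLp hp τ k).continuous)
    (act p (band τ.reflect (-k) η)).continuous (funext fun ψ => ?_)) f
  simp only [Function.comp_apply]
  rw [bandLp_toLp, act_toLp, act_toLp, integral_band_mul]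

lemma hasSpectrumIn_bandLp (hp : p ≠ ∞) (k : Fin d → ℤ)
    (f : Lp ℂ p (volume : Measure (Rd d))) : HasSpectrumIn (bandLp hp .narrow k f) k := by
  obtain ⟨ψ, hψ⟩ := exists_seq_toLp_tendsto hp f
  rw [← mem_spectral]
  refine (isClosed_spectral k).mem_of_tendsto ((bandLp hp .narrow k).continuous.tendsto f |>.comp hψ)
    (Eventually.of_forall fun n => ?_)
  rw [Function.comp_apply, bandLp_toLp]
  exact mem_spectral.2 (hasSpectrumIn_band k _)

/-- Convolution is commutative: here ψ becomes the kernel and the inverse transform of M the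
function translated, so that a functional can later be moved inside the integral against ψ. -/
lemma freqMul_fourier_comm (M ψ : 𝓢(Rd d, ℂ)) : freqMul M ψ = freqMul (𝓕 ψ) (𝓕⁻ M) := by
  rw [← FourierTransform.fourierInv_fourier_eq (F := 𝓢(Rd d, ℂ)) (freqMul M ψ), ← FourierTransform.fourierInv_fourier_eq (F := 𝓢(Rd d, ℂ)) (freqMul (𝓕 ψ) (𝓕⁻ M))]
  congr 1
  ext ξ
  rw [fourier_freqMul, fourier_freqMul, FourierTransform.fourier_fourierInv_eq, mul_comm]

/-- The kernel representing `ψ ↦ Λ (freqMul M ψ)`. -/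
def kernel (Λ : Lp ℂ p (volume : Measure (Rd d)) →L[ℂ] ℂ) (M : 𝓢(Rd d, ℂ)) (t : Rd d) : ℂ :=
  Λ (trans p t ((𝓕⁻ M).toLp p))

lemma continuous_kernel (hp : p ≠ ∞) (Λ : Lp ℂ p (volume : Measure (Rd d)) →L[ℂ] ℂ)
    (M : 𝓢(Rd d, ℂ)) : Continuous (kernel Λ M) :=
  Λ.continuous.comp (continuous_trans hp _)

lemma norm_kernel_le (Λ : Lp ℂ p (volume : Measure (Rd d)) →L[ℂ] ℂ) (M : 𝓢(Rd d, ℂ))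
    (t : Rd d) : ‖kernel Λ M t‖ ≤ ‖Λ‖ * ‖(𝓕⁻ M).toLp p‖ := by
  refine (Λ.le_opNorm _).trans (le_of_eq ?_)
  rw [LinearIsometry.norm_map]

lemma apply_freqMul (hp : p ≠ ∞) (Λ : Lp ℂ p (volume : Measure (Rd d)) →L[ℂ] ℂ)
    (M ψ : 𝓢(Rd d, ℂ)) : Λ ((freqMul M ψ).toLp p) = ∫ t, ψ t * kernel Λ M t := by
  rw [freqMul_fourier_comm, ← freqMulLp_toLp hp, freqMulLp_apply,
    ← ContinuousLinearMap.integral_comp_comm _ (integrable_smul_trans hp _ _),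
    FourierTransform.fourierInv_fourier_eq]
  simp only [map_smul, smul_eq_mul, kernel]

end

section

/-! ### Converse Hölder inequalities -/

lemma holderConjugate_toReal {p p' : ℝ≥0∞} [Fact (1 ≤ p)] [ENNReal.HolderConjugate p p']
    (hp1 : p ≠ 1) (hp : p ≠ ∞) : p.toReal.HolderConjugate p'.toReal := by
  have h1 : 1 < p := lt_of_le_of_ne Fact.out (Ne.symm hp1)
  refine ENNReal.HolderConjugate.toReal ?_
  simpa using (ENNReal.toReal_lt_toReal ENNReal.one_ne_top hp).2 h1

variable {d : ℕ} {p p' : ℝ≥0∞} [Fact (1 ≤ p)] [Fact (1 ≤ p')] [ENNReal.HolderConjugate p p']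

/-- Test g against the extremal function of Hölder's inequality, |g|^{p'-2} times the conjugate of
g, whose L^p norm is ‖g‖^{p'-1}. -/
lemma norm_le_of_pair_le (hp1 : p ≠ 1) (hp : p ≠ ∞) {D : ℝ} (hD : 0 ≤ D)
    (g : Lp ℂ p' (volume : Measure (Rd d)))
    (h : ∀ f : Lp ℂ p (volume : Measure (Rd d)), ‖pair p p' f g‖ ≤ D * ‖f‖) : ‖g‖ ≤ D := by
  have hc := holderConjugate_toReal (p' := p') hp1 hp
  set r := p'.toReal with hr
  have hr1 : 1 < r := hc.symm.lt
  have hp' : p' ≠ ∞ := by rintro rfl; norm_num [hr] at hr1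
  have hp'0 : p' ≠ 0 := by rintro rfl; norm_num [hr] at hr1
  have hexp : p * ENNReal.ofReal (r - 1) = p' := by
    rw [← ENNReal.toReal_eq_toReal_iff' (ENNReal.mul_ne_top hp ENNReal.ofReal_ne_top) hp',
      ENNReal.toReal_mul, ENNReal.toReal_ofReal (by linarith), ← hr]
    have := hc.mul_eq_add
    linarith
  -- The exponent r - 2 may be zero or negative, but where g vanishes the conjugate factor is zero,
  -- so the value assigned to the power of 0 is irrelevant.
  set F : Rd d → ℂ := fun x => ((‖g x‖ ^ (r - 2) : ℝ) : ℂ) * (starRingEnd ℂ) (g x) with hF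
  have hFnorm : ∀ x, ‖F x‖ = ‖g x‖ ^ (r - 1) := fun x => by
    rw [hF]
    simp only [norm_mul, Complex.norm_real, RCLike.norm_conj]
    rw [Real.norm_of_nonneg (by positivity)]
    rcases eq_or_ne (g x) 0 with h0 | h0
    · rw [h0, norm_zero, mul_zero, Real.zero_rpow (by linarith)]
    · have h1 : (r - 1 : ℝ) = r - 2 + 1 := by ring
      rw [h1, Real.rpow_add (norm_pos_iff.2 h0), Real.rpow_one]
  have hgm : AEStronglyMeasurable g volume := (Lp.memLp g).1
  have hFm : AEStronglyMeasurable F volume := by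
    refine AEStronglyMeasurable.mul ?_ (Complex.continuous_conj.comp_aestronglyMeasurable hgm)
    exact Complex.continuous_ofReal.comp_aestronglyMeasurable
      (hgm.norm.aemeasurable.pow_const _).aestronglyMeasurable
  have hFe : eLpNorm F p volume = eLpNorm g p' volume ^ (r - 1) := by
    rw [← eLpNorm_norm F]
    simp only [hFnorm]
    rw [eLpNorm_norm_rpow _ (by linarith), hexp]
  have hFL : MemLp F p volume := by
    refine ⟨hFm, ?_⟩
    rw [hFe]
    exact ENNReal.rpow_lt_top_of_nonneg (by linarith) (Lp.memLp g).eLpNorm_ne_top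
  have hN : ‖hFL.toLp F‖ = ‖g‖ ^ (r - 1) := by
    rw [Lp.norm_toLp, hFe, ← ENNReal.toReal_rpow, Lp.norm_def]
  have hpair : pair p p' (hFL.toLp F) g = ((‖g‖ ^ r : ℝ) : ℂ) := by
    rw [pair_apply]
    have h1 : ∫ x, hFL.toLp F x * g x = ∫ x, ((‖g x‖ ^ r : ℝ) : ℂ) := by
      refine integral_congr_ae ?_
      filter_upwards [hFL.coeFn_toLp] with x hx
      rw [hx, hF]
      simp only
      rw [mul_assoc, mul_comm ((starRingEnd ℂ) (g x)), Complex.mul_conj, Complex.normSq_eq_norm_sq,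
        ← Complex.ofReal_mul]
      congr 1
      rcases eq_or_ne (g x) 0 with h0 | h0
      · rw [h0, norm_zero, Real.zero_rpow (by linarith : r ≠ 0)]; simp
      · rw [← Real.rpow_natCast, ← Real.rpow_add (norm_pos_iff.2 h0)]
        congr 1; push_cast; ring
    rw [h1, integral_complex_ofReal, Lp.norm_def,
      (Lp.memLp g).eLpNorm_eq_integral_rpow_norm hp'0 hp', ENNReal.toReal_ofReal (by positivity),
      ← hr, ← Real.rpow_mul (by positivity), inv_mul_cancel₀ (by linarith), Real.rpow_one]
  have h2 := h (hFL.toLp F)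
  rw [hpair, hN, Complex.norm_real, Real.norm_of_nonneg (by positivity)] at h2
  rcases eq_or_lt_of_le (norm_nonneg g) with h0 | h0
  · rwa [← h0]
  · have h3 : ‖g‖ ^ r = ‖g‖ * ‖g‖ ^ (r - 1) := by
      rw [← Real.rpow_one_add' h0.le (by linarith)]; congr 1; ring
    rw [h3] at h2
    exact le_of_mul_le_mul_right h2 (by positivity)

/-- Smooth compactly supported functions with values in `[0, 1]` exhausting `ℝ^d`. -/
lemma exists_exhaustion (d : ℕ) : ∃ η : ℕ → 𝓢(Rd d, ℂ), (∀ n x, ‖η n x‖ ≤ 1) ∧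
    ∀ x, Tendsto (fun n => η n x) atTop (𝓝 1) := by
  let b : ℕ → ContDiffBump (0 : Rd d) := fun n => ⟨n + 1, n + 2, by positivity, by linarith⟩
  have h1 : ∀ n, HasCompactSupport fun x => ((b n x : ℝ) : ℂ) := fun n =>
    (b n).hasCompactSupport.comp_left (g := fun t : ℝ => (t : ℂ)) Complex.ofReal_zero
  have h2 : ∀ n, ContDiff ℝ (⊤ : ℕ∞) fun x => ((b n x : ℝ) : ℂ) := fun n =>
    Complex.ofRealCLM.contDiff.comp (b n).contDiff
  refine ⟨fun n => (h1 n).toSchwartzMap (h2 n), fun n x => ?_, fun x => ?_⟩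
  · change ‖((b n x : ℝ) : ℂ)‖ ≤ 1
    rw [Complex.norm_real, Real.norm_of_nonneg (b n).nonneg]
    exact (b n).le_one
  · refine tendsto_const_nhds.congr' ?_
    filter_upwards [eventually_ge_atTop ⌈‖x‖⌉₊] with n hn
    change (1 : ℂ) = ((b n x : ℝ) : ℂ)
    rw [(b n).one_of_mem_closedBall, Complex.ofReal_one]
    rw [mem_closedBall_zero_iff]
    exact (Nat.ceil_le.1 hn).trans (by change (n : ℝ) ≤ n + 1; linarith)

lemma exists_schwartz_mul (η ψ : 𝓢(Rd d, ℂ)) : ∃ u : 𝓢(Rd d, ℂ), ∀ x, u x = η x * ψ x :=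
  ⟨SchwartzMap.bilinLeftCLM (ContinuousLinearMap.mul ℂ ℂ) ψ.hasTemperateGrowth η,
    fun _ => rfl⟩

/-- It is not known beforehand that γ is in L^{p'}. The truncations by η n are, and their norms are
at most D because multiplying ψ by η n does not increase its L^p norm; Fatou's lemma passes to the
limit. -/
lemma eLpNorm_le_of_integral_schwartz_le (hp1 : p ≠ 1) (hp : p ≠ ∞) {D B : ℝ} (hD : 0 ≤ D)
    {γ : Rd d → ℂ} (hc : Continuous γ) (hB : ∀ x, ‖γ x‖ ≤ B)
    (h : ∀ ψ : 𝓢(Rd d, ℂ), ‖∫ x, ψ x * γ x‖ ≤ D * ‖ψ.toLp p‖) :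
    eLpNorm γ p' volume ≤ ENNReal.ofReal D := by
  obtain ⟨η, hη1, hηlim⟩ := exists_exhaustion d
  have hB0 : 0 ≤ B := (norm_nonneg _).trans (hB 0)
  have hm : ∀ n, MemLp (fun x => η n x * γ x) p' volume := fun n => by
    refine ((η n).memLp p' volume).of_le_mul (c := B)
      (((η n).continuous.mul hc).aestronglyMeasurable) (Eventually.of_forall fun x => ?_)
    rw [norm_mul, mul_comm]
    exact mul_le_mul_of_nonneg_right (hB x) (norm_nonneg _)
  have hn : ∀ n, ‖(hm n).toLp _‖ ≤ D := fun n => by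
    refine norm_le_of_pair_le (p := p) hp1 hp hD _ fun f => ?_
    refine (denseRange_toLp hp).induction_on f
      (isClosed_le (by fun_prop) (by fun_prop)) fun ψ => ?_
    rw [toLp_pair]
    obtain ⟨u, hu⟩ := exists_schwartz_mul (η n) ψ
    have h1 : ∫ x, ψ x * (hm n).toLp _ x = ∫ x, u x * γ x := by
      refine integral_congr_ae ?_
      filter_upwards [(hm n).coeFn_toLp] with x hx
      rw [hx, hu]; ring
    rw [h1]
    refine (h u).trans (mul_le_mul_of_nonneg_left ?_ hD)
    rw [SchwartzMap.norm_toLp, SchwartzMap.norm_toLp]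
    refine ENNReal.toReal_mono (ψ.memLp p volume).eLpNorm_ne_top (eLpNorm_mono fun x => ?_)
    rw [hu, norm_mul]
    exact mul_le_of_le_one_left (norm_nonneg _) (hη1 n x)
  refine (Lp.eLpNorm_lim_le_liminf_eLpNorm (fun n => (hm n).1) γ
    (Eventually.of_forall fun x => ?_)).trans ?_
  · simpa using (hηlim x).mul_const (γ x)
  · refine liminf_le_of_le (by isBoundedDefault) fun b hb => ?_
    obtain ⟨n, hn'⟩ := hb.exists
    refine hn'.trans ?_
    have h3 := hn n
    rw [Lp.norm_toLp] at h3
    exact ENNReal.le_ofReal_iff_toReal_le (hm n).eLpNorm_ne_top (ENNReal.toReal_nonneg.trans h3) |>.2 h3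

/-- Riesz representation for the functional `ψ ↦ Λ (freqMul M ψ)`. -/
lemma exists_kernel_Lp (hp : p ≠ ∞) (Λ : Lp ℂ p (volume : Measure (Rd d)) →L[ℂ] ℂ)
    (M : 𝓢(Rd d, ℂ)) : ∃ G : Lp ℂ p' (volume : Measure (Rd d)),
      (∀ ψ, act p' ψ G = Λ ((freqMul M ψ).toLp p)) ∧ ‖G‖ ≤ (∫ t, ‖(𝓕⁻ M) t‖) * ‖Λ‖ := by
  have hbound : eLpNorm (kernel Λ M) p' volume ≤ ENNReal.ofReal ((∫ t, ‖(𝓕⁻ M) t‖) * ‖Λ‖) := by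
    -- For p = 1 the conjugate norm is the essential supremum and the pointwise bound on the kernel
    -- suffices; otherwise the converse Hölder inequality applies.
    by_cases hp1 : p = 1
    · subst hp1
      have hp' : p' = ∞ := by
        have := ENNReal.HolderConjugate.conjExponent_eq (p := 1) (q := p')
        rw [← this]; simp [ENNReal.conjExponent]
      subst hp'
      rw [eLpNorm_exponent_top]
      refine eLpNormEssSup_le_of_ae_bound (Eventually.of_forall fun t => ?_)
      refine (norm_kernel_le Λ M t).trans (le_of_eq ?_)
      rw [mul_comm, SchwartzMap.norm_toLp, eLpNorm_one_eq_lintegral_enorm,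
        integral_norm_eq_lintegral_enorm (𝓕⁻ M).continuous.aestronglyMeasurable]
    · refine eLpNorm_le_of_integral_schwartz_le (p := p) hp1 hp (by positivity)
        (continuous_kernel hp Λ M) (norm_kernel_le Λ M) fun ψ => ?_
      rw [← apply_freqMul hp]
      refine (Λ.le_opNorm _).trans ?_
      have := norm_toLp_freqMul_le hp M ψ
      calc _ ≤ ‖Λ‖ * ((∫ t, ‖(𝓕⁻ M) t‖) * ‖ψ.toLp p‖) := by gcongr
        _ = _ := by ring
  have hmem : MemLp (kernel Λ M) p' volume :=
    ⟨(continuous_kernel hp Λ M).aestronglyMeasurable, hbound.trans_lt ENNReal.ofReal_lt_top⟩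
  refine ⟨hmem.toLp _, fun ψ => ?_, ?_⟩
  · rw [apply_freqMul hp, act_apply]
    refine integral_congr_ae ?_
    filter_upwards [hmem.coeFn_toLp] with x hx
    rw [hx, mul_comm]
  · rw [Lp.norm_toLp]
    exact ENNReal.toReal_le_of_le_ofReal (by positivity) hbound

/-! ### Functionals on ℓ^q and the norms of their components -/

section Sequences

variable {ι κ : Type*} [DecidableEq ι] {E : ι → Type*} {F : κ → Type*}
  [∀ i, NormedAddCommGroup (E i)] [∀ i, NormedSpace ℂ (E i)] [∀ i, NormedAddCommGroup (F i)]
  {q q' : ℝ≥0∞} [Fact (1 ≤ q)] [Fact (1 ≤ q')] [ENNReal.HolderConjugate q q']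

/-- The restriction of a functional on `ℓ^q` to the `i`-th component. -/
def component (Λ : lp E q →L[ℂ] ℂ) (i : ι) : E i →L[ℂ] ℂ :=
  Λ ∘L lp.singleContinuousLinearMap ℂ E q i

lemma component_apply (Λ : lp E q →L[ℂ] ℂ) (i : ι) (x : E i) :
    component Λ i x = Λ (lp.single q i x) := rfl

lemma norm_component_le (Λ : lp E q →L[ℂ] ℂ) (i : ι) : ‖component Λ i‖ ≤ ‖Λ‖ := by
  refine ContinuousLinearMap.opNorm_le_bound _ (norm_nonneg _) fun x => ?_
  rw [component_apply]
  refine (Λ.le_opNorm _).trans (le_of_eq ?_)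
  rw [lp.norm_single (zero_lt_one.trans_le (Fact.out : 1 ≤ q))]

/-- Choose unit-ball vectors that almost attain the component norms, with real values, and evaluate
Λ on their combination with coefficients a, whose ℓ^q norm is at most one. -/
lemma sum_mul_norm_component_le (hq : q ≠ ∞) (Λ : lp E q →L[ℂ] ℂ) (S : Finset ι) (a : ι → ℝ)
    (ha : ∀ i, 0 ≤ a i) (ha1 : ∑ i ∈ S, a i ^ q.toReal ≤ 1) :
    ∑ i ∈ S, a i * ‖component Λ i‖ ≤ ‖Λ‖ := by
  have hq0 : 0 < q.toReal :=
    ENNReal.toReal_pos (zero_lt_one.trans_le (Fact.out : 1 ≤ q)).ne' hq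
  have key : ∀ ε : ℝ, 0 < ε → ∑ i ∈ S, a i * (‖component Λ i‖ - ε) ≤ ‖Λ‖ := fun ε hε => by
    have hx : ∀ i, ∃ x : E i, ‖x‖ ≤ 1 ∧ ∃ t : ℝ, ‖component Λ i‖ - ε ≤ t ∧
        component Λ i x = (t : ℂ) := fun i => by
      obtain ⟨x, hx1, hx2⟩ :=
        (component Λ i).exists_lt_apply_of_lt_opNorm (sub_lt_self ‖component Λ i‖ hε)
      rcases eq_or_ne (component Λ i x) 0 with h0 | h0
      · rw [h0, norm_zero] at hx2
        exact ⟨0, by simp, 0, hx2.le, by simp⟩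
      refine ⟨((‖component Λ i x‖ : ℂ) / component Λ i x) • x, ?_, ‖component Λ i x‖, hx2.le, ?_⟩
      · rw [norm_smul, norm_div, Complex.norm_real, norm_norm, div_self (norm_ne_zero_iff.2 h0),
          one_mul]
        exact hx1.le
      · rw [map_smul, smul_eq_mul, div_mul_cancel₀ _ h0]
    choose x hx1 t ht hxt using hx
    have h1 : Λ (∑ i ∈ S, lp.single q i ((a i : ℂ) • x i)) = ((∑ i ∈ S, a i * t i : ℝ) : ℂ) := by
      rw [map_sum, Complex.ofReal_sum]
      refine Finset.sum_congr rfl fun i _ => ?_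
      rw [← component_apply, map_smul, hxt, smul_eq_mul, Complex.ofReal_mul]
    have h2 : ‖∑ i ∈ S, lp.single q i ((a i : ℂ) • x i)‖ ≤ 1 := by
      have h3 := lp.norm_sum_single hq0 (fun i => (a i : ℂ) • x i) S
      have h4 : ∑ i ∈ S, ‖(a i : ℂ) • x i‖ ^ q.toReal ≤ 1 := by
        refine (Finset.sum_le_sum fun i _ => ?_).trans ha1
        refine Real.rpow_le_rpow (norm_nonneg _) ?_ hq0.le
        rw [norm_smul, Complex.norm_real, Real.norm_of_nonneg (ha i)]
        exact mul_le_of_le_one_right (ha i) (hx1 i)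
      rw [← h3] at h4
      rw [← Real.one_rpow q.toReal] at h4
      exact (Real.rpow_le_rpow_iff (norm_nonneg _) zero_le_one hq0).1 h4
    calc ∑ i ∈ S, a i * (‖component Λ i‖ - ε) ≤ ∑ i ∈ S, a i * t i :=
          Finset.sum_le_sum fun i _ => mul_le_mul_of_nonneg_left (ht i) (ha i)
      _ ≤ ‖((∑ i ∈ S, a i * t i : ℝ) : ℂ)‖ := by
          rw [Complex.norm_real]; exact le_abs_self _
      _ ≤ ‖Λ‖ * 1 := by rw [← h1]; exact Λ.le_opNorm_of_le h2
      _ = ‖Λ‖ := mul_one _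
  have hlim : Tendsto (fun ε : ℝ => ∑ i ∈ S, a i * (‖component Λ i‖ - ε)) (𝓝[>] 0)
      (𝓝 (∑ i ∈ S, a i * (‖component Λ i‖ - 0))) :=
    (Continuous.tendsto (by fun_prop) 0).mono_left nhdsWithin_le_nhds
  simp only [sub_zero] at hlim
  exact le_of_tendsto hlim (eventually_mem_nhdsWithin.mono key)

/-- A sequence dominated by the component norms of a functional on `ℓ^q` belongs to `ℓ^{q'}`. -/
lemma exists_lp_of_norm_le_component (hq : q ≠ ∞) (Λ : lp E q →L[ℂ] ℂ) {C : ℝ} (hC : 0 ≤ C)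
    (σ : κ ↪ ι) (g : ∀ i, F i) (hg : ∀ i, ‖g i‖ ≤ C * ‖component Λ (σ i)‖) :
    ∃ G : lp F q', (∀ i, G i = g i) ∧ ‖G‖ ≤ C * ‖Λ‖ := by
  by_cases hq1 : q = 1
  · subst hq1
    have hq' : q' = ∞ := by
      have := ENNReal.HolderConjugate.conjExponent_eq (p := 1) (q := q')
      rw [← this]; simp [ENNReal.conjExponent]
    subst hq'
    have hb : ∀ i, ‖g i‖ ≤ C * ‖Λ‖ := fun i =>
      (hg i).trans (mul_le_mul_of_nonneg_left (norm_component_le Λ _) hC)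
    exact ⟨⟨g, memℓp_infty ⟨C * ‖Λ‖, by rintro _ ⟨i, rfl⟩; exact hb i⟩⟩, fun _ => rfl,
      lp.norm_le_of_forall_le (by positivity) hb⟩
  have hc := holderConjugate_toReal (p' := q') hq1 hq
  have hcomp : ∀ S : Finset ι,
      ∑ i ∈ S, ‖component Λ i‖ ^ q'.toReal ≤ ‖Λ‖ ^ q'.toReal := fun S => by
    -- b is extremal for finite Hölder duality: the linear estimate at b is the bound on the ℓ^{q'}
    -- norm.
    obtain ⟨b, hb1, hb2⟩ := (NNReal.isGreatest_Lp S (fun i => ‖component Λ i‖₊) hc.symm).1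
    have h1 := sum_mul_norm_component_le hq Λ S (fun i => (b i : ℝ)) (fun i => (b i).2)
      (by exact_mod_cast hb1)
    have h2 : (∑ i ∈ S, ‖component Λ i‖ ^ q'.toReal) ^ (1 / q'.toReal) ≤ ‖Λ‖ := by
      refine le_trans (le_of_eq ?_) h1
      have := congrArg NNReal.toReal hb2
      simp only at this
      push_cast at this
      rw [← this]
      exact Finset.sum_congr rfl fun i _ => mul_comm _ _
    rw [one_div] at h2
    exact (Real.rpow_inv_le_iff_of_pos (by positivity) (norm_nonneg _) hc.symm.pos).1 h2
  have hsum : ∀ S : Finset κ, ∑ i ∈ S, ‖g i‖ ^ q'.toReal ≤ (C * ‖Λ‖) ^ q'.toReal := fun S => by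
    calc ∑ i ∈ S, ‖g i‖ ^ q'.toReal ≤
        ∑ i ∈ S, C ^ q'.toReal * ‖component Λ (σ i)‖ ^ q'.toReal := by
          refine Finset.sum_le_sum fun i _ => ?_
          rw [← Real.mul_rpow hC (norm_nonneg _)]
          exact Real.rpow_le_rpow (norm_nonneg _) (hg i) hc.symm.nonneg
      _ = C ^ q'.toReal * ∑ i ∈ S.map σ, ‖component Λ i‖ ^ q'.toReal := by
          rw [Finset.sum_map, Finset.mul_sum]
      _ ≤ C ^ q'.toReal * ‖Λ‖ ^ q'.toReal := by gcongr; exact hcomp _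
      _ = _ := by rw [Real.mul_rpow hC (norm_nonneg _)]
  exact ⟨⟨g, memℓp_gen' hsum⟩, fun _ => rfl,
    lp.norm_le_of_forall_sum_le hc.symm.pos (by positivity) hsum⟩

end Sequences

end

section

variable {d : ℕ}

/-! ### Band decompositions of Schwartz functions -/

/-- The one-entry sequences sum absolutely in ℓ^q, so no case distinction on q is needed, even for q
= ∞. -/
lemma exists_lp_of_norm_le_summable {ι : Type*} [DecidableEq ι] {E : ι → Type*}
    [∀ i, NormedAddCommGroup (E i)] [∀ i, NormedSpace ℂ (E i)] [∀ i, CompleteSpace (E i)]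
    (q : ℝ≥0∞) [Fact (1 ≤ q)] (x : ∀ i, E i) {b : ι → ℝ} (hb : Summable b)
    (hx : ∀ i, ‖x i‖ ≤ b i) : ∃ w : lp E q, (∀ i, w i = x i) ∧ ‖w‖ ≤ ∑' i, b i := by
  have hq : 0 < q := zero_lt_one.trans_le Fact.out
  have hx' : ∀ i, ‖lp.single q i (x i)‖ ≤ b i := fun i => by
    rw [lp.norm_single hq]; exact hx i
  have hs : Summable fun i => lp.single q i (x i) := Summable.of_norm_bounded hb hx'
  refine ⟨∑' i, lp.single q i (x i), fun i => ?_, tsum_of_norm_bounded hb.hasSum hx'⟩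
  have h1 := (lp.evalCLM ℂ E q i).map_tsum hs
  refine h1.trans ((tsum_eq_single i fun j hj => ?_).trans ?_)
  · exact lp.single_apply_ne q j (x j) hj.symm
  · exact lp.single_apply_self q i (x i)

/-- On the frequency side this is the partition of unity under the integral; the symbols are
non-negative with sum one, so the absolute value of the full integrand dominates. -/
lemma hasSum_integral_band_mul (φ ψ : 𝓢(Rd d, ℂ)) :
    HasSum (fun k : Fin d → ℤ => ∫ x, band .narrow k φ x * ψ x) (∫ x, φ x * ψ x) := by
  have h1 : ∀ u : 𝓢(Rd d, ℂ), ∫ x, u x * ψ x = ∫ ξ, 𝓕 u ξ * 𝓕⁻ ψ ξ := fun u => by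
    rw [← SchwartzMap.integral_fourierInv_mul_eq, FourierTransform.fourierInv_fourier_eq]
  simp only [h1, fourier_band, mul_assoc]
  obtain ⟨v, hv⟩ := exists_schwartz_mul (𝓕 φ) (𝓕⁻ ψ)
  simp only [← hv]
  refine hasSum_integral_of_dominated_convergence (fun k ξ => Cutoff.narrow.symb k ξ * ‖v ξ‖)
    (fun k => ?_) (fun k => Eventually.of_forall fun ξ => ?_)
    (Eventually.of_forall fun ξ => ((Cutoff.hasSum_narrow_symb ξ).mul_right _).summable) ?_
    (Eventually.of_forall fun ξ => ?_)
  · have h2 : Continuous fun ξ : Rd d => ((Cutoff.narrow.symb k ξ : ℝ) : ℂ) :=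
      (Cutoff.narrow.schw k).continuous
    exact (h2.mul v.continuous).aestronglyMeasurable
  · rw [norm_mul, Complex.norm_real, Real.norm_of_nonneg (Cutoff.narrow_symb_nonneg _ _)]
  · refine v.integrable.norm.congr (Eventually.of_forall fun ξ => ?_)
    simp only
    rw [((Cutoff.hasSum_narrow_symb ξ).mul_right _).tsum_eq, one_mul]
  · have := (Complex.hasSum_ofReal.2 (Cutoff.hasSum_narrow_symb ξ)).mul_right (v ξ)
    simpa using this

variable {s : ℝ} {p q : ℝ≥0∞} [Fact (1 ≤ p)] [Fact (1 ≤ q)]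

/-- `w` is the weighted sequence of the frequency-localised parts of `φ`. -/
def IsBandSeq (s : ℝ) (φ : 𝓢(Rd d, ℂ)) (w : spectralSeq d p q) : Prop :=
  ∀ k, w.1 k = weight s k • (band .narrow k φ).toLp p volume

lemma IsBandSeq.sub {φ ψ : 𝓢(Rd d, ℂ)} {w v : spectralSeq d p q} (hw : IsBandSeq s φ w)
    (hv : IsBandSeq s ψ v) : IsBandSeq s (φ - ψ) (w - v) := fun k => by
  rw [Submodule.coe_sub, lp.coeFn_sub, Pi.sub_apply, hw k, hv k, ← smul_sub, map_sub]
  exact congrArg _ (map_sub (SchwartzMap.toLpCLM ℂ ℂ p (volume : Measure (Rd d))) _ _).symm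

lemma IsBandSeq.unique {φ : 𝓢(Rd d, ℂ)} {w v : spectralSeq d p q} (hw : IsBandSeq s φ w)
    (hv : IsBandSeq s φ v) : w = v :=
  Subtype.ext (lp.ext (funext fun k => (hw k).trans (hv k).symm))

-- This places test functions in E^s_{p,q}. It is stated for Schwartz functions with explicit
-- constants, so that it also measures errors of approximation.
variable (p q) in
lemma exists_isBandSeq (d : ℕ) (s : ℝ) : ∃ C : ℝ, 0 ≤ C ∧ ∀ (φ : 𝓢(Rd d, ℂ)) (P Q : ℝ),
    DecayBound (rate s) P Q φ →
      ∃ w : spectralSeq d p q, IsBandSeq s φ w ∧ ‖w‖ ≤ C * Real.sqrt (P * Q) := by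
  obtain ⟨C, hC0, hC⟩ := exists_norm_toLp_band_le (d := d) .narrow (rate s).2.le p Fact.out
  refine ⟨C * ∑' k : Fin d → ℤ, Real.exp (-absOneInt k), by positivity, fun φ P Q h => ?_⟩
  have hb : ∀ k, ‖weight s k • (band .narrow k φ).toLp p volume‖ ≤
      C * Real.sqrt (P * Q) * Real.exp (-absOneInt k) := fun k => by
    rw [norm_smul, Real.norm_of_nonneg (weight_pos s k).le]
    refine (mul_le_mul_of_nonneg_left (hC φ P Q h k) (weight_pos s k).le).trans ?_
    rw [mul_left_comm, mul_comm (Real.exp _), mul_left_comm (weight s k), ← mul_assoc]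
    exact mul_le_mul_of_nonneg_left (weight_mul_exp_le s k) (by positivity)
  obtain ⟨w, hw1, hw2⟩ := exists_lp_of_norm_le_summable
    (E := fun _ : Fin d → ℤ => Lp ℂ p (volume : Measure (Rd d))) q _
    ((summable_exp_neg_absOneInt d).mul_left (C * Real.sqrt (P * Q))) hb
  have hw : w ∈ spectralSeq d p q := mem_spectralSeq.2 fun k => by
    rw [hw1, ← mem_spectral]
    exact Submodule.smul_of_tower_mem _ _ (mem_spectral.2 (hasSpectrumIn_band k φ))
  refine ⟨⟨w, hw⟩, hw1, hw2.trans (le_of_eq ?_)⟩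
  rw [tsum_mul_left]; ring

lemma weight_mul_act_weight_smul (s : ℝ) (k : Fin d → ℤ) (η : 𝓢(Rd d, ℂ))
    (f : Lp ℂ p (volume : Measure (Rd d))) :
    (weight (-s) k : ℂ) * act p η (weight s k • f) = act p η f := by
  have h : weight s k • f = (weight s k : ℂ) • f := (Complex.coe_smul _ _).symm
  rw [h, map_smul, smul_eq_mul, ← mul_assoc, ← Complex.ofReal_mul, weight_neg_mul,
    Complex.ofReal_one, one_mul]

lemma IsBandSeq.seqPair_eq {φ : 𝓢(Rd d, ℂ)} {w : spectralSeq d p q} (hw : IsBandSeq s φ w)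
    (ψ : 𝓢(Rd d, ℂ)) : seqPair s w.1 ψ = ∫ x, φ x * ψ x := by
  rw [seqPair, ← (hasSum_integral_band_mul φ ψ).tsum_eq]
  refine tsum_congr fun k => ?_
  rw [hw k, weight_mul_act_weight_smul, act_toLp]

lemma IsBandSeq.toUltra_quot_apply {φ : 𝓢(Rd d, ℂ)} {w : spectralSeq d p q}
    (hw : IsBandSeq s φ w) (ψ : GelfandShilov d) :
    (ExpMod.quot s w).toUltra ψ = ∫ x, φ x * ψ x := by
  rw [ExpMod.toUltra_quot, toDist_apply, hw.seqPair_eq, GelfandShilov.coe_toSchwartz]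

/-! ### The functional attached to an element of the dual space -/

lemma fourier_fourier_apply (u : 𝓢(Rd d, ℂ)) (ξ : Rd d) : 𝓕 (𝓕 u : 𝓢(Rd d, ℂ)) ξ = u (-ξ) := by
  have h := fourierInv_apply_neg (𝓕 u) (-ξ)
  rw [neg_neg, FourierTransform.fourierInv_fourier_eq] at h
  exact h.symm

lemma schwartz_ext_fourier {u v : 𝓢(Rd d, ℂ)} (h : ∀ ξ, 𝓕 u ξ = 𝓕 v ξ) : u = v := by
  rw [← FourierTransform.fourierInv_fourier_eq (F := 𝓢(Rd d, ℂ)) u,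
    ← FourierTransform.fourierInv_fourier_eq (F := 𝓢(Rd d, ℂ)) v]
  congr 1
  exact SchwartzMap.ext h

/-- The double transform is u reflected, and the narrow symbol at -k vanishes off the reflected
cube, where alone it could meet u. This gives the spectra of the representing kernels. -/
lemma band_fourier_eq_zero {k : Fin d → ℤ} {u : 𝓢(Rd d, ℂ)} (hu : tsupport u ⊆ (freqCube k)ᶜ) :
    band .narrow (-k) (𝓕 u) = 0 := by
  refine schwartz_ext_fourier fun ξ => ?_
  have h0 : 𝓕 (0 : 𝓢(Rd d, ℂ)) = 0 := map_zero (fourierCLM ℂ 𝓢(Rd d, ℂ))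
  rw [fourier_band, fourier_fourier_apply, h0, zero_apply]
  by_cases h : -ξ ∈ freqCube k
  · rw [image_eq_zero_of_notMem_tsupport fun h' => hu h' h, mul_zero]
  · simp only [freqCube, Set.mem_ofPred_eq, not_forall, not_le] at h
    obtain ⟨i, hi⟩ := h
    rw [Cutoff.narrow_symb_eq_zero (i := i), Complex.ofReal_zero, zero_mul]
    rw [PiLp.neg_apply] at hi
    rw [Pi.neg_apply, Int.cast_neg, ← abs_neg]
    have : -(2 * Real.pi * ξ i - -(k i : ℝ)) = 2 * Real.pi * -ξ i - k i := by ring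
    rw [this]
    linarith

variable {p' q' : ℝ≥0∞} [Fact (1 ≤ p')] [Fact (1 ≤ q')]
  [ENNReal.HolderConjugate p p'] [ENNReal.HolderConjugate q q']

variable (d s p q p' q') in
/-- Every functional `L` on `E^s_{p,q}` agrees on test functions with an element of
`E^{-s}_{p',q'}`, whose norm is controlled by that of `L`. -/
lemma exists_expMod_of_dual (hp : p ≠ ∞) (hq : q ≠ ∞) : ∃ C : ℝ,
    ∀ L : ExpMod d s p q →L[ℂ] ℂ, ∃ v : ExpMod d (-s) p' q', ‖v‖ ≤ C * ‖L‖ ∧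
      ∀ (φ : GelfandShilov d) (w : spectralSeq d p q), IsBandSeq s φ.toSchwartz w →
        v.toUltra φ = L (ExpMod.quot s w) := by
  set C := ∫ t, ‖(𝓕⁻ (Cutoff.narrow.schw (0 : Fin d → ℤ))) t‖ with hCdef
  have hC0 : 0 ≤ C := by positivity
  refine ⟨C, fun L => ?_⟩
  -- Hahn-Banach from the spectral subspace to the whole sequence space, so that the components act
  -- on all of L^p.
  obtain ⟨Λ, hΛ, hΛnorm⟩ := exists_extension_norm_eq (spectralSeq d p q) (L ∘L ExpMod.quot s)
  have hΛL : ‖Λ‖ ≤ ‖L‖ := by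
    rw [hΛnorm]
    refine ContinuousLinearMap.opNorm_le_bound _ (norm_nonneg _) fun w => ?_
    exact (L.le_opNorm _).trans (mul_le_mul_of_nonneg_left (ExpMod.norm_quot_le w) (norm_nonneg _))
  have hg : ∀ k : Fin d → ℤ, ∃ G : Lp ℂ p' (volume : Measure (Rd d)),
      (∀ ψ, act p' ψ G = component Λ k ((band .narrow k ψ).toLp p)) ∧
        ‖G‖ ≤ C * ‖component Λ k‖ := fun k => by
    obtain ⟨G, h1, h2⟩ := exists_kernel_Lp (p' := p') hp (component Λ k) (Cutoff.narrow.schw k)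
    simp only [norm_fourierInv_schw Cutoff.narrow k] at h2
    exact ⟨G, h1, h2⟩
  choose g hg1 hg2 using hg
  -- The index is reflected: by bilinearity the kernel of the band at k has its spectrum in the cube
  -- at -k.
  obtain ⟨G, hG1, hG2⟩ := exists_lp_of_norm_le_component (q' := q') hq Λ hC0
    (Equiv.neg (Fin d → ℤ)).toEmbedding (fun k => g (-k)) fun k => hg2 (-k)
  have hG : G ∈ spectralSeq d p' q' := mem_spectralSeq.2 fun k => by
    refine hasSpectrumIn_iff.2 fun u hu => ?_
    rw [← act_apply, hG1, hg1, band_fourier_eq_zero hu]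
    have h0 : (0 : 𝓢(Rd d, ℂ)).toLp p volume = 0 :=
      map_zero (SchwartzMap.toLpCLM ℂ ℂ p (volume : Measure (Rd d)))
    rw [h0, map_zero]
  refine ⟨ExpMod.quot (-s) ⟨G, hG⟩, ?_, fun φ w hw => ?_⟩
  · exact (ExpMod.norm_quot_le _).trans (hG2.trans (mul_le_mul_of_nonneg_left hΛL hC0))
  · rw [ExpMod.toUltra_quot, toDist_apply, seqPair]
    -- As q < ∞, w is the ℓ^q sum of its single entries, so Λ is the sum of its components.
    have h1 : L (ExpMod.quot s w) = ∑' k, Λ (lp.single q k (w.1 k)) := by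
      rw [← (Λ.hasSum (lp.hasSum_single hq w.1)).tsum_eq.symm]
      exact (hΛ w).symm
    rw [h1, ← (Equiv.neg (Fin d → ℤ)).tsum_eq]
    refine tsum_congr fun k => ?_
    rw [Equiv.neg_apply, neg_neg, hG1, hg1, neg_neg, weight_neg_index, hw k, ← component_apply]
    have h2 : weight s k • (band .narrow k φ.toSchwartz).toLp p volume =
      (weight s k : ℂ) • (band .narrow k φ.toSchwartz).toLp p volume := (Complex.coe_smul _ _).symm
    rw [h2, map_smul, smul_eq_mul]

end

section

variable {d : ℕ}

/-! ### Gaussian damping -/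

/-- The function `θ(x) exp(-ε‖x‖²)`. -/
def damped (θ : 𝓢(Rd d, ℂ)) (ε : ℝ) (x : Rd d) : ℂ := θ x * Complex.exp (-ε * ‖x‖ ^ 2)

lemma norm_damped (θ : 𝓢(Rd d, ℂ)) (ε : ℝ) (x : Rd d) :
    ‖damped θ ε x‖ = ‖θ x‖ * Real.exp (-ε * ‖x‖ ^ 2) := by
  rw [damped, norm_mul, Complex.norm_exp]
  congr 2
  norm_cast

lemma norm_damped_sub_le (θ : 𝓢(Rd d, ℂ)) {ε : ℝ} (hε : 0 ≤ ε) (x : Rd d) :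
    ‖damped θ ε x - θ x‖ ≤ ε * (‖x‖ ^ 2 * ‖θ x‖) := by
  have h1 : damped θ ε x - θ x = θ x * ((Real.exp (-ε * ‖x‖ ^ 2) - 1 : ℝ) : ℂ) := by
    rw [damped, Complex.ofReal_sub, Complex.ofReal_exp, mul_sub]
    push_cast
    ring
  have h2 : Real.exp (-ε * ‖x‖ ^ 2) ≤ 1 := Real.exp_le_one_iff.2 (by nlinarith [sq_nonneg ‖x‖])
  have h3 := Real.add_one_le_exp (-ε * ‖x‖ ^ 2)
  rw [h1, norm_mul, Complex.norm_real, Real.norm_eq_abs, abs_sub_comm, abs_of_nonneg (by linarith)]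
  calc ‖θ x‖ * (1 - Real.exp (-ε * ‖x‖ ^ 2)) ≤ ‖θ x‖ * (ε * ‖x‖ ^ 2) :=
        mul_le_mul_of_nonneg_left (by linarith) (norm_nonneg _)
    _ = _ := by ring

lemma contDiff_damped (θ : 𝓢(Rd d, ℂ)) (ε : ℝ) : ContDiff ℝ (⊤ : ℕ∞) (damped θ ε) := by
  have h1 : ContDiff ℝ (⊤ : ℕ∞) fun x : Rd d => ((-ε * ‖x‖ ^ 2 : ℝ) : ℂ) :=
    Complex.ofRealCLM.contDiff.comp (contDiff_const.mul (contDiff_norm_sq ℝ))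
  have h2 := (θ.smooth ⊤).mul h1.cexp
  have h3 : damped θ ε = fun x => θ x * Complex.exp ((-ε * ‖x‖ ^ 2 : ℝ) : ℂ) := by
    funext x
    simp only [damped]
    push_cast
    rfl
  rw [h3]
  exact h2

lemma absOne_add_le (x y : Rd d) : absOne (x + y) ≤ absOne x + absOne y := by
  rw [absOne, absOne, absOne, ← Finset.sum_add_distrib]
  exact Finset.sum_le_sum fun i _ => abs_add_le _ _

lemma absOne_le_mul_norm (x : Rd d) : absOne x ≤ d * ‖x‖ := by
  refine (Finset.sum_le_card_nsmul Finset.univ _ ‖x‖ fun i _ => PiLp.norm_apply_le x i).trans ?_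
  simp

/-- The transform of the product is a convolution with a Gaussian, obtained by moving the transform
from θ to the modulated Gaussian in the multiplication formula. -/
lemma norm_fourier_damped_le (θ : 𝓢(Rd d, ℂ)) {ε : ℝ} (hε : 0 < ε) (ξ : Rd d) :
    ‖𝓕 (damped θ ε) ξ‖ ≤ ∫ η, ‖𝓕 θ (-η)‖ *
      ((Real.pi / ε) ^ ((d : ℝ) / 2) * Real.exp (-Real.pi ^ 2 * ‖ξ + η‖ ^ 2 / ε)) := by
  have hre : 0 < ((ε : ℝ) : ℂ).re := by simpa using hε
  set g : Rd d → ℂ := fun x =>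
    Complex.exp (-(ε : ℂ) * ‖x‖ ^ 2 + 2 * Real.pi * Complex.I * (inner ℝ (-ξ) x : ℝ)) with hg
  have hgi : Integrable g volume :=
    GaussianFourier.integrable_cexp_neg_mul_sq_norm_add hre (2 * Real.pi * Complex.I) (-ξ)
  have h1 : 𝓕 (damped θ ε) ξ = ∫ x, 𝓕 (𝓕⁻ θ : 𝓢(Rd d, ℂ)) x * g x := by
    rw [Real.fourier_eq', FourierTransform.fourier_fourierInv_eq]
    refine integral_congr_ae (Eventually.of_forall fun x => ?_)
    simp only [damped, hg, smul_eq_mul]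
    rw [mul_left_comm, ← Complex.exp_add]
    congr 2
    rw [inner_neg_left, real_inner_comm]
    push_cast
    ring
  have h2 : ∫ x, 𝓕 (𝓕⁻ θ : 𝓢(Rd d, ℂ)) x * g x = ∫ η, (𝓕⁻ θ : 𝓢(Rd d, ℂ)) η * 𝓕 g η := by
    have := VectorFourier.integral_fourierIntegral_smul_eq_flip (L := innerₗ (Rd d))
      Real.continuous_fourierChar continuous_inner
      ((𝓕⁻ θ : 𝓢(Rd d, ℂ)).integrable (μ := volume)) hgi
    rw [flip_innerₗ] at this
    exact this
  rw [h1, h2]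
  refine (norm_integral_le_integral_norm _).trans (le_of_eq ?_)
  refine integral_congr_ae (Eventually.of_forall fun η => ?_)
  simp only [norm_mul]
  rw [fourierInv_apply_neg, hg, fourier_gaussian_innerProductSpace' hre, norm_mul,
    finrank_euclideanSpace_fin]
  congr 2
  · rw [← Complex.ofReal_div]
    have : ((d : ℂ) / 2) = (((d : ℝ) / 2 : ℝ) : ℂ) := by push_cast; rfl
    rw [this, ← Complex.ofReal_cpow (by positivity), Complex.norm_real,
      Real.norm_of_nonneg (by positivity)]
  · rw [Complex.norm_exp]
    congr 1
    rw [show -ξ - η = -(ξ + η) by abel, norm_neg]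
    norm_cast

/-- Uniformity in ε is the point. Half of the Gaussian exponent absorbs the growth of the weight
over the displacement ζ + η, and the other half integrates against the prefactor to 2^{d/2},
independently of ε. -/
lemma exists_freq_bound_damped {l : ℝ} (hl : 0 ≤ l) {A : ℝ} {θ : 𝓢(Rd d, ℂ)}
    (hA : ∀ ξ, Real.exp (l * absOne ξ) * ‖angFourier θ ξ‖ ≤ A) :
    ∃ B : ℝ, ∀ ε : ℝ, 0 < ε → ε ≤ 1 →
      ∀ ξ, Real.exp (l * absOne ξ) * ‖angFourier (damped θ ε) ξ‖ ≤ B := by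
  have hA0 : 0 ≤ A := le_trans (by positivity) (hA 0)
  set c := l * (2 * Real.pi) * d with hc
  have hc0 : 0 ≤ c := by positivity
  refine ⟨A * Real.exp (c ^ 2) * 2 ^ ((d : ℝ) / 2), fun ε hε hε1 ξ => ?_⟩
  have hpi := Real.pi_pos
  have hpi3 : 9 ≤ Real.pi ^ 2 := by nlinarith [Real.pi_gt_three]
  set ζ := (2 * Real.pi)⁻¹ • ξ with hζ
  have hξζ : ξ = (2 * Real.pi) • ζ := by rw [hζ, smul_inv_smul₀ (by positivity)]
  have hθ : ∀ η, Real.exp (l * (2 * Real.pi) * absOne η) * ‖𝓕 θ η‖ ≤ A := fun η => by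
    have := hA ((2 * Real.pi) • η)
    rwa [← fourier_eq_angFourier, absOne_smul (by positivity), ← mul_assoc] at this
  have hb : (0 : ℝ) < Real.pi ^ 2 / (2 * ε) := by positivity
  have hgi : Integrable (fun η : Rd d => Real.exp (-(Real.pi ^ 2 / (2 * ε)) * ‖ζ + η‖ ^ 2))
      volume := by
    have h0 : Integrable (fun η : Rd d => Real.exp (-(Real.pi ^ 2 / (2 * ε)) * ‖η‖ ^ 2))
        volume := by
      have := (GaussianFourier.integrable_cexp_neg_mul_sq_norm_add (V := Rd d)
        (b := ((Real.pi ^ 2 / (2 * ε) : ℝ) : ℂ)) (by rwa [Complex.ofReal_re]) 0 0).norm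
      refine this.congr (Eventually.of_forall fun η => ?_)
      simp only [zero_mul, add_zero, Complex.norm_exp]
      congr 1
      norm_cast
    exact h0.comp_add_left ζ
  have hint : ∫ η : Rd d, Real.exp (-(Real.pi ^ 2 / (2 * ε)) * ‖ζ + η‖ ^ 2) =
      (Real.pi / (Real.pi ^ 2 / (2 * ε))) ^ ((d : ℝ) / 2) := by
    rw [integral_add_left_eq_self (μ := (volume : Measure (Rd d)))
      (fun η : Rd d => Real.exp (-(Real.pi ^ 2 / (2 * ε)) * ‖η‖ ^ 2)) ζ,
      GaussianFourier.integral_rexp_neg_mul_sq_norm hb, finrank_euclideanSpace_fin]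
  have hpt : ∀ η : Rd d, Real.exp (l * (2 * Real.pi) * absOne ζ) * (‖𝓕 θ (-η)‖ *
      ((Real.pi / ε) ^ ((d : ℝ) / 2) * Real.exp (-Real.pi ^ 2 * ‖ζ + η‖ ^ 2 / ε))) ≤
      (A * Real.exp (c ^ 2) * (Real.pi / ε) ^ ((d : ℝ) / 2)) *
        Real.exp (-(Real.pi ^ 2 / (2 * ε)) * ‖ζ + η‖ ^ 2) := fun η => by
    have h1 : l * (2 * Real.pi) * absOne ζ ≤
        l * (2 * Real.pi) * absOne (-η) + c * ‖ζ + η‖ := by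
      have h2 := absOne_add_le (ζ + η) (-η)
      rw [add_neg_cancel_right] at h2
      have h3 := absOne_le_mul_norm (ζ + η)
      have h4 : 0 ≤ l * (2 * Real.pi) := by positivity
      calc _ ≤ l * (2 * Real.pi) * (d * ‖ζ + η‖ + absOne (-η)) := by gcongr; linarith
        _ = _ := by rw [hc]; ring
    -- Since ε ≤ 1, the coefficient π²/(2ε) is at least one, and ct ≤ c² + t².
    have h5 : c * ‖ζ + η‖ + -Real.pi ^ 2 * ‖ζ + η‖ ^ 2 / ε ≤
        c ^ 2 + -(Real.pi ^ 2 / (2 * ε)) * ‖ζ + η‖ ^ 2 := by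
      have h6 : -Real.pi ^ 2 * ‖ζ + η‖ ^ 2 / ε = -(Real.pi ^ 2 / (2 * ε)) * ‖ζ + η‖ ^ 2 -
        (Real.pi ^ 2 / (2 * ε)) * ‖ζ + η‖ ^ 2 := by field_simp; ring
      have h7 : 1 ≤ Real.pi ^ 2 / (2 * ε) := by
        rw [le_div_iff₀ (by positivity)]; linarith
      rw [h6]
      nlinarith [sq_nonneg (c - ‖ζ + η‖), mul_le_mul_of_nonneg_right h7 (sq_nonneg ‖ζ + η‖),
        sq_nonneg c, sq_nonneg ‖ζ + η‖]
    calc _ ≤ Real.exp (l * (2 * Real.pi) * absOne (-η) + c * ‖ζ + η‖) * (‖𝓕 θ (-η)‖ *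
      ((Real.pi / ε) ^ ((d : ℝ) / 2) * Real.exp (-Real.pi ^ 2 * ‖ζ + η‖ ^ 2 / ε))) := by gcongr
      _ = (Real.exp (l * (2 * Real.pi) * absOne (-η)) * ‖𝓕 θ (-η)‖) *
        (Real.pi / ε) ^ ((d : ℝ) / 2) *
        Real.exp (c * ‖ζ + η‖ + -Real.pi ^ 2 * ‖ζ + η‖ ^ 2 / ε) := by
          rw [Real.exp_add, Real.exp_add]; ring
      _ ≤ A * (Real.pi / ε) ^ ((d : ℝ) / 2) *
        Real.exp (c ^ 2 + -(Real.pi ^ 2 / (2 * ε)) * ‖ζ + η‖ ^ 2) := by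
          gcongr
          exact hθ (-η)
      _ = _ := by rw [Real.exp_add]; ring
  rw [hξζ, ← fourier_eq_angFourier, absOne_smul (by positivity), ← mul_assoc]
  refine (mul_le_mul_of_nonneg_left (norm_fourier_damped_le θ hε ζ) (Real.exp_pos _).le).trans ?_
  rw [← integral_const_mul]
  refine (integral_mono_of_nonneg (Eventually.of_forall fun η => by positivity)
    (hgi.const_mul _) (Eventually.of_forall hpt)).trans (le_of_eq ?_)
  rw [integral_const_mul, hint, mul_assoc, ← Real.mul_rpow (by positivity) (by positivity)]
  congr 2
  field_simp

lemma exists_space_bound_schwartz (u : 𝓢(Rd d, ℂ)) (n : ℕ) :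
    ∃ P : ℝ, 0 ≤ P ∧ ∀ x, (1 + ‖x‖) ^ n * ‖u x‖ ≤ P := by
  have h : ∀ x, (1 + ‖x‖) ^ n * ‖u x‖ ≤ 2 ^ n *
      (Finset.Iic (n, 0)).sup (fun m => SchwartzMap.seminorm ℝ m.1 m.2) u := fun x => by
    have := SchwartzMap.one_add_le_sup_seminorm_apply (𝕜 := ℝ) (m := (n, 0)) le_rfl le_rfl u x
    rwa [norm_iteratedFDeriv_zero] at this
  exact ⟨_, le_trans (by positivity) (h 0), h⟩

lemma norm_angFourier_sub_le (u v : 𝓢(Rd d, ℂ)) (ξ : Rd d) :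
    ‖angFourier (u - v : 𝓢(Rd d, ℂ)) ξ‖ ≤ ‖angFourier u ξ‖ + ‖angFourier v ξ‖ := by
  simp only [angFourier, ← SchwartzMap.fourier_coe]
  have : 𝓕 (u - v) = 𝓕 u - 𝓕 v := map_sub (fourierCLM ℂ 𝓢(Rd d, ℂ)) u v
  rw [this, sub_apply]
  exact norm_sub_le _ _

/-- The Fourier transform of `θ` decays faster than any exponential. -/
def HasExpFourier (θ : 𝓢(Rd d, ℂ)) : Prop :=
  ∀ l : ℝ, 0 < l → ∃ A : ℝ, ∀ ξ, Real.exp (l * absOne ξ) * ‖angFourier θ ξ‖ ≤ A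

lemma isGelfandShilov_damped {θ : 𝓢(Rd d, ℂ)} (hθ : HasExpFourier θ) {ε : ℝ} (hε : 0 < ε)
    (hε1 : ε ≤ 1) : IsGelfandShilov (damped θ ε) where
  smooth := contDiff_damped θ ε
  decay l hl := by
    obtain ⟨P, hP0, hP⟩ := exists_space_bound_schwartz θ 0
    refine ⟨P * Real.exp ((l * d) ^ 2 / ε), fun x => ?_⟩
    have h0 := hP x
    rw [pow_zero, one_mul] at h0
    rw [norm_damped, mul_left_comm, ← Real.exp_add]
    refine mul_le_mul h0 (Real.exp_le_exp.2 ?_) (Real.exp_pos _).le hP0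
    have h1 := mul_le_mul_of_nonneg_left (absOne_le_mul_norm x) hl.le
    rw [le_div_iff₀ hε]
    nlinarith [sq_nonneg (l * d - ε * ‖x‖), sq_nonneg (l * d), sq_nonneg (ε * ‖x‖)]
  decayFourier l hl := by
    obtain ⟨A, hA⟩ := hθ l hl
    obtain ⟨B, hB⟩ := exists_freq_bound_damped hl.le hA
    exact ⟨B, hB ε hε hε1⟩

/-- Schwartz functions whose Fourier transform decays fast are approximated by Gelfand-Shilov
functions. -/
lemma HasExpFourier.exists_approx {θ : 𝓢(Rd d, ℂ)} (hθ : HasExpFourier θ) {l : ℝ} (hl : 0 < l)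
    {δ : ℝ} (hδ : 0 < δ) : ∃ (φ : GelfandShilov d) (P Q : ℝ),
      DecayBound l P Q (φ.toSchwartz - θ) ∧ Real.sqrt (P * Q) ≤ δ := by
  -- The two extra powers pay for the factor ‖x‖² in the damping error.
  obtain ⟨P, hP0, hP⟩ := exists_space_bound_schwartz θ (2 * (d + 1) + 2)
  obtain ⟨A, hA⟩ := hθ l hl
  obtain ⟨B, hB⟩ := exists_freq_bound_damped hl.le hA
  have hA0 : 0 ≤ A := le_trans (by positivity) (hA 0)
  have hB0 : 0 ≤ B := le_trans (by positivity) (hB 1 one_pos le_rfl 0)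
  set R := P * (B + A) with hR
  have hR0 : 0 ≤ R := by positivity
  set ε := min 1 (δ ^ 2 / (R + 1)) with hε
  have hε0 : 0 < ε := lt_min one_pos (by positivity)
  have hε1 : ε ≤ 1 := min_le_left _ _
  let φ : GelfandShilov d := ⟨damped θ ε, isGelfandShilov_damped hθ hε0 hε1⟩
  -- The spatial constant is linear in ε while the frequency constant only stays bounded; the
  -- geometric mean is still small, and ε was chosen to put its square below δ².
  refine ⟨φ, ε * P, B + A, ⟨fun x => ?_, fun ξ => ?_⟩, Real.sqrt_le_iff.2 ⟨hδ.le, ?_⟩⟩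
  · rw [sub_apply, GelfandShilov.toSchwartz_apply]
    change _ * ‖damped θ ε x - θ x‖ ≤ _
    calc (1 + ‖x‖) ^ (2 * (d + 1)) * ‖damped θ ε x - θ x‖ ≤
          (1 + ‖x‖) ^ (2 * (d + 1)) * (ε * (‖x‖ ^ 2 * ‖θ x‖)) := by
          gcongr; exact norm_damped_sub_le θ hε0.le x
      _ ≤ (1 + ‖x‖) ^ (2 * (d + 1)) * (ε * ((1 + ‖x‖) ^ 2 * ‖θ x‖)) := by
          gcongr; linarith
      _ = ε * ((1 + ‖x‖) ^ (2 * (d + 1) + 2) * ‖θ x‖) := by rw [pow_add]; ring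
      _ ≤ ε * P := mul_le_mul_of_nonneg_left (hP x) hε0.le
  · refine (mul_le_mul_of_nonneg_left (norm_angFourier_sub_le _ _ ξ) (Real.exp_pos _).le).trans ?_
    rw [mul_add, GelfandShilov.coe_toSchwartz]
    exact add_le_add (hB ε hε0 hε1 ξ) (hA ξ)
  · have h1 : ε * (R + 1) ≤ δ ^ 2 := by
      rw [← le_div_iff₀ (by positivity)]; exact min_le_right _ _
    rw [mul_assoc, ← hR]
    nlinarith

lemma HasExpFourier.exists_decayBound {θ : 𝓢(Rd d, ℂ)} (hθ : HasExpFourier θ) {l : ℝ}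
    (hl : 0 < l) : ∃ P Q : ℝ, DecayBound l P Q θ := by
  obtain ⟨P, -, hP⟩ := exists_space_bound_schwartz θ (2 * (d + 1))
  obtain ⟨Q, hQ⟩ := hθ l hl
  exact ⟨P, Q, hP, hQ⟩

lemma hasExpFourier_band (τ : Cutoff) (k : Fin d → ℤ) (ψ : 𝓢(Rd d, ℂ)) :
    HasExpFourier (band τ k ψ) := by
  intro l hl
  obtain ⟨P, hP0, hP⟩ := exists_space_bound_schwartz (𝓕 ψ) 0
  refine ⟨Real.exp (l * (absOneInt k + 3 * d)) * P, fun ξ => ?_⟩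
  have hξ : angFourier (band τ k ψ) ξ = (τ.symb k ((2 * Real.pi)⁻¹ • ξ) : ℂ) *
      𝓕 ψ ((2 * Real.pi)⁻¹ • ξ) := by
    rw [← fourier_band]; rfl
  rw [hξ]
  by_cases h0 : τ.symb k ((2 * Real.pi)⁻¹ • ξ) = 0
  · rw [h0, Complex.ofReal_zero, zero_mul, norm_zero, mul_zero]; positivity
  have h1 : absOne ξ ≤ absOneInt k + 3 * d := by
    have h2 : ∀ i, |ξ i| ≤ |(k i : ℝ)| + 3 := fun i => by
      have h3 : |2 * Real.pi * ((2 * Real.pi)⁻¹ • ξ) i - k i| < 3 := by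
        by_contra h4
        exact h0 (Cutoff.symb_eq_zero (not_lt.1 h4))
      rw [PiLp.smul_apply, smul_eq_mul, mul_inv_cancel_left₀ Real.two_pi_pos.ne'] at h3
      have := abs_sub_abs_le_abs_sub (ξ i) (k i)
      linarith
    calc absOne ξ ≤ ∑ i, (|(k i : ℝ)| + 3) := Finset.sum_le_sum fun i _ => h2 i
      _ = _ := by simp [absOneInt, Finset.sum_add_distrib, mul_comm]
  have h5 := hP ((2 * Real.pi)⁻¹ • ξ)
  rw [pow_zero, one_mul] at h5
  rw [norm_mul, Complex.norm_real, Real.norm_eq_abs]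
  have h6 := τ.abs_symb_le_one k ((2 * Real.pi)⁻¹ • ξ)
  calc _ ≤ Real.exp (l * (absOneInt k + 3 * d)) * (1 * P) := by gcongr
    _ = _ := by rw [one_mul]

end

section

variable {d : ℕ}

/-! ### Overlapping frequency cubes -/

/-- The indices at distance at most `4` from `j`. -/
def near (j : Fin d → ℤ) : Finset (Fin d → ℤ) :=
  -- From distance 5 = 2 + 3 on, the neighbourhood of a cube seen by the pairing misses the support
  -- of the wide symbol.
  Fintype.piFinset fun i => Finset.Icc (j i - 4) (j i + 4)

lemma mem_near {j k : Fin d → ℤ} : k ∈ near j ↔ ∀ i, |k i - j i| ≤ 4 := by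
  simp only [near, Fintype.mem_piFinset, Finset.mem_Icc, abs_le]
  exact forall_congr' fun i => by constructor <;> rintro ⟨h1, h2⟩ <;> constructor <;> linarith

lemma exists_of_notMem_near {j k : Fin d → ℤ} (h : k ∉ near j) : ∃ i, 5 ≤ |k i - j i| := by
  rw [mem_near] at h
  push Not at h
  exact h

lemma sum_near {M : Type*} [AddCommMonoid M] (j : Fin d → ℤ) (f : (Fin d → ℤ) → M) :
    ∑ k ∈ near j, f k = ∑ n ∈ near (0 : Fin d → ℤ), f (n + j) := by
  refine Finset.sum_bij' (fun k _ => k - j) (fun n _ => n + j) ?_ ?_ ?_ ?_ ?_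
  · intro k hk
    rw [mem_near] at hk ⊢
    simpa using hk
  · intro n hn
    rw [mem_near] at hn ⊢
    simpa using hn
  · intro k _; simp
  · intro n _; simp
  · intro k _; simp

lemma band_comm (τ τ' : Cutoff) (k j : Fin d → ℤ) (ψ : 𝓢(Rd d, ℂ)) :
    band τ k (band τ' j ψ) = band τ' j (band τ k ψ) :=
  schwartz_ext_fourier fun ξ => by simp only [fourier_band]; ring

lemma band_narrow_wide_eq_zero {k j : Fin d → ℤ} (h : k ∉ near j) (ψ : 𝓢(Rd d, ℂ)) :
    band .narrow k (band .wide j ψ) = 0 := by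
  obtain ⟨i, hi⟩ := exists_of_notMem_near h
  refine schwartz_ext_fourier fun ξ => ?_
  have h0 : 𝓕 (0 : 𝓢(Rd d, ℂ)) = 0 := map_zero (fourierCLM ℂ 𝓢(Rd d, ℂ))
  rw [fourier_band, fourier_band, h0, zero_apply]
  have h5 : (5 : ℝ) ≤ |(k i : ℝ) - j i| := by exact_mod_cast hi
  by_cases h1 : 1 ≤ |2 * Real.pi * ξ i - k i|
  · rw [Cutoff.narrow_symb_eq_zero h1, Complex.ofReal_zero, zero_mul]
  · have h2 := abs_sub_le (k i : ℝ) (2 * Real.pi * ξ i) (j i)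
    rw [abs_sub_comm (k i : ℝ) (2 * Real.pi * ξ i)] at h2
    rw [Cutoff.symb_eq_zero (τ := .wide) (i := i) (k := j) (by linarith), Complex.ofReal_zero,
      zero_mul, mul_zero]

/-- Every narrow symbol that is non-zero somewhere on the support of the wide one at j has index
near j, so the partition of unity is complete there. -/
lemma sum_band_narrow_wide (j : Fin d → ℤ) (ψ : 𝓢(Rd d, ℂ)) :
    ∑ k ∈ near j, band .narrow k (band .wide j ψ) = band .wide j ψ := by
  refine schwartz_ext_fourier fun ξ => ?_
  have h0 : 𝓕 (∑ k ∈ near j, band .narrow k (band .wide j ψ)) =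
      ∑ k ∈ near j, 𝓕 (band .narrow k (band .wide j ψ)) :=
    map_sum (fourierCLM ℂ 𝓢(Rd d, ℂ)) _ _
  rw [h0, sum_apply]
  simp only [fourier_band]
  rw [← Finset.sum_mul]
  by_cases hw : Cutoff.wide.symb j ξ = 0
  · simp [hw]
  rw [← Complex.ofReal_sum, Cutoff.sum_narrow_symb_of_subset, Complex.ofReal_one, one_mul]
  intro k hk
  by_contra hkj
  obtain ⟨i, hi⟩ := exists_of_notMem_near hkj
  have h5 : (5 : ℝ) ≤ |(k i : ℝ) - j i| := by exact_mod_cast hi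
  refine hw (Cutoff.symb_eq_zero (i := i) ?_)
  have h2 := abs_sub_le (k i : ℝ) (2 * Real.pi * ξ i) (j i)
  rw [abs_sub_comm (k i : ℝ) (2 * Real.pi * ξ i)] at h2
  have := hk i
  linarith

variable {s : ℝ} {p q : ℝ≥0∞} [Fact (1 ≤ p)] [Fact (1 ≤ q)]

lemma bandLp_wide_eq_self (hp : p ≠ ∞) {j : Fin d → ℤ} {f : Lp ℂ p (volume : Measure (Rd d))}
    (hf : HasSpectrumIn f j) : bandLp hp .wide j f = f := by
  refine ext_act fun η => ?_
  rw [act_bandLp, act_apply, act_apply]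
  refine hf.integral_congr fun ξ hξ => ?_
  rw [fourier_band, ← Cutoff.symb_neg, Cutoff.wide_symb_eq_one, Complex.ofReal_one, one_mul]
  intro i
  rw [PiLp.neg_apply, ← abs_neg]
  refine le_of_eq_of_le ?_ (hξ i).le
  congr 1; ring

/-- Insert the wide band operator, which fixes f; the identity then holds on all of L^p by density
of Schwartz functions. -/
lemma sum_bandLp_narrow_eq_self (hp : p ≠ ∞) {j : Fin d → ℤ}
    {f : Lp ℂ p (volume : Measure (Rd d))} (hf : HasSpectrumIn f j) :
    ∑ k ∈ near j, bandLp hp .narrow k f = f := by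
  have key : ∀ g, ∑ k ∈ near j, bandLp hp .narrow k (bandLp hp .wide j g) = bandLp hp .wide j g := by
    refine congrFun ((denseRange_toLp hp).equalizer ?_ (bandLp hp .wide j).continuous
      (funext fun ψ => ?_))
    · exact continuous_finsetSum _ fun k _ =>
        (bandLp hp .narrow k).continuous.comp (bandLp hp .wide j).continuous
    · simp only [Function.comp_apply, bandLp_toLp]
      conv_rhs => rw [← sum_band_narrow_wide]
      exact (map_sum (SchwartzMap.toLpCLM ℂ ℂ p (volume : Measure (Rd d))) _ _).symm
  have := key f
  rwa [bandLp_wide_eq_self hp hf] at this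

/-! ### Functionals are determined by their values on test functions -/

variable (q) in
/-- The sequence whose only non-zero entry is the `k`-th band of `f`, weighted. -/
def bandSingle (hp : p ≠ ∞) (s : ℝ) (k : Fin d → ℤ) :
    Lp ℂ p (volume : Measure (Rd d)) →L[ℂ] spectralSeq d p q :=
  (lp.singleContinuousLinearMap ℂ (fun _ : Fin d → ℤ => Lp ℂ p (volume : Measure (Rd d))) q k ∘L
    ((weight s k : ℂ) • bandLp hp .narrow k)).codRestrict (spectralSeq d p q) fun f => by
      refine mem_spectralSeq.2 fun m => mem_spectral.1 ?_
      change lp.single (E := fun _ : Fin d → ℤ => Lp ℂ p (volume : Measure (Rd d))) q k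
        ((weight s k : ℂ) • bandLp hp .narrow k f) m ∈ _
      rcases eq_or_ne m k with rfl | h
      · rw [lp.single_apply_self]
        exact Submodule.smul_mem _ _ (mem_spectral.2 (hasSpectrumIn_bandLp hp m f))
      · rw [lp.single_apply_ne _ _ _ h]
        exact Submodule.zero_mem _

lemma coe_bandSingle (hp : p ≠ ∞) (k : Fin d → ℤ) (f : Lp ℂ p (volume : Measure (Rd d))) :
    (bandSingle q hp s k f).1 = lp.single q k (weight s k • bandLp hp .narrow k f) := by
  have h : weight s k • bandLp hp .narrow k f = (weight s k : ℂ) • bandLp hp .narrow k f :=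
    (Complex.coe_smul _ _).symm
  rw [h]
  rfl

lemma sum_bandSingle_apply (hp : p ≠ ∞) (S : Finset (Fin d → ℤ)) (m : Fin d → ℤ)
    (f : Lp ℂ p (volume : Measure (Rd d))) : (∑ k ∈ S, bandSingle q hp s k f).1 m =
      if m ∈ S then weight s m • bandLp hp .narrow m f else 0 := by
  rw [Submodule.coe_sum, lp.coeFn_sum, Finset.sum_apply]
  simp only [coe_bandSingle, lp.coeFn_single]
  rw [Finset.sum_pi_single]

/-- The band sequence of a wide band is finite and continuous in the L^p function, which allows the
passage from Schwartz functions to L^p. -/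
lemma isBandSeq_sum_bandSingle (hp : p ≠ ∞) (j : Fin d → ℤ) (ψ : 𝓢(Rd d, ℂ)) :
    IsBandSeq s (band .wide j ψ)
      (∑ k ∈ near j, bandSingle q hp s k ((band .wide j ψ).toLp p)) := fun m => by
  rw [sum_bandSingle_apply]
  split_ifs with h
  · rw [bandLp_toLp]
  · have h0 : (0 : 𝓢(Rd d, ℂ)).toLp p volume = 0 :=
      map_zero (SchwartzMap.toLpCLM ℂ ℂ p (volume : Measure (Rd d)))
    rw [band_narrow_wide_eq_zero h, h0, smul_zero]

lemma toDist_sum_bandSingle (hp : p ≠ ∞) (S : Finset (Fin d → ℤ))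
    (f : Lp ℂ p (volume : Measure (Rd d))) (φ : GelfandShilov d) :
    toDist s (∑ k ∈ S, bandSingle q hp s k f) φ =
      act p φ.toSchwartz (∑ k ∈ S, bandLp hp .narrow k f) := by
  rw [toDist_apply, seqPair, tsum_eq_sum (s := S) fun m hm => ?_, map_sum]
  · refine Finset.sum_congr rfl fun m hm => ?_
    rw [sum_bandSingle_apply, if_pos hm, weight_mul_act_weight_smul]
  · rw [sum_bandSingle_apply, if_neg hm, map_zero, mul_zero]

lemma toDist_of_eq_single {j : Fin d → ℤ} {f : Lp ℂ p (volume : Measure (Rd d))}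
    {w : spectralSeq d p q} (hw : w.1 = lp.single q j (weight s j • f)) (φ : GelfandShilov d) :
    toDist s w φ = act p φ.toSchwartz f := by
  rw [toDist_apply, seqPair, hw, tsum_eq_single j fun m hm => ?_]
  · rw [lp.single_apply_self, weight_mul_act_weight_smul]
  · rw [lp.single_apply_ne _ _ _ hm, map_zero, mul_zero]

/-- A functional on `E^s_{p,q}` vanishing on the test functions. -/
def VanishesOnTest (L : ExpMod d s p q →L[ℂ] ℂ) : Prop :=
  ∀ (φ : GelfandShilov d) (w : spectralSeq d p q), IsBandSeq s φ.toSchwartz w →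
    L (ExpMod.quot s w) = 0

/-- θ need not be a test function, but damped versions of it are, and the band sequence of the error
is small in `ℓ^q(L^p)`. -/
lemma VanishesOnTest.apply_of_hasExpFourier {L : ExpMod d s p q →L[ℂ] ℂ}
    (hL : VanishesOnTest L) {θ : 𝓢(Rd d, ℂ)} (hθ : HasExpFourier θ) {w : spectralSeq d p q}
    (hw : IsBandSeq s θ w) : L (ExpMod.quot s w) = 0 := by
  obtain ⟨C, hC0, hC⟩ := exists_isBandSeq p q d s
  have key : ∀ δ : ℝ, 0 < δ → ‖L (ExpMod.quot s w)‖ ≤ ‖L‖ * C * δ := fun δ hδ => by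
    obtain ⟨φ, P, Q, hPQ, hle⟩ := hθ.exists_approx (rate s).2 hδ
    obtain ⟨v, hv, hvn⟩ := hC _ _ _ hPQ
    obtain ⟨u, hu, -⟩ := hC _ _ _ (φ.decayBound (rate s))
    have h1 : v = u - w := hv.unique (hu.sub hw)
    have h2 : L (ExpMod.quot s w) = -L (ExpMod.quot s v) := by
      rw [h1, map_sub, map_sub, hL φ u hu, zero_sub, neg_neg]
    rw [h2, norm_neg]
    refine (L.le_opNorm _).trans ?_
    rw [mul_assoc]
    refine mul_le_mul_of_nonneg_left ?_ (norm_nonneg _)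
    exact (ExpMod.norm_quot_le v).trans (hvn.trans (mul_le_mul_of_nonneg_left hle hC0))
  have hlim : Tendsto (fun δ : ℝ => ‖L‖ * C * δ) (𝓝[>] 0) (𝓝 (‖L‖ * C * 0)) :=
    ((continuous_const.mul continuous_id).tendsto 0).mono_left nhdsWithin_le_nhds
  rw [mul_zero] at hlim
  exact norm_le_zero_iff.1 (ge_of_tendsto hlim (eventually_mem_nhdsWithin.mono key))

/-- The one-entry sequence and the splitting of f into narrow bands represent the same element. The
splitting is continuous in f, and on wide bands of Schwartz functions it is a band sequence, where L
vanishes. -/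
lemma VanishesOnTest.apply_single (hp : p ≠ ∞) {L : ExpMod d s p q →L[ℂ] ℂ}
    (hL : VanishesOnTest L) {j : Fin d → ℤ} {f : Lp ℂ p (volume : Measure (Rd d))}
    (hf : HasSpectrumIn f j) {w : spectralSeq d p q}
    (hw : w.1 = lp.single q j (weight s j • f)) : L (ExpMod.quot s w) = 0 := by
  have key : ∀ g, L (ExpMod.quot s (∑ k ∈ near j, bandSingle q hp s k (bandLp hp .wide j g))) =
      0 := by
    refine congrFun ((denseRange_toLp hp).equalizer ?_ continuous_const (funext fun ψ => ?_))
    · refine L.continuous.comp ((ExpMod.quot s).continuous.comp ?_)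
      exact continuous_finsetSum _ fun k _ =>
        (bandSingle q hp s k).continuous.comp (bandLp hp .wide j).continuous
    · simp only [Function.comp_apply, bandLp_toLp]
      exact hL.apply_of_hasExpFourier (hasExpFourier_band _ _ _) (isBandSeq_sum_bandSingle hp j ψ)
  have h1 := key f
  rw [bandLp_wide_eq_self hp hf] at h1
  have h2 : ExpMod.quot s w = ExpMod.quot s (∑ k ∈ near j, bandSingle q hp s k f) := by
    refine ExpMod.ext_apply fun φ => ?_
    rw [ExpMod.toUltra_quot, ExpMod.toUltra_quot, toDist_of_eq_single hw,
      toDist_sum_bandSingle, sum_bandLp_narrow_eq_self hp hf]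
  rw [h2, h1]

/-- For q < ∞ a sequence is the sum of its one-entry parts, each of which is killed by L. -/
lemma VanishesOnTest.eq_zero (hp : p ≠ ∞) (hq : q ≠ ∞) {L : ExpMod d s p q →L[ℂ] ℂ}
    (hL : VanishesOnTest L) : L = 0 := by
  ext u
  obtain ⟨w, rfl⟩ := ExpMod.quot_surjective u
  rw [zero_apply]
  have hmem : ∀ k, lp.single q k (w.1 k) ∈ spectralSeq d p q := fun k =>
    mem_spectralSeq.2 fun m => mem_spectral.1 <| by
      rcases eq_or_ne m k with rfl | h
      · rw [lp.single_apply_self]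
        exact mem_spectral.2 (mem_spectralSeq.1 w.2 m)
      · rw [lp.single_apply_ne _ _ _ h]
        exact Submodule.zero_mem _
  have hsum : HasSum (fun k => (⟨_, hmem k⟩ : spectralSeq d p q)) w := by
    rw [← Topology.IsInducing.subtypeVal.hasSum_iff (g := (spectralSeq d p q).subtype)]
    exact lp.hasSum_single hq w.1
  have h1 := (L ∘L ExpMod.quot s).hasSum hsum
  refine h1.unique ?_
  convert hasSum_zero (α := ℂ) with k
  have hf : HasSpectrumIn (weight (-s) k • w.1 k) k := by
    rw [← mem_spectral]
    exact Submodule.smul_of_tower_mem _ _ (mem_spectral.2 (mem_spectralSeq.1 w.2 k))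
  refine hL.apply_single hp hf ?_
  rw [smul_smul, weight_mul_neg, one_smul]

end

section

variable {d : ℕ} {s : ℝ} {p q : ℝ≥0∞} [Fact (1 ≤ p)] [Fact (1 ≤ q)]

/-! ### The functional defined by an element of `E^{-s}_{p',q'}` -/

/-- Reindexing on `ℓ^q`, `q < ∞`. -/
def reindex {ι E : Type*} [NormedAddCommGroup E] [NormedSpace ℂ E] (hq : q ≠ ∞) (σ : ι ≃ ι) :
    lp (fun _ : ι => E) q →L[ℂ] lp (fun _ : ι => E) q :=
  have hq0 : 0 < q.toReal :=
    ENNReal.toReal_pos (zero_lt_one.trans_le (Fact.out : 1 ≤ q)).ne' hq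
  LinearMap.mkContinuous
    { toFun := fun w => ⟨fun i => w (σ i), memℓp_gen
        (σ.summable_iff.2 ((lp.memℓp w).summable hq0))⟩
      map_add' := fun _ _ => rfl
      map_smul' := fun _ _ => rfl } 1 fun w => by
        rw [one_mul, lp.norm_eq_tsum_rpow hq0, lp.norm_eq_tsum_rpow hq0]
        exact le_of_eq (congrArg (· ^ (1 / q.toReal)) (σ.tsum_eq fun i => ‖w i‖ ^ q.toReal))

/-- By the reverse triangle inequality the ratio of weights at indices differing by n, up to
reflection, is bounded uniformly in m. -/
lemma weight_mul_weight_le (s : ℝ) (m n : Fin d → ℤ) :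
    weight s m * weight (-s) (n + -m) ≤ weight |s| n := by
  rw [weight, weight, weight, ← Real.rpow_add two_pos]
  refine Real.rpow_le_rpow_of_exponent_le one_le_two ?_
  have h1 := absOneInt_add_le n (-m)
  have h2 := absOneInt_add_le (-n) (n + -m)
  rw [neg_add_cancel_left, absOneInt_neg, absOneInt_neg] at h2
  rw [absOneInt_neg] at h1
  have h3 : |absOneInt m - absOneInt (n + -m)| ≤ absOneInt n := abs_le.2 ⟨by linarith, by linarith⟩
  calc s * absOneInt m + -s * absOneInt (n + -m) = s * (absOneInt m - absOneInt (n + -m)) := by ring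
    _ ≤ |s * (absOneInt m - absOneInt (n + -m))| := le_abs_self _
    _ ≤ |s| * absOneInt n := by rw [abs_mul]; gcongr

/-- The operator with components `m ↦ 2^{s|m|} 2^{-s|n-m|} B_{-m} w_{n-m}`, where `B_{-m}` is the
wide band operator. -/
def shiftBand (hp : p ≠ ∞) (hq : q ≠ ∞) (s : ℝ) (n : Fin d → ℤ) :
    SeqLp d p q →L[ℂ] SeqLp d p q :=
  lp.mapCLM q
    (fun m => ((weight s m * weight (-s) (n + -m) : ℝ) : ℂ) • bandLp (p := p) hp .wide (-m))
    (K := weight |s| n * ∫ t, ‖(𝓕⁻ (Cutoff.wide.schw (0 : Fin d → ℤ))) t‖)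
    (mul_nonneg (weight_pos _ _).le (by positivity))
    (fun m => by
      have h0 := mul_pos (weight_pos s m) (weight_pos (-s) (n + -m))
      rw [norm_smul, Complex.norm_real, Real.norm_of_nonneg h0.le]
      exact mul_le_mul (weight_mul_weight_le s m n) (norm_bandLp_le hp _ _) (norm_nonneg _)
        (weight_pos _ _).le) ∘L
  reindex hq ((Equiv.neg (Fin d → ℤ)).trans (Equiv.addLeft n))

/-- The sum of the entries of `w` that overlap with the frequency cube of index `m`, cut off
around that cube. -/
def localPart (hp : p ≠ ∞) (s : ℝ) (w : SeqLp d p q) (m : Fin d → ℤ) :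
    Lp ℂ p (volume : Measure (Rd d)) :=
  ∑ k ∈ near m, (weight (-s) k : ℂ) • bandLp hp .wide m (w k)

/-- The sequence of weighted local parts, with reflected index. -/
def localSeq (hp : p ≠ ∞) (hq : q ≠ ∞) (s : ℝ) : SeqLp d p q →L[ℂ] SeqLp d p q :=
  ∑ n ∈ near (0 : Fin d → ℤ), shiftBand hp hq s n

lemma localSeq_apply (hp : p ≠ ∞) (hq : q ≠ ∞) (w : SeqLp d p q) (m : Fin d → ℤ) :
    localSeq hp hq s w m = (weight s m : ℂ) • localPart hp s w (-m) := by
  rw [localSeq, localPart, sum_near (-m), sum_apply, lp.coeFn_sum, Finset.sum_apply, Finset.smul_sum]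
  refine Finset.sum_congr rfl fun n _ => ?_
  rw [smul_smul, ← Complex.ofReal_mul]
  rfl

/-- The local part is the wide band at m of the distribution represented by w: distant entries do
not pair with θ, a band of η. Since θ is approximated by test functions, on which that distribution
vanishes, every pairing is zero. -/
lemma localPart_eq_zero (hp : p ≠ ∞) {w : spectralSeq d p q} (hw : ExpMod.quot s w = 0)
    (m : Fin d → ℤ) : localPart hp s w.1 m = 0 := by
  refine ext_act fun η => ?_
  set θ := band Cutoff.wide.reflect (-m) η with hθdef
  have hθ : HasExpFourier θ := hasExpFourier_band _ _ _
  have h1 : act p η (localPart hp s w.1 m) = seqPair s w.1 θ := by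
    rw [localPart, map_sum, seqPair, tsum_eq_sum (s := near m) fun k hk => ?_]
    · refine Finset.sum_congr rfl fun k _ => ?_
      rw [map_smul, act_bandLp, smul_eq_mul]
    · obtain ⟨i, hi⟩ := exists_of_notMem_near hk
      rw [act_apply, hθdef, (mem_spectralSeq.1 w.2 k).integral_band_eq_zero _ (i := i), mul_zero]
      rwa [Pi.neg_apply, neg_add_eq_sub]
  rw [h1, map_zero]
  obtain ⟨C, hC0, hC⟩ := exists_norm_seqPair_le p q d s
  have key : ∀ δ : ℝ, 0 < δ → ‖seqPair s w.1 θ‖ ≤ C * ‖w.1‖ * δ := fun δ hδ => by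
    obtain ⟨φ, P, Q, hPQ, hle⟩ := hθ.exists_approx (rate s).2 hδ
    obtain ⟨P', Q', hPQ'⟩ := hθ.exists_decayBound (rate s).2
    have h2 : seqPair s w.1 φ.toSchwartz = 0 := by
      rw [← toDist_apply, ← ExpMod.toUltra_quot, hw, map_zero, zero_apply]
    have h3 : seqPair s w.1 (φ.toSchwartz - θ) =
        seqPair s w.1 φ.toSchwartz - seqPair s w.1 θ := by
      rw [seqPair, seqPair, seqPair, ← (summable_seqPair w.2 (φ.decayBound (rate s))).tsum_sub
        (summable_seqPair w.2 hPQ')]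
      simp only [map_sub, sub_apply, mul_sub]
    rw [← norm_neg, ← zero_sub, ← h2, ← h3]
    refine (hC w.1 w.2 _ _ _ hPQ).trans ?_
    rw [mul_assoc]
    gcongr
  have hlim : Tendsto (fun δ : ℝ => C * ‖w.1‖ * δ) (𝓝[>] 0) (𝓝 (C * ‖w.1‖ * 0)) :=
    ((continuous_const.mul continuous_id).tendsto 0).mono_left nhdsWithin_le_nhds
  rw [mul_zero] at hlim
  exact norm_le_zero_iff.1 (ge_of_tendsto hlim (eventually_mem_nhdsWithin.mono key))

/-- Narrow and wide bands commute, and the narrow ones near m sum to the identity on a wide band at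
m. -/
lemma IsBandSeq.localPart_eq (hp : p ≠ ∞) {φ : 𝓢(Rd d, ℂ)} {w : spectralSeq d p q}
    (hw : IsBandSeq s φ w) (m : Fin d → ℤ) :
    localPart hp s w.1 m = (band .wide m φ).toLp p := by
  have h1 : ∀ k, (weight (-s) k : ℂ) • bandLp hp .wide m (w.1 k) =
      (band .narrow k (band .wide m φ)).toLp p := fun k => by
    rw [hw k]
    have h : weight s k • (band .narrow k φ).toLp p volume =
      (weight s k : ℂ) • (band .narrow k φ).toLp p volume := (Complex.coe_smul _ _).symm
    rw [h, map_smul, smul_smul, ← Complex.ofReal_mul, weight_neg_mul, Complex.ofReal_one, one_smul,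
      bandLp_toLp, band_comm]
  rw [localPart, Finset.sum_congr rfl fun k _ => h1 k]
  conv_rhs => rw [← sum_band_narrow_wide]
  exact (map_sum (SchwartzMap.toLpCLM ℂ ℂ p (volume : Measure (Rd d))) _ _).symm

/-- By the open mapping theorem a continuous surjection of Banach spaces is a quotient map, so the
set-theoretic factor is continuous. -/
lemma exists_factor_of_surjective {E F : Type*} [NormedAddCommGroup E] [NormedSpace ℂ E]
    [CompleteSpace E] [NormedAddCommGroup F] [NormedSpace ℂ F] [CompleteSpace F] (π : E →L[ℂ] F)
    (hπ : Function.Surjective π) (T : E →L[ℂ] ℂ) (hT : ∀ w, π w = 0 → T w = 0) :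
    ∃ L : F →L[ℂ] ℂ, ∀ w, L (π w) = T w := by
  have hT' : ∀ w v, π w = π v → T w = T v := fun w v h => by
    rw [← sub_eq_zero, ← map_sub]
    exact hT _ (by rw [map_sub, h, sub_self])
  choose r hr using id hπ
  have hquot : ∀ w, T (r (π w)) = T w := fun w => hT' _ _ (hr _)
  have hcont : Continuous fun u => T (r u) := by
    rw [(π.isQuotientMap hπ).continuous_iff]
    exact T.continuous.congr fun w => (hquot w).symm
  exact ⟨⟨⟨⟨fun u => T (r u), fun u v => by
    rw [← map_add]; exact hT' _ _ (by rw [map_add, hr, hr, hr])⟩, fun c u => by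
    rw [RingHom.id_apply, ← map_smul]; exact hT' _ _ (by rw [map_smul, hr, hr])⟩, hcont⟩, hquot⟩

variable {p' q' : ℝ≥0∞} [Fact (1 ≤ p')] [Fact (1 ≤ q')]
  [ENNReal.HolderConjugate p p'] [ENNReal.HolderConjugate q q']

lemma exists_dual_of_expMod (hp : p ≠ ∞) (hq : q ≠ ∞) (v : ExpMod d (-s) p' q') :
    ∃ L : ExpMod d s p q →L[ℂ] ℂ, ∀ (φ : GelfandShilov d) (w : spectralSeq d p q),
      IsBandSeq s φ.toSchwartz w → L (ExpMod.quot s w) = v.toUltra φ := by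
  obtain ⟨g, rfl⟩ := ExpMod.quot_surjective v
  have hK : ‖pair (d := d) p p'‖ ≤ (1 : NNReal) := by
    refine ContinuousLinearMap.opNorm_le_bound₂ _ zero_le_one fun f h => ?_
    rw [NNReal.coe_one, one_mul]
    exact norm_pair_le f h
  -- Pair the entry of g at m with the wide band at -m. The wide band depends only on the
  -- represented distribution, so T descends; on test functions the cutoff is invisible to an entry
  -- with spectrum at m, and T returns the value of v.
  let T : spectralSeq d p q →L[ℂ] ℂ :=
    (lp.dualPairing q q' (fun _ : Fin d → ℤ => pair (d := d) p p') (fun _ => hK)).flip g.1 ∘L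
      localSeq hp hq s ∘L (spectralSeq d p q).subtypeL
  have hT : ∀ w, T w = ∑' m, pair p p' ((weight s m : ℂ) • localPart hp s w.1 (-m)) (g.1 m) :=
    fun w => by
      simp only [← localSeq_apply hp hq]
      rfl
  have hker : ∀ w : spectralSeq d p q, ExpMod.quot s w = 0 → T w = 0 := fun w hw => by
    rw [hT]
    simp only [localPart_eq_zero hp hw, smul_zero, map_zero, zero_apply, tsum_zero]
  obtain ⟨L, hL⟩ := exists_factor_of_surjective (E := spectralSeq d p q) (F := ExpMod d s p q)
    (ExpMod.quot s) ExpMod.quot_surjective T hker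
  refine ⟨L, fun φ w hw => ?_⟩
  rw [hL, hT, ExpMod.toUltra_quot, toDist_apply, seqPair]
  refine tsum_congr fun m => ?_
  rw [hw.localPart_eq hp, map_smul, smul_apply, smul_eq_mul, neg_neg, toLp_pair, act_apply,
    (mem_spectralSeq.1 g.2 m).integral_eq_band]
  simp only [mul_comm]

variable (d s p q p' q') in
/-- The duality between `E^s_{p,q}` and `E^{-s}_{p',q'}`. -/
lemma exists_duality (hp : p ≠ ∞) (hq : q ≠ ∞) :
    ∃ J : (ExpMod d s p q →L[ℂ] ℂ) ≃L[ℂ] ExpMod d (-s) p' q',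
      ∀ (L : ExpMod d s p q →L[ℂ] ℂ) (φ : GelfandShilov d) (w : spectralSeq d p q),
        IsBandSeq s φ.toSchwartz w → (J L).toUltra φ = L (ExpMod.quot s w) := by
  obtain ⟨C, hC⟩ := exists_expMod_of_dual d s p q p' q' hp hq
  choose v hvn hv using hC
  obtain ⟨_, -, hband⟩ := exists_isBandSeq p q d s
  have hex : ∀ φ : GelfandShilov d, ∃ w : spectralSeq d p q, IsBandSeq s φ.toSchwartz w :=
    fun φ => let ⟨w, hw, _⟩ := hband _ _ _ (φ.decayBound (rate s)); ⟨w, hw⟩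
  let J₀ : (ExpMod d s p q →L[ℂ] ℂ) →L[ℂ] ExpMod d (-s) p' q' :=
    LinearMap.mkContinuous
      { toFun := v
        map_add' := fun L M => ExpMod.ext_apply fun φ => by
          obtain ⟨w, hw⟩ := hex φ
          rw [map_add, add_apply, hv _ φ w hw, hv _ φ w hw, hv _ φ w hw, add_apply]
        map_smul' := fun c L => ExpMod.ext_apply fun φ => by
          obtain ⟨w, hw⟩ := hex φ
          rw [map_smul, smul_apply, hv _ φ w hw, hv _ φ w hw, smul_apply]; rfl } C hvn
  have hker : J₀.ker = ⊥ := by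
    rw [LinearMap.ker_eq_bot']
    intro L hL
    have hL' : v L = 0 := hL
    refine VanishesOnTest.eq_zero hp hq fun φ w hw => ?_
    rw [← hv L φ w hw, hL', map_zero, zero_apply]
  have hrange : J₀.range = ⊤ := by
    rw [LinearMap.range_eq_top]
    intro u
    obtain ⟨L, hL⟩ := exists_dual_of_expMod (p := p) (q := q) hp hq u
    refine ⟨L, ExpMod.ext_apply fun φ => ?_⟩
    obtain ⟨w, hw⟩ := hex φ
    exact (hv L φ w hw).trans (hL φ w hw)
  -- Both spaces are complete, so the open mapping theorem gives the continuity of the inverse.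
  refine ⟨ContinuousLinearEquiv.ofBijective J₀ hker hrange, fun L φ w hw => ?_⟩
  rw [ContinuousLinearEquiv.coeFn_ofBijective]
  exact hv L φ w hw

end

end ExpModulation

end

/-! ### Duality and completeness -/

open ExpModulation in
theorem proposition5p6 (d : ℕ) (s : ℝ) :
    -- duality
    (∀ (p q p' q' : ℝ≥0∞) [Fact (1 ≤ p)] [Fact (1 ≤ q)] [Fact (1 ≤ p')] [Fact (1 ≤ q')],
      ENNReal.HolderConjugate p p' → ENNReal.HolderConjugate q q' → p ≠ ∞ → q ≠ ∞ →
      ∃ J : (ExpMod d s p q →L[ℂ] ℂ) ≃L[ℂ] ExpMod d (-s) p' q',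
        ∀ φ : GelfandShilov d, ∃ h : ExpMod d s p q,
          (∀ ψ : GelfandShilov d, h.toUltra ψ = ∫ x, φ x * ψ x) ∧
          ∀ L : ExpMod d s p q →L[ℂ] ℂ, (J L).toUltra φ = L h) ∧
    -- completeness of the norm
    (∀ (p q : ℝ≥0∞) [Fact (1 ≤ p)] [Fact (1 ≤ q)],
      (∀ u : ExpMod d s p q, ‖u‖ = 0 ↔ u = 0) ∧ CompleteSpace (ExpMod d s p q)) := by
  refine ⟨?_, fun p q => ⟨ExpMod.norm_eq_zero_iff, inferInstance⟩⟩
  intro p q p' q' _ _ _ _ hpp hqq hp hq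
  obtain ⟨J, hJ⟩ := exists_duality d s p q p' q' hp hq
  obtain ⟨_, -, hband⟩ := exists_isBandSeq p q d s
  refine ⟨J, fun φ => ?_⟩
  obtain ⟨w, hw, -⟩ := hband _ _ _ (φ.decayBound (rate s))
  refine ⟨ExpMod.quot s w, fun ψ => ?_, fun L => hJ L φ w hw⟩
  rw [hw.toUltra_quot_apply, GelfandShilov.coe_toSchwartz]
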